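/- Let $G$ be a connected, simply connected Lie group whose Lie algebra $\mathfrak g$ is completely solvable (solvable, with every $\mathrm{ad}\,Z$ having only real eigenvalues), and suppose $G=P\rtimes M$ where $P=\exp\mathfrak p$ (normal) and $M=\exp\mathfrak m$ are closed subgroups and $\mathfrak g=\mathfrak p\oplus\mathfrak m$ with $\mathfrak p$ an ideal and $\mathfrak m$ a subalgebra. Fix a left Haar measure $\mu_M$ on $M$. Let $\lambda\in\mathfrak p^*$ be such that $\chi_\lambda(\exp X)=e^{2\pi i\lambda(X)}$ is a continuous unitary character of $P$ and the induced representation $\pi_\lambda=\mathrm{ind}_P^G\chi_\lambda$, realized in $L^2(M,\mu_M)$ by $$[\pi_\lambda(pn)\mathbf f](m)=\chi_\lambda(m^{-1}pm)\,\mathbf f(n^{-1}m)\qquad(p\in P,\ n,m\in M),$$ is irreducible. Let $(X_1,\dots,X_{n_1})$ and $(A_1,\dots,A_{n_2})$ be strong Malcev bases of $\mathfrak p$ and $\mathfrak m$ (all initial spans are ideals of $\mathfrak p$, resp. $\mathfrak m$). For $a\in\mathbb R^{n_2}$ put $\mathbf e(a)=\exp(a_1A_1)\cdots\exp(a_{n_2}A_{n_2})$,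 $\mathbf C(a)=e^{-\mathrm{ad}(a_{n_2}A_{n_2})}\cdots e^{-\mathrm{ad}(a_1A_1)}|_{\mathfrak p}$ and $\theta_\lambda(a)=\mathbf C(a)^*\lambda\in\mathfrak p^*$. Let $J=(j_1<\dots<j_{n_2})$ be such that the rows $j_1,\dots,j_{n_2}$ of the Jacobian matrix of $\theta_\lambda$ at $0$ (in the bases $(A_k)$, $(X_j^*)$) form an invertible matrix, and let $\beta_J(a)=\sum_{j\in J}\theta_\lambda(a)(X_j)\,X_j^*\in V_J^*:=\sum_{j\in J}\mathbb RX_j^*$. Let $\mathcal O\subset\mathbb R^{n_2}$ be an open neighbourhood of $0$ on which $\beta_J$ is a diffeomorphism onto an open set, let $\epsilon>0$ with $[-\frac\epsilon2,\frac\epsilon2]^{n_2}\subset\mathcal O$, and put $\mathcal O_\epsilon=(-\frac\epsilon2,\frac\epsilon2)^{n_2}$, $\Omega_\epsilon^\circ=\mathbf e(\mathcal O_\epsilon)\subset M$. Define $\Phi:\Omega_\epsilon^\circ\to\beta_J(\mathcal O_\epsilon)$ by $\Phi(\mathbf e(a))=\beta_J(a)$, and let $\Psi$ be the continuous positive function on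 $\beta_J(\mathcal O_\epsilon)$ with $\Psi(\xi)\,d\xi=d\mu_M(\Phi^{-1}(\xi))$, where $d\xi$ is Lebesgue measure in the coordinates given by $(X_j^*)_{j\in J}$. Let $\mathbf s\in C_c^\infty(M)$ be supported in a compact subset of $\Omega_\epsilon^\circ$. Let $\mathcal L$ be an invertible linear operator of $\sum_{j\in J}\mathbb RX_j$, with inverse transpose $\mathcal L^\top$, such that $\Phi(\mathrm{supp}\,\mathbf s)$ is contained in a fundamental domain of the lattice $\Lambda^\star=\sum_{j\in J}\mathbb Z\,\mathcal L^\top X_j^*$ of $V_J^*$, and put $\Gamma_P=\exp\big(\sum_{j\in J}\mathbb Z\,\mathcal LX_j\big)\subset P$. Let $$\Upsilon(m)=\sqrt{\Psi(\Phi(m))\,|\det\mathcal L^\top|}\;\mathbf s(m)\quad(m\in\Omega_\epsilon^\circ),\qquad \Upsilon=0\text{ elsewhere on }M,$$ and let $\Gamma_M\subset M$ be a discrete set with $$A:=\inf_{m\in M}\sum_{\gamma\in\Gamma_M}|\Upsilon(\gamma m)|^2>0,\qquad B:=\sup_{m\in M}\sum_{\gamma\in\Gamma_M}|\Upsilon(\gamma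 m)|^2<\infty.$$ Then, with $\Gamma=\Gamma_M^{-1}\Gamma_P$, the family $(\pi_\lambda(\kappa)\mathbf s)_{\kappa\in\Gamma}$ is a frame for $L^2(M,\mu_M)$, that is, there are constants $0<a\le b$ with $$a\|\mathbf h\|^2\le\sum_{\kappa\in\Gamma}|\langle\mathbf h,\pi_\lambda(\kappa)\mathbf s\rangle|^2\le b\|\mathbf h\|^2\qquad\text{for all }\mathbf h\in L^2(M,\mu_M);$$ moreover the largest possible lower bound $a$ is $A$ and the smallest possible upper bound $b$ is $B$. -/

import Mathlib

open MeasureTheory Set Filter Topology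
open scoped Manifold ContDiff Matrix Pointwise ENNReal InnerProductSpace

noncomputable section

namespace SolvFrame

/-! ### Lie groups, exponential map, completely solvable Lie algebras -/

/-- The regularity that Mathlib asks for in order to form the Lie algebra of a Lie group holds for
every smooth real Lie group. -/
instance instLieGroupMin {d : ℕ} {G : Type*} [TopologicalSpace G]
    [ChartedSpace (EuclideanSpace ℝ (Fin d)) G] [Group G] [LieGroup (𝓡 d) ∞ G] :
    LieGroup (𝓡 d) (minSmoothness ℝ 3) G :=
  LieGroup.of_le (n := ∞) (by
    rw [minSmoothness_of_isRCLikeNormedField]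
    exact ENat.LEInfty.out)

instance instFiniteLieAlgebra {d : ℕ} {G : Type*} [TopologicalSpace G]
    [ChartedSpace (EuclideanSpace ℝ (Fin d)) G] [Group G] :
    Module.Finite ℝ (GroupLieAlgebra (𝓡 d) G) :=
  inferInstanceAs (Module.Finite ℝ (EuclideanSpace ℝ (Fin d)))

section LieGroup

variable {d : ℕ} {G : Type*} [TopologicalSpace G] [ChartedSpace (EuclideanSpace ℝ (Fin d)) G]
  [Group G]

/-- The exponential map of the Lie group `G`: `exp X` is the value at time `1` of the global
integral curve, starting at `1`, of the left-invariant vector field defined by `X`. -/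
def lieExp (X : GroupLieAlgebra (𝓡 d) G) : G :=
  Classical.epsilon (fun γ : ℝ → G =>
    γ 0 = 1 ∧ IsMIntegralCurve (I := 𝓡 d) γ (mulInvariantVectorField X)) 1

end LieGroup

/-- A finite-dimensional real Lie algebra is completely solvable if it is solvable and every
`ad Z` has only real (complex) eigenvalues. -/
def IsCompletelySolvable (L : Type*) [LieRing L] [LieAlgebra ℝ L] [Module.Finite ℝ L] : Prop :=
  LieAlgebra.IsSolvable L ∧
    ∀ (Z : L) (z : ℂ), Polynomial.aeval z (LieAlgebra.ad ℝ L Z).charpoly = 0 → z.im = 0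

/-- An ordered basis `b` of a Lie algebra is a strong Malcev basis if all the initial spans
`ℝ b₁ + ⋯ + ℝ bᵢ` are ideals. -/
def IsStrongMalcev {L : Type*} [LieRing L] [LieAlgebra ℝ L] {n : ℕ}
    (b : Module.Basis (Fin n) ℝ L) : Prop :=
  ∀ i : Fin n, ∀ x : L, ∀ y ∈ Submodule.span ℝ (b '' Set.Iic i),
    ⁅x, y⁆ ∈ Submodule.span ℝ (b '' Set.Iic i)

/-! ### The orbit maps -/

section Orbit

variable {d : ℕ} {G : Type*} [TopologicalSpace G] [ChartedSpace (EuclideanSpace ℝ (Fin d)) G]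
  [Group G] [LieGroup (𝓡 d) ∞ G]
  {𝔪 : LieSubalgebra ℝ (GroupLieAlgebra (𝓡 d) G)} {𝔭 : LieIdeal ℝ (GroupLieAlgebra (𝓡 d) G)}
  {n₁ n₂ : ℕ}

/-- Canonical coordinates of the second kind, `e(a) = exp (a₁ A₁) ⋯ exp (aₙ Aₙ)`. -/
def secondKind (A : Module.Basis (Fin n₂) ℝ 𝔪) (a : Fin n₂ → ℝ) : G :=
  (List.ofFn fun k => lieExp (a k • (A k : GroupLieAlgebra (𝓡 d) G))).prod

/-- The linear operator `C(a) = e^{-ad (aₙ Aₙ)} ⋯ e^{-ad (a₁ A₁)}` of the ideal `𝔭`; the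
exponentials are computed on matrices with respect to the basis `X` of `𝔭`. -/
def opC (A : Module.Basis (Fin n₂) ℝ 𝔪) (X : Module.Basis (Fin n₁) ℝ 𝔭) (a : Fin n₂ → ℝ) :
    𝔭 →ₗ[ℝ] 𝔭 :=
  Matrix.toLin X X
    (List.ofFn fun k => NormedSpace.exp
      (-(LinearMap.toMatrix X X
        (LieModule.toEnd ℝ (GroupLieAlgebra (𝓡 d) G) 𝔭
          (a k • (A k : GroupLieAlgebra (𝓡 d) G)))))).reverse.prod

/-- The map `θ_λ(a) = C(a)^* λ`, with values in `𝔭^*`. -/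
def theta (A : Module.Basis (Fin n₂) ℝ 𝔪) (X : Module.Basis (Fin n₁) ℝ 𝔭) (lam : Module.Dual ℝ 𝔭)
    (a : Fin n₂ → ℝ) : Module.Dual ℝ 𝔭 :=
  lam ∘ₗ opC A X a

/-- The Jacobian matrix at `0` of `θ_λ` with respect to the bases `A` and `X^*`. -/
def jacZero (A : Module.Basis (Fin n₂) ℝ 𝔪) (X : Module.Basis (Fin n₁) ℝ 𝔭)
    (lam : Module.Dual ℝ 𝔭) : Matrix (Fin n₁) (Fin n₂) ℝ :=
  Matrix.of fun j k => fderiv ℝ (fun a => theta A X lam a (X j)) 0 (Pi.single k 1)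

/-- The map `β_J(a) = P_J^* C(a)^* λ`, an element of `∑_{j ∈ J} ℝ X_j^*`, given by its coordinates
in the basis `(X_j^*)_{j ∈ J}`. -/
def beta (A : Module.Basis (Fin n₂) ℝ 𝔪) (X : Module.Basis (Fin n₁) ℝ 𝔭) (lam : Module.Dual ℝ 𝔭)
    (J : Fin n₂ ↪o Fin n₁) (a : Fin n₂ → ℝ) : Fin n₂ → ℝ :=
  fun i => theta A X lam a (X (J i))

end Orbit

/-- The restriction of `f` to the open set `U` is a (smooth) diffeomorphism onto an open set. -/
def IsDiffeoOn {n : ℕ} (f : (Fin n → ℝ) → (Fin n → ℝ)) (U : Set (Fin n → ℝ)) : Prop :=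
  IsOpen U ∧ IsOpen (f '' U) ∧ ContDiffOn ℝ ∞ f U ∧
    ∃ g : (Fin n → ℝ) → (Fin n → ℝ), ContDiffOn ℝ ∞ g (f '' U) ∧ LeftInvOn g f U

/-- The open cube `(-ε/2, ε/2)ⁿ`. -/
def openCube (n : ℕ) (ε : ℝ) : Set (Fin n → ℝ) := Set.univ.pi fun _ => Set.Ioo (-(ε / 2)) (ε / 2)

/-- The closed cube `[-ε/2, ε/2]ⁿ`. -/
def closedCube (n : ℕ) (ε : ℝ) : Set (Fin n → ℝ) := Set.univ.pi fun _ => Set.Icc (-(ε / 2)) (ε / 2)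

section Smooth

variable {d : ℕ} {G : Type*} [TopologicalSpace G] [ChartedSpace (EuclideanSpace ℝ (Fin d)) G]
  [Group G]

/-- Smooth complex functions on a closed subgroup (an embedded submanifold) of `G`: those that are
locally restrictions of smooth functions on `G`. -/
def IsSmoothFun (d : ℕ) {G : Type*} [TopologicalSpace G]
    [ChartedSpace (EuclideanSpace ℝ (Fin d)) G] [Group G] {M : Subgroup G} (s : M → ℂ) : Prop :=
  ∀ m : M, ∃ F : G → ℂ, ContMDiff (𝓡 d) 𝓘(ℝ, ℂ) ∞ F ∧ ∀ᶠ x : M in 𝓝 m, s x = F x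

theorem IsSmoothFun.continuous {M : Subgroup G} {s : M → ℂ} (hs : IsSmoothFun d s) :
    Continuous s := by
  refine continuous_iff_continuousAt.2 fun m => ?_
  obtain ⟨F, hF, h⟩ := hs m
  exact ((hF.continuous.comp continuous_subtype_val).continuousAt).congr (h.mono fun x hx => hx.symm)

end Smooth

/-! ### The representation induced by a unitary character -/

theorem norm_coeHom (z : Circle) : ‖Circle.coeHom z‖ = 1 := Circle.norm_coe z

theorem continuous_coeHom : Continuous fun z : Circle => Circle.coeHom z :=
  continuous_subtype_val

theorem memLp_mulCircle {Y : Type*} [TopologicalSpace Y] [MeasurableSpace Y] [BorelSpace Y]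
    (μ : Measure Y) (u : C(Y, Circle)) (f : Lp ℂ 2 μ) :
    MemLp (fun y => Circle.coeHom (u y) * f y) 2 μ :=
  (Lp.memLp f).of_le
    ((continuous_coeHom.comp u.continuous).aestronglyMeasurable.mul (Lp.aestronglyMeasurable f))
    (Eventually.of_forall fun y => by rw [norm_mul, norm_coeHom, one_mul])

/-- Multiplication by a continuous function of modulus one, as an isometry of `L²`. -/
def mulCircle {Y : Type*} [TopologicalSpace Y] [MeasurableSpace Y] [BorelSpace Y] (μ : Measure Y)
    (u : C(Y, Circle)) : Lp ℂ 2 μ →ₗᵢ[ℂ] Lp ℂ 2 μ where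
  toFun f := (memLp_mulCircle μ u f).toLp fun y => Circle.coeHom (u y) * f y
  map_add' f g := by
    refine Lp.ext ?_
    filter_upwards [(memLp_mulCircle μ u (f + g)).coeFn_toLp, (memLp_mulCircle μ u f).coeFn_toLp,
      (memLp_mulCircle μ u g).coeFn_toLp, Lp.coeFn_add f g,
      Lp.coeFn_add ((memLp_mulCircle μ u f).toLp _) ((memLp_mulCircle μ u g).toLp _)]
      with y h₁ h₂ h₃ h₄ h₅
    rw [h₁, h₅, Pi.add_apply, h₂, h₃, h₄, Pi.add_apply, mul_add]
  map_smul' c f := by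
    refine Lp.ext ?_
    filter_upwards [(memLp_mulCircle μ u (c • f)).coeFn_toLp, (memLp_mulCircle μ u f).coeFn_toLp,
      Lp.coeFn_smul c f, Lp.coeFn_smul c ((memLp_mulCircle μ u f).toLp _)] with y h₁ h₂ h₃ h₄
    rw [h₁, RingHom.id_apply, h₄, Pi.smul_apply, h₂, h₃, Pi.smul_apply, smul_eq_mul, smul_eq_mul]
    ring
  norm_map' f := by
    refine (Lp.norm_toLp _ (memLp_mulCircle μ u f)).trans ?_
    rw [Lp.norm_def]
    congr 1
    exact eLpNorm_congr_norm_ae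
      (Eventually.of_forall fun y => by rw [norm_mul, norm_coeHom, one_mul])

section Rep

variable {G : Type*} [TopologicalSpace G] [Group G] [IsTopologicalGroup G] {P M : Subgroup G}

/-- Conjugation `m ↦ m⁻¹ p m`, with values in the normal subgroup `P`. -/
def conjP [hP : P.Normal] (p : P) (m : M) : P :=
  ⟨(m : G)⁻¹ * p * m, by simpa using hP.conj_mem p p.2 (m : G)⁻¹⟩

theorem continuous_conjP [P.Normal] (p : P) : Continuous (conjP p : M → P) :=
  Continuous.subtype_mk (by fun_prop) _

variable [MeasurableSpace G] [BorelSpace G]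

/-- The representation `π = ind_P^G χ` of `G = P ⋊ M` realized in `L²(M, μ)`: if `g = p n` with
`p ∈ P` and `n ∈ M`, then `(π(g) f)(m) = χ(m⁻¹ p m) f(n⁻¹ m)`. -/
def indRep [P.Normal] (hPM : P.IsComplement' M) (χ : P →ₜ* Circle) (μ : Measure M)
    [μ.IsMulLeftInvariant] (g : G) : Lp ℂ 2 μ →ₗᵢ[ℂ] Lp ℂ 2 μ :=
  (mulCircle μ ⟨fun m => χ (conjP (hPM.equiv g).1 m),
      χ.continuous_toFun.comp (continuous_conjP (P := P) (hPM.equiv g).1)⟩).comp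
    (Lp.compMeasurePreservingₗᵢ ℂ (fun m : M => ((hPM.equiv g).2 : M)⁻¹ * m)
      (measurePreserving_mul_left μ ((hPM.equiv g).2 : M)⁻¹))

theorem indRep_ae [P.Normal] (hPM : P.IsComplement' M) (χ : P →ₜ* Circle) (μ : Measure M)
    [μ.IsMulLeftInvariant] (p : P) (n : M) (f : Lp ℂ 2 μ) :
    indRep hPM χ μ ((p : G) * n) f =ᵐ[μ] fun m => Circle.coeHom (χ (conjP p m)) * f (n⁻¹ * m) := by
  have h : hPM.equiv ((p : G) * n) = (p, n) := (Equiv.eq_symm_apply hPM.equiv).1 rfl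
  have h₁ : (hPM.equiv ((p : G) * n)).1 = p := by rw [h]
  have h₂ : (hPM.equiv ((p : G) * n)).2 = n := by rw [h]
  refine (MemLp.coeFn_toLp (memLp_mulCircle μ _ _)).trans ?_
  filter_upwards [Lp.coeFn_compMeasurePreserving f
    (measurePreserving_mul_left μ ((hPM.equiv ((p : G) * n)).2 : M)⁻¹)] with m hm
  refine (congrArg _ hm).trans ?_
  simp only [ContinuousMap.coe_mk, h₁, h₂, Function.comp]

/-- Irreducibility: the only closed invariant subspaces are `0` and the whole space. -/
def IsIrreducibleRep {H : Type*} [NormedAddCommGroup H] [InnerProductSpace ℂ H]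
    (π : G → H →ₗᵢ[ℂ] H) : Prop :=
  Nontrivial H ∧ ∀ W : Submodule ℂ H, IsClosed (W : Set H) → (∀ g, ∀ f ∈ W, π g f ∈ W) →
    W = ⊥ ∨ W = ⊤

end Rep

/-! ### Frames -/

section Frame

variable {H : Type*} [NormedAddCommGroup H] [InnerProductSpace ℂ H] {ι : Type*}

/-- `a` is a lower frame bound: `a > 0` and `a ‖h‖² ≤ ∑ |⟨h, vᵢ⟩|²` for all `h`. -/
def IsLowerFrameBound (v : ι → H) (a : ℝ) : Prop :=
  0 < a ∧ ∀ h : H, ENNReal.ofReal (a * ‖h‖ ^ 2) ≤ ∑' i, ‖⟪h, v i⟫_ℂ‖ₑ ^ 2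

/-- `b` is an upper frame bound: `b > 0` and `∑ |⟨h, vᵢ⟩|² ≤ b ‖h‖²` for all `h`. -/
def IsUpperFrameBound (v : ι → H) (b : ℝ) : Prop :=
  0 < b ∧ ∀ h : H, ∑' i, ‖⟪h, v i⟫_ℂ‖ₑ ^ 2 ≤ ENNReal.ofReal (b * ‖h‖ ^ 2)

/-- The family `v` is a frame of `H`. -/
def IsFrame (v : ι → H) : Prop :=
  ∃ a b : ℝ, a ≤ b ∧ IsLowerFrameBound v a ∧ IsUpperFrameBound v b

end Frame

/-! ### The data of the construction -/

section Construction

variable {d : ℕ} {G : Type*} [TopologicalSpace G] [ChartedSpace (EuclideanSpace ℝ (Fin d)) G]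
  [Group G] [LieGroup (𝓡 d) ∞ G] {M : Subgroup G}
  {𝔪 : LieSubalgebra ℝ (GroupLieAlgebra (𝓡 d) G)} {𝔭 : LieIdeal ℝ (GroupLieAlgebra (𝓡 d) G)}
  {n₁ n₂ : ℕ}

/-- The set `Ω_ε° = exp ((-ε/2, ε/2) A₁) ⋯ exp ((-ε/2, ε/2) Aₙ)`, as a subset of `M`. -/
def omegaOpen (M : Subgroup G) (A : Module.Basis (Fin n₂) ℝ 𝔪) (ε : ℝ) : Set M :=
  {m | (m : G) ∈ secondKind A '' openCube n₂ ε}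

/-- The map `Φ` with `Φ(e(a)) = β_J(a)` for `a` in the open cube; only its values on `Ω_ε°`
are meaningful. -/
def phi (A : Module.Basis (Fin n₂) ℝ 𝔪) (X : Module.Basis (Fin n₁) ℝ 𝔭) (lam : Module.Dual ℝ 𝔭)
    (J : Fin n₂ ↪o Fin n₁) (ε : ℝ) (m : M) : Fin n₂ → ℝ :=
  beta A X lam J (Function.invFunOn (secondKind A) (openCube n₂ ε) (m : G))

/-- `Ψ` is a continuous version, on `β_J(O_ε)`, of the Radon–Nikodym derivative with respect to
Lebesgue measure of the image under `Φ` of the Haar measure of `Ω_ε°`, that is,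
`Ψ(ξ) dξ = dμ_M(Φ⁻¹(ξ))`. It is unique on the open set `β_J(O_ε)`. -/
def IsHaarDensity [MeasurableSpace G] (A : Module.Basis (Fin n₂) ℝ 𝔪)
    (X : Module.Basis (Fin n₁) ℝ 𝔭) (lam : Module.Dual ℝ 𝔭) (J : Fin n₂ ↪o Fin n₁) (ε : ℝ)
    (μ : Measure M) (Ψ : (Fin n₂ → ℝ) → ℝ) : Prop :=
  ContinuousOn Ψ (beta A X lam J '' openCube n₂ ε) ∧
  (∀ ξ ∈ beta A X lam J '' openCube n₂ ε, 0 < Ψ ξ) ∧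
  (μ.restrict (omegaOpen M A ε)).map (phi A X lam J ε) =
    (volume.restrict (beta A X lam J '' openCube n₂ ε)).withDensity
      (fun ξ => ENNReal.ofReal (Ψ ξ))

/-- The density `Ψ`. -/
def psi [MeasurableSpace G] (A : Module.Basis (Fin n₂) ℝ 𝔪) (X : Module.Basis (Fin n₁) ℝ 𝔭)
    (lam : Module.Dual ℝ 𝔭) (J : Fin n₂ ↪o Fin n₁) (ε : ℝ) (μ : Measure M) :
    (Fin n₂ → ℝ) → ℝ :=
  Classical.epsilon (IsHaarDensity A X lam J ε μ)

/-- The function `Υ(m) = √(Ψ(Φ(m)) |det L^{-T}|) s(m)`. The operator `L` of `∑_{j ∈ J} ℝ X_j` is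
given by its matrix in the basis `(X_j)_{j ∈ J}`. -/
def upsilon [MeasurableSpace G] (A : Module.Basis (Fin n₂) ℝ 𝔪) (X : Module.Basis (Fin n₁) ℝ 𝔭)
    (lam : Module.Dual ℝ 𝔭) (J : Fin n₂ ↪o Fin n₁) (ε : ℝ) (μ : Measure M)
    (L : GL (Fin n₂) ℝ) (s : M → ℂ) (m : M) : ℂ :=
  (Real.sqrt (psi A X lam J ε μ (phi A X lam J ε m) *
    |((↑L⁻¹ : Matrix (Fin n₂) (Fin n₂) ℝ)ᵀ).det|) : ℂ) * s m

/-- The sum `∑_{γ ∈ Γ_M} |Υ(γ m)|²`, with values in `[0, ∞]`. -/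
def upsilonSum [MeasurableSpace G] (A : Module.Basis (Fin n₂) ℝ 𝔪)
    (X : Module.Basis (Fin n₁) ℝ 𝔭)
    (lam : Module.Dual ℝ 𝔭) (J : Fin n₂ ↪o Fin n₁) (ε : ℝ) (μ : Measure M)
    (L : GL (Fin n₂) ℝ) (s : M → ℂ) (ΓM : Set M) (m : M) : ℝ≥0∞ :=
  ∑' γ : ΓM, ‖upsilon A X lam J ε μ L s ((γ : M) * m)‖ₑ ^ 2

/-- The lattice `Λ = ∑_{j ∈ J} ℤ L X_j` of `∑_{j ∈ J} ℝ X_j ⊆ 𝔭`. -/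
def latticeP (X : Module.Basis (Fin n₁) ℝ 𝔭) (J : Fin n₂ ↪o Fin n₁) (L : GL (Fin n₂) ℝ) :
    Submodule ℤ 𝔭 :=
  Submodule.span ℤ (Set.range fun k : Fin n₂ =>
    ∑ i, (L : Matrix (Fin n₂) (Fin n₂) ℝ) i k • X (J i))

/-- The lattice `Λ^⋆ = ∑_{j ∈ J} ℤ L^{-T} X_j^*`, in the coordinates of `(X_j^*)_{j ∈ J}`. -/
def dualLattice (L : GL (Fin n₂) ℝ) : Submodule ℤ (Fin n₂ → ℝ) :=
  Submodule.span ℤ (Set.range fun k : Fin n₂ =>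
    ((↑L⁻¹ : Matrix (Fin n₂) (Fin n₂) ℝ)ᵀ).col k)

/-- The discrete set `Γ_P = exp Λ`. -/
def gammaP (X : Module.Basis (Fin n₁) ℝ 𝔭) (J : Fin n₂ ↪o Fin n₁) (L : GL (Fin n₂) ℝ) : Set G :=
  (fun Y : 𝔭 => lieExp (Y : GroupLieAlgebra (𝓡 d) G)) '' (latticeP X J L : Set 𝔭)

/-- The set `Γ = Γ_M⁻¹ Γ_P`. -/
def gammaSet (X : Module.Basis (Fin n₁) ℝ 𝔭) (J : Fin n₂ ↪o Fin n₁) (L : GL (Fin n₂) ℝ)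
    (ΓM : Set M) : Set G :=
  ((fun γ : M => (γ : G)) '' ΓM)⁻¹ * gammaP X J L

end Construction

end SolvFrame

end

namespace SolvFrame

noncomputable section

/-! ### One-parameter subgroups -/

section Exp

variable {d : ℕ} {G : Type*} [TopologicalSpace G] [ChartedSpace (EuclideanSpace ℝ (Fin d)) G]
  [Group G] [LieGroup (𝓡 d) ∞ G]

theorem mdifferentiableAt_mul_left (g x : G) :
    MDifferentiableAt (𝓡 d) (𝓡 d) (fun y : G => g * y) x :=
  (contMDiff_mul_left (I := 𝓡 d) (n := ∞)).mdifferentiableAt (by simp)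

theorem mdifferentiableAt_mul_right (g x : G) :
    MDifferentiableAt (𝓡 d) (𝓡 d) (fun y : G => y * g) x :=
  (contMDiff_mul_right (I := 𝓡 d) (n := ∞)).mdifferentiableAt (by simp)

theorem mfderiv_mul_left_mulInvariantVectorField (g h : G) (v : GroupLieAlgebra (𝓡 d) G) :
    mfderiv (𝓡 d) (𝓡 d) (fun y : G => g * y) h (mulInvariantVectorField v h) =
      mulInvariantVectorField v (g * h) := by
  have h₁ : (fun x : G => g * h * x) = (fun y : G => g * y) ∘ (fun x : G => h * x) := by
    ext x
    simp [mul_assoc]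
  unfold mulInvariantVectorField
  rw [h₁, mfderiv_comp (I' := 𝓡 d) _ (mdifferentiableAt_mul_left _ _)
    (mdifferentiableAt_mul_left _ _), mul_one]
  rfl

theorem contMDiff_one_mulInvariantVectorField (v : GroupLieAlgebra (𝓡 d) G) :
    ContMDiff (𝓡 d) (𝓡 d).tangent 1
      (fun g : G => (⟨g, mulInvariantVectorField v g⟩ : TangentBundle (𝓡 d) G)) :=
  (contMDiff_mulInvariantVectorField v).of_le (by
    rw [minSmoothness_of_isRCLikeNormedField]
    norm_num)

theorem _root_.HasMFDerivWithinAt.mul_left_integral {γ : ℝ → G} {v : GroupLieAlgebra (𝓡 d) G}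
    {s : Set ℝ} {t : ℝ} (g : G)
    (h : HasMFDerivWithinAt 𝓘(ℝ, ℝ) (𝓡 d) γ s t
      ((1 : ℝ →L[ℝ] ℝ).smulRight (mulInvariantVectorField v (γ t)))) :
    HasMFDerivWithinAt 𝓘(ℝ, ℝ) (𝓡 d) (fun t => g * γ t) s t
      ((1 : ℝ →L[ℝ] ℝ).smulRight (mulInvariantVectorField v (g * γ t))) := by
  have h₂ := (mdifferentiableAt_mul_left (d := d) g (γ t)).hasMFDerivAt.comp_hasMFDerivWithinAt t h
  refine h₂.congr_mfderiv (ContinuousLinearMap.ext fun r => ?_)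
  exact ((mfderiv (𝓡 d) (𝓡 d) (fun y : G => g * y) (γ t)).map_smul (show ℝ from r) _).trans
    (congrArg ((show ℝ from r) • ·) (mfderiv_mul_left_mulInvariantVectorField g (γ t) v))

theorem isMIntegralCurve_mul_left {γ : ℝ → G} {v : GroupLieAlgebra (𝓡 d) G} (g : G)
    (h : IsMIntegralCurve (I := 𝓡 d) γ (mulInvariantVectorField v)) :
    IsMIntegralCurve (I := 𝓡 d) (fun t => g * γ t) (mulInvariantVectorField v) := fun t => by
  exact hasMFDerivWithinAt_univ.1 (((h t).hasMFDerivWithinAt (s := univ)).mul_left_integral g)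

variable [T2Space G]

theorem exists_isMIntegralCurve_mulInvariantVectorField (v : GroupLieAlgebra (𝓡 d) G) :
    ∃ γ : ℝ → G, γ 0 = 1 ∧ IsMIntegralCurve (I := 𝓡 d) γ (mulInvariantVectorField v) := by
  obtain ⟨γ, h0, hγ⟩ := exists_isMIntegralCurveAt_of_contMDiffAt_boundaryless (I := 𝓡 d) 0
    ((contMDiff_one_mulInvariantVectorField v).contMDiffAt (x := (1 : G)))
  obtain ⟨ε, hε, h⟩ := isMIntegralCurveAt_iff'.1 hγ
  refine exists_isMIntegralCurve_of_isMIntegralCurveOn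
    (contMDiff_one_mulInvariantVectorField v) hε (fun x => ⟨fun t => x * γ t, by simp [h0], ?_⟩) 1
  rw [Real.ball_eq_Ioo, zero_sub, zero_add] at h
  exact fun t ht => (h t ht).mul_left_integral x

theorem integralCurve_unique {v : GroupLieAlgebra (𝓡 d) G} {γ γ' : ℝ → G}
    (h : IsMIntegralCurve (I := 𝓡 d) γ (mulInvariantVectorField v))
    (h' : IsMIntegralCurve (I := 𝓡 d) γ' (mulInvariantVectorField v)) (h0 : γ 0 = γ' 0) :
    γ = γ' :=
  isMIntegralCurve_Ioo_eq_of_contMDiff_boundaryless (t₀ := 0)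
    (contMDiff_one_mulInvariantVectorField v) h h' h0

theorem lieExp_eq {v : GroupLieAlgebra (𝓡 d) G} {γ : ℝ → G} (h0 : γ 0 = 1)
    (h : IsMIntegralCurve (I := 𝓡 d) γ (mulInvariantVectorField v)) : lieExp v = γ 1 := by
  have hs := Classical.epsilon_spec (exists_isMIntegralCurve_mulInvariantVectorField v)
  exact congrFun (integralCurve_unique hs.2 h (hs.1.trans h0.symm)) 1

theorem lieExp_smul_eq {v : GroupLieAlgebra (𝓡 d) G} {γ : ℝ → G} (h0 : γ 0 = 1)
    (h : IsMIntegralCurve (I := 𝓡 d) γ (mulInvariantVectorField v)) (t : ℝ) :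
    lieExp (t • v) = γ t := by
  have h₁ := h.comp_mul t
  rw [← mulInvariantVectorField_smul] at h₁
  rw [lieExp_eq (by simp [h0]) h₁]
  simp

theorem isMIntegralCurve_lieExp (v : GroupLieAlgebra (𝓡 d) G) :
    IsMIntegralCurve (I := 𝓡 d) (fun t : ℝ => lieExp (t • v)) (mulInvariantVectorField v) := by
  obtain ⟨γ, h0, h⟩ := exists_isMIntegralCurve_mulInvariantVectorField v
  have : (fun t : ℝ => lieExp (t • v)) = γ := funext (lieExp_smul_eq h0 h)
  rwa [this]

@[simp]
theorem lieExp_zero : lieExp (0 : GroupLieAlgebra (𝓡 d) G) = (1 : G) := by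
  obtain ⟨γ, h0, h⟩ := exists_isMIntegralCurve_mulInvariantVectorField (0 : GroupLieAlgebra (𝓡 d) G)
  have := lieExp_smul_eq h0 h 0
  rwa [zero_smul, h0] at this

theorem lieExp_add_smul (v : GroupLieAlgebra (𝓡 d) G) (s t : ℝ) :
    (lieExp ((s + t) • v) : G) = lieExp (s • v) * lieExp (t • v) := by
  have h := isMIntegralCurve_lieExp v
  have h₁ : IsMIntegralCurve (I := 𝓡 d) (fun t : ℝ => (lieExp ((t + s) • v) : G))
      (mulInvariantVectorField v) := h.comp_add s
  have h₂ := isMIntegralCurve_mul_left (lieExp (s • v)) h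
  have := congrFun (integralCurve_unique h₁ h₂ (by simp)) t
  simpa [add_comm] using this

theorem lieExp_neg (v : GroupLieAlgebra (𝓡 d) G) : (lieExp (-v) : G) = (lieExp v)⁻¹ := by
  have := lieExp_add_smul v (-1) 1
  simp only [neg_add_cancel, zero_smul, lieExp_zero, neg_smul, one_smul] at this
  exact eq_inv_of_mul_eq_one_left this.symm

theorem continuous_lieExp_smul (v : GroupLieAlgebra (𝓡 d) G) :
    Continuous fun t : ℝ => (lieExp (t • v) : G) :=
  (isMIntegralCurve_lieExp v).continuous

/-! ### The adjoint representation -/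

/-- The adjoint action of `g`, the derivative at `1` of `x ↦ g x g⁻¹`. -/
def lieAd (g : G) : GroupLieAlgebra (𝓡 d) G →L[ℝ] GroupLieAlgebra (𝓡 d) G :=
  (mfderiv (𝓡 d) (𝓡 d) (fun x : G => g * x * g⁻¹) 1 :
    EuclideanSpace ℝ (Fin d) →L[ℝ] EuclideanSpace ℝ (Fin d))

omit [T2Space G] in
theorem mdifferentiableAt_conj (g x : G) :
    MDifferentiableAt (𝓡 d) (𝓡 d) (fun y : G => g * y * g⁻¹) x :=
  (mdifferentiableAt_mul_right (d := d) g⁻¹ (g * x)).comp x (mdifferentiableAt_mul_left g x)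

omit [T2Space G] in
theorem mfderiv_conj_mulInvariantVectorField (g h : G) (v : GroupLieAlgebra (𝓡 d) G) :
    mfderiv (𝓡 d) (𝓡 d) (fun y : G => g * y * g⁻¹) h (mulInvariantVectorField v h) =
      mulInvariantVectorField (lieAd g v) (g * h * g⁻¹) := by
  have h₁ : (fun y : G => g * y * g⁻¹) ∘ (fun x : G => h * x) =
      (fun x : G => g * h * g⁻¹ * x) ∘ (fun y : G => g * y * g⁻¹) := by
    ext x
    simp [mul_assoc]
  have h₂ := mfderiv_comp (I := 𝓡 d) (I' := 𝓡 d) (I'' := 𝓡 d) (1 : G)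
    (mdifferentiableAt_conj (d := d) g (h * 1)) (mdifferentiableAt_mul_left h 1)
  have h₃ := mfderiv_comp (I := 𝓡 d) (I' := 𝓡 d) (I'' := 𝓡 d) (1 : G)
    (mdifferentiableAt_mul_left (d := d) (g * h * g⁻¹) (g * 1 * g⁻¹)) (mdifferentiableAt_conj g 1)
  rw [h₁, h₃] at h₂
  have e₁ : g * 1 * g⁻¹ = 1 := by simp
  rw [mul_one h, e₁] at h₂
  exact (DFunLike.congr_fun h₂ v).symm

theorem conj_lieExp (g : G) (v : GroupLieAlgebra (𝓡 d) G) :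
    g * lieExp v * g⁻¹ = lieExp (lieAd g v) := by
  have h : IsMIntegralCurve (I := 𝓡 d) (fun t : ℝ => g * lieExp (t • v) * g⁻¹)
      (mulInvariantVectorField (lieAd g v)) := fun t => by
    have h₂ := (mdifferentiableAt_conj (d := d) g (lieExp (t • v))).hasMFDerivAt.comp t
      (isMIntegralCurve_lieExp v t)
    refine h₂.congr_mfderiv (ContinuousLinearMap.ext fun r => ?_)
    exact ((mfderiv (𝓡 d) (𝓡 d) (fun y : G => g * y * g⁻¹) (lieExp (t • v))).map_smul
      (show ℝ from r) _).trans
      (congrArg ((show ℝ from r) • ·) (mfderiv_conj_mulInvariantVectorField g (lieExp (t • v)) v))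
  have := lieExp_eq (by simp) h
  simpa using this.symm

omit [T2Space G] in
theorem lieAd_mul (g h : G) (v : GroupLieAlgebra (𝓡 d) G) :
    lieAd (g * h) v = lieAd g (lieAd h v) := by
  have h₁ : (fun x : G => g * h * x * (g * h)⁻¹) =
      (fun y : G => g * y * g⁻¹) ∘ (fun x : G => h * x * h⁻¹) := by
    ext x
    simp [mul_assoc]
  have h₃ := mfderiv_comp (I := 𝓡 d) (I' := 𝓡 d) (I'' := 𝓡 d) (1 : G)
    (mdifferentiableAt_conj (d := d) g (h * 1 * h⁻¹)) (mdifferentiableAt_conj h 1)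
  have e₁ : h * 1 * h⁻¹ = 1 := by simp
  rw [← h₁, e₁] at h₃
  exact DFunLike.congr_fun h₃ v

omit [T2Space G] [LieGroup (𝓡 d) ∞ G] in
@[simp]
theorem lieAd_one (v : GroupLieAlgebra (𝓡 d) G) : lieAd (1 : G) v = v := by
  have : (fun x : G => 1 * x * (1 : G)⁻¹) = id := by
    ext x
    simp
  unfold lieAd
  rw [this, mfderiv_id]
  rfl

end Exp

/-! ### Multiplication in the chart at the identity -/

section Chart

variable {d : ℕ} (G : Type*) [TopologicalSpace G] [ChartedSpace (EuclideanSpace ℝ (Fin d)) G]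
  [Group G]

/-- The multiplication of `G`, read in the chart at `1`. -/
def chartMul (p : EuclideanSpace ℝ (Fin d) × EuclideanSpace ℝ (Fin d)) :
    EuclideanSpace ℝ (Fin d) :=
  extChartAt (𝓡 d) (1 : G)
    ((extChartAt (𝓡 d) (1 : G)).symm p.1 * (extChartAt (𝓡 d) (1 : G)).symm p.2)

/-- The coordinates of `1`. -/
def chartOne : EuclideanSpace ℝ (Fin d) := extChartAt (𝓡 d) (1 : G) 1

variable {G}

theorem chartMul_apply {g h : G} (hg : g ∈ (extChartAt (𝓡 d) (1 : G)).source)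
    (hh : h ∈ (extChartAt (𝓡 d) (1 : G)).source) :
    chartMul G (extChartAt (𝓡 d) (1 : G) g, extChartAt (𝓡 d) (1 : G) h) =
      extChartAt (𝓡 d) (1 : G) (g * h) := by
  simp only [chartMul, (extChartAt (𝓡 d) (1 : G)).left_inv hg,
    (extChartAt (𝓡 d) (1 : G)).left_inv hh]

theorem chartMul_chartOne_right {x : EuclideanSpace ℝ (Fin d)}
    (hx : x ∈ (extChartAt (𝓡 d) (1 : G)).target) : chartMul G (x, chartOne G) = x := by
  simp only [chartMul, chartOne, (extChartAt (𝓡 d) (1 : G)).left_inv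
    (mem_extChartAt_source (I := 𝓡 d) (1 : G)), mul_one, (extChartAt (𝓡 d) (1 : G)).right_inv hx]

theorem chartMul_chartOne_left {x : EuclideanSpace ℝ (Fin d)}
    (hx : x ∈ (extChartAt (𝓡 d) (1 : G)).target) : chartMul G (chartOne G, x) = x := by
  simp only [chartMul, chartOne, (extChartAt (𝓡 d) (1 : G)).left_inv
    (mem_extChartAt_source (I := 𝓡 d) (1 : G)), one_mul, (extChartAt (𝓡 d) (1 : G)).right_inv hx]

theorem target_mem_nhds_chartOne :
    (extChartAt (𝓡 d) (1 : G)).target ∈ 𝓝 (chartOne G) :=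
  extChartAt_target_mem_nhds (I := 𝓡 d) (1 : G)

variable [LieGroup (𝓡 d) ∞ G]

theorem contDiffAt_chartMul : ContDiffAt ℝ ∞ (chartMul (d := d) G) (chartOne G, chartOne G) := by
  rw [← contMDiffAt_iff_contDiffAt]
  have h₀ : ContMDiffAt 𝓘(ℝ, EuclideanSpace ℝ (Fin d)) (𝓡 d) ∞ (extChartAt (𝓡 d) (1 : G)).symm
      (chartOne G) :=
    (contMDiffOn_extChartAt_symm (I := 𝓡 d) (n := ∞) (1 : G)).contMDiffAt target_mem_nhds_chartOne
  have e₀ : (extChartAt (𝓡 d) (1 : G)).symm (chartOne G) = 1 :=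
    (extChartAt (𝓡 d) (1 : G)).left_inv (mem_extChartAt_source (I := 𝓡 d) (1 : G))
  have h₁ : ContMDiffAt 𝓘(ℝ, EuclideanSpace ℝ (Fin d) × EuclideanSpace ℝ (Fin d)) (𝓡 d) ∞
      (fun p : EuclideanSpace ℝ (Fin d) × EuclideanSpace ℝ (Fin d) =>
        (extChartAt (𝓡 d) (1 : G)).symm p.1) (chartOne G, chartOne G) :=
    ContMDiffAt.comp _ h₀ contDiff_fst.contMDiff.contMDiffAt
  have h₂ : ContMDiffAt 𝓘(ℝ, EuclideanSpace ℝ (Fin d) × EuclideanSpace ℝ (Fin d)) (𝓡 d) ∞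
      (fun p : EuclideanSpace ℝ (Fin d) × EuclideanSpace ℝ (Fin d) =>
        (extChartAt (𝓡 d) (1 : G)).symm p.2) (chartOne G, chartOne G) :=
    ContMDiffAt.comp _ h₀ contDiff_snd.contMDiff.contMDiffAt
  refine ContMDiffAt.comp _ (contMDiffAt_extChartAt' ?_) (h₁.mul h₂)
  simp only [e₀, mul_one]
  exact mem_chart_source _ _

theorem eventually_differentiableAt_chartMul :
    ∀ᶠ p in 𝓝 ((chartOne G, chartOne G) : EuclideanSpace ℝ (Fin d) × EuclideanSpace ℝ (Fin d)),
      DifferentiableAt ℝ (chartMul G) p :=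
  ((contDiffAt_chartMul.of_le (m := 1) (mod_cast le_top)).eventually (by simp)).mono
    fun _ h => h.differentiableAt (by simp)

theorem hasStrictFDerivAt_chartMul :
    HasStrictFDerivAt (chartMul G)
      (ContinuousLinearMap.fst ℝ (EuclideanSpace ℝ (Fin d)) (EuclideanSpace ℝ (Fin d)) +
        ContinuousLinearMap.snd ℝ _ _) (chartOne G, chartOne G) := by
  have h := (contDiffAt_chartMul (d := d) (G := G)).hasStrictFDerivAt (by simp)
  convert! h using 1
  have h₁ : HasFDerivAt (fun x : EuclideanSpace ℝ (Fin d) => chartMul G (x, chartOne G))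
      ((fderiv ℝ (chartMul G) (chartOne G, chartOne G)).comp (.inl ℝ _ _)) (chartOne G) :=
    HasFDerivAt.comp (f := fun x => (x, chartOne G)) (chartOne G) h.hasFDerivAt
      (hasFDerivAt_prodMk_left _ _)
  have h₂ : HasFDerivAt (fun x : EuclideanSpace ℝ (Fin d) => chartMul G (chartOne G, x))
      ((fderiv ℝ (chartMul G) (chartOne G, chartOne G)).comp (.inr ℝ _ _)) (chartOne G) :=
    HasFDerivAt.comp (f := fun x => (chartOne G, x)) (chartOne G) h.hasFDerivAt
      (hasFDerivAt_prodMk_right _ _)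
  have e₁ := h₁.unique ((hasFDerivAt_id (chartOne G)).congr_of_eventuallyEq
    (by filter_upwards [target_mem_nhds_chartOne (G := G)] with x hx
        exact chartMul_chartOne_right hx))
  have e₂ := h₂.unique ((hasFDerivAt_id (chartOne G)).congr_of_eventuallyEq
    (by filter_upwards [target_mem_nhds_chartOne (G := G)] with x hx
        exact chartMul_chartOne_left hx))
  ext1
  · rw [e₁]
    ext
    simp
  · rw [e₂]
    ext
    simp

omit [LieGroup (𝓡 d) ∞ G] in
theorem mulInvariantVectorField_one (v : GroupLieAlgebra (𝓡 d) G) :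
    mulInvariantVectorField v (1 : G) = v := by
  unfold mulInvariantVectorField
  have : (fun x : G => 1 * x) = id := by
    ext x
    simp
  rw [this, mfderiv_id]
  rfl

/-- The one-parameter group generated by `v`, read in the chart at `1`. -/
def chartExp (v : GroupLieAlgebra (𝓡 d) G) (t : ℝ) : EuclideanSpace ℝ (Fin d) :=
  extChartAt (𝓡 d) (1 : G) (lieExp (t • v))

variable [T2Space G]

@[simp]
theorem chartExp_zero (v : GroupLieAlgebra (𝓡 d) G) : chartExp v 0 = chartOne G := by
  simp [chartExp, chartOne]

theorem eventually_lieExp_mem_source (v : GroupLieAlgebra (𝓡 d) G) :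
    ∀ᶠ t : ℝ in 𝓝 0, (lieExp (t • v) : G) ∈ (extChartAt (𝓡 d) (1 : G)).source := by
  refine (continuous_lieExp_smul v).continuousAt.eventually_mem ?_
  rw [zero_smul, lieExp_zero]
  exact extChartAt_source_mem_nhds (I := 𝓡 d) (1 : G)

theorem hasDerivAt_chartExp_zero (v : GroupLieAlgebra (𝓡 d) G) :
    HasDerivAt (chartExp v) v 0 := by
  have h₀ : ∀ g : G, g = 1 →
      (mulInvariantVectorField v g : EuclideanSpace ℝ (Fin d)) = v := by
    rintro g rfl
    exact mulInvariantVectorField_one v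
  have h₁ := (isMIntegralCurve_lieExp v 0).2
  simp only [writtenInExtChartAt, zero_smul, lieExp_zero, extChartAt_model_space_eq_id,
    modelWithCornersSelf_coe, range_id] at h₁
  have h₂ : HasFDerivAt (chartExp v) ((1 : ℝ →L[ℝ] ℝ).smulRight
      (@id (EuclideanSpace ℝ (Fin d)) (mulInvariantVectorField v (lieExp ((0 : ℝ) • v))))) 0 :=
    hasFDerivWithinAt_univ.1 h₁
  refine h₂.hasDerivAt.congr_deriv ?_
  rw [ContinuousLinearMap.smulRight_apply]
  refine (one_smul ℝ (_ : EuclideanSpace ℝ (Fin d))).trans (h₀ _ ?_)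
  simp

theorem hasDerivAt_chartExp (v : GroupLieAlgebra (𝓡 d) G) :
    ∀ᶠ t : ℝ in 𝓝 0, HasDerivAt (chartExp v)
      (fderiv ℝ (chartMul G) (chartExp v t, chartOne G) (0, v)) t := by
  have hc : ContinuousAt (fun t => (chartExp v t, chartOne (d := d) G)) 0 :=
    (hasDerivAt_chartExp_zero v).continuousAt.prodMk continuousAt_const
  rw [ContinuousAt, chartExp_zero] at hc
  have hd := hc.eventually (eventually_differentiableAt_chartMul (G := G))
  filter_upwards [hd, eventually_lieExp_mem_source v] with t ht hs
  have h₁ : HasDerivAt (fun r : ℝ => chartExp v (r - t)) v t := by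
    have := hasDerivAt_chartExp_zero v
    rw [← sub_self t] at this
    exact this.comp_sub_const t t
  have h₂ : HasDerivAt (fun r : ℝ => chartMul G (chartExp v t, chartExp v (r - t)))
      (fderiv ℝ (chartMul G) (chartExp v t, chartOne G) (0, v)) t := by
    have h₃ : HasDerivAt (fun r : ℝ => (chartExp v t, chartExp v (r - t)))
        ((0, v) : EuclideanSpace ℝ (Fin d) × EuclideanSpace ℝ (Fin d)) t :=
      (hasDerivAt_const t _).prodMk h₁
    have h₄ : HasFDerivAt (chartMul G) (fderiv ℝ (chartMul G) (chartExp v t, chartOne G))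
        (chartExp v t, chartExp v (t - t)) := by
      rw [sub_self, chartExp_zero]
      exact ht.hasFDerivAt
    exact h₄.comp_hasDerivAt t h₃
  refine h₂.congr_of_eventuallyEq ?_
  have : Tendsto (fun r : ℝ => r - t) (𝓝 t) (𝓝 0) := by
    have := (continuous_sub_right t).tendsto t
    rwa [sub_self] at this
  filter_upwards [this.eventually (eventually_lieExp_mem_source v)] with r hr
  unfold chartExp
  rw [chartMul_apply hs hr, ← lieExp_add_smul, add_sub_cancel]

theorem hasStrictDerivAt_chartExp (v : GroupLieAlgebra (𝓡 d) G) :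
    HasStrictDerivAt (chartExp v) v 0 := by
  have h₁ : fderiv ℝ (chartMul G) (chartExp v 0, chartOne G) (0, v) = v := by
    rw [chartExp_zero, hasStrictFDerivAt_chartMul.hasFDerivAt.fderiv]
    exact zero_add (show EuclideanSpace ℝ (Fin d) from v)
  have hc : ContinuousAt (fun t => (chartExp v t, chartOne (d := d) G)) 0 :=
    (hasDerivAt_chartExp_zero v).continuousAt.prodMk continuousAt_const
  have hf : ContinuousAt (fderiv ℝ (chartMul (d := d) G)) (chartExp v 0, chartOne G) := by
    rw [chartExp_zero]
    exact contDiffAt_chartMul.continuousAt_fderiv (by simp)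
  have h₂ := hasStrictDerivAt_of_hasDerivAt_of_continuousAt (hasDerivAt_chartExp v)
    ((ContinuousAt.comp (f := fun t => (chartExp v t, chartOne G)) hf hc).clm_apply
      continuousAt_const)
  exact h₂.congr_deriv h₁

/-- The identity `dL_g Y = dR_g (Ad g Y)`, in the chart at `1`. -/
theorem fderiv_chartMul_lieAd {g : G} (hg : g ∈ (extChartAt (𝓡 d) (1 : G)).source)
    (h₁ : DifferentiableAt ℝ (chartMul G) (extChartAt (𝓡 d) (1 : G) g, chartOne G))
    (h₂ : DifferentiableAt ℝ (chartMul G) (chartOne G, extChartAt (𝓡 d) (1 : G) g))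
    (v : GroupLieAlgebra (𝓡 d) G) :
    fderiv ℝ (chartMul G) (extChartAt (𝓡 d) (1 : G) g, chartOne G) (0, v) =
      fderiv ℝ (chartMul G) (chartOne G, extChartAt (𝓡 d) (1 : G) g) (lieAd g v, 0) := by
  have d₁ : HasDerivAt (fun s : ℝ => chartMul G (extChartAt (𝓡 d) (1 : G) g, chartExp v s))
      (fderiv ℝ (chartMul G) (extChartAt (𝓡 d) (1 : G) g, chartOne G) (0, v)) 0 := by
    have h₃ : HasDerivAt (fun s : ℝ => (extChartAt (𝓡 d) (1 : G) g, chartExp v s))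
        ((0, v) : EuclideanSpace ℝ (Fin d) × EuclideanSpace ℝ (Fin d)) 0 :=
      (hasDerivAt_const (0 : ℝ) _).prodMk (hasDerivAt_chartExp_zero v)
    have h₄ : HasFDerivAt (chartMul G)
        (fderiv ℝ (chartMul G) (extChartAt (𝓡 d) (1 : G) g, chartOne G))
        (extChartAt (𝓡 d) (1 : G) g, chartExp v 0) := by
      rw [chartExp_zero]
      exact h₁.hasFDerivAt
    exact h₄.comp_hasDerivAt (0 : ℝ) h₃
  have d₂ : HasDerivAt
      (fun s : ℝ => chartMul G (chartExp (lieAd g v) s, extChartAt (𝓡 d) (1 : G) g))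
      (fderiv ℝ (chartMul G) (chartOne G, extChartAt (𝓡 d) (1 : G) g) (lieAd g v, 0)) 0 := by
    have h₃ : HasDerivAt (fun s : ℝ => (chartExp (lieAd g v) s, extChartAt (𝓡 d) (1 : G) g))
        ((lieAd g v, 0) : EuclideanSpace ℝ (Fin d) × EuclideanSpace ℝ (Fin d)) 0 :=
      (hasDerivAt_chartExp_zero (lieAd g v)).prodMk (hasDerivAt_const (0 : ℝ) _)
    have h₄ : HasFDerivAt (chartMul G)
        (fderiv ℝ (chartMul G) (chartOne G, extChartAt (𝓡 d) (1 : G) g))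
        (chartExp (lieAd g v) 0, extChartAt (𝓡 d) (1 : G) g) := by
      rw [chartExp_zero]
      exact h₂.hasFDerivAt
    exact h₄.comp_hasDerivAt (0 : ℝ) h₃
  refine d₁.unique (d₂.congr_of_eventuallyEq ?_)
  filter_upwards [eventually_lieExp_mem_source v, eventually_lieExp_mem_source (lieAd g v)]
    with s hs hs'
  unfold chartExp
  rw [chartMul_apply hg hs, chartMul_apply hs' hg, ← map_smul, ← conj_lieExp,
    inv_mul_cancel_right]

end Chart

/-! ### The bracket and the derivative of the adjoint representation -/

section Bracket

variable {d : ℕ} {G : Type*} [TopologicalSpace G] [ChartedSpace (EuclideanSpace ℝ (Fin d)) G]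
  [Group G] [LieGroup (𝓡 d) ∞ G] [T2Space G]

theorem mfderiv_extChartAt_mulInvariantVectorField {g : G}
    (hg : g ∈ (extChartAt (𝓡 d) (1 : G)).source)
    (h₁ : DifferentiableAt ℝ (chartMul G) (extChartAt (𝓡 d) (1 : G) g, chartOne G))
    (v : GroupLieAlgebra (𝓡 d) G) :
    mfderiv (𝓡 d) 𝓘(ℝ, EuclideanSpace ℝ (Fin d)) (extChartAt (𝓡 d) (1 : G)) g
      (mulInvariantVectorField v g) =
    fderiv ℝ (chartMul G) (extChartAt (𝓡 d) (1 : G) g, chartOne G) (0, v) := by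
  have h₀ : ∀ g' : G, g' = g →
      (mfderiv (𝓡 d) 𝓘(ℝ, EuclideanSpace ℝ (Fin d)) (extChartAt (𝓡 d) (1 : G)) g'
        (mulInvariantVectorField v g') : EuclideanSpace ℝ (Fin d)) =
      mfderiv (𝓡 d) 𝓘(ℝ, EuclideanSpace ℝ (Fin d)) (extChartAt (𝓡 d) (1 : G)) g
        (mulInvariantVectorField v g) := by
    rintro g' rfl
    rfl
  have hg' : g * lieExp ((0 : ℝ) • v) ∈ (chartAt (EuclideanSpace ℝ (Fin d)) (1 : G)).source := by
    simpa using hg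
  have d₁ : HasDerivAt (fun s : ℝ => chartMul G (extChartAt (𝓡 d) (1 : G) g, chartExp v s))
      (fderiv ℝ (chartMul G) (extChartAt (𝓡 d) (1 : G) g, chartOne G) (0, v)) 0 := by
    have h₃ : HasDerivAt (fun s : ℝ => (extChartAt (𝓡 d) (1 : G) g, chartExp v s))
        ((0, v) : EuclideanSpace ℝ (Fin d) × EuclideanSpace ℝ (Fin d)) 0 :=
      (hasDerivAt_const (0 : ℝ) _).prodMk (hasDerivAt_chartExp_zero v)
    have h₄ : HasFDerivAt (chartMul G)
        (fderiv ℝ (chartMul G) (extChartAt (𝓡 d) (1 : G) g, chartOne G))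
        (extChartAt (𝓡 d) (1 : G) g, chartExp v 0) := by
      rw [chartExp_zero]
      exact h₁.hasFDerivAt
    exact h₄.comp_hasDerivAt (0 : ℝ) h₃
  have m := (mdifferentiableAt_extChartAt (I := 𝓡 d) hg').hasMFDerivAt.comp (0 : ℝ)
    (isMIntegralCurve_mul_left g (isMIntegralCurve_lieExp v) 0)
  let T : EuclideanSpace ℝ (Fin d) →L[ℝ] EuclideanSpace ℝ (Fin d) :=
    mfderiv (𝓡 d) 𝓘(ℝ, EuclideanSpace ℝ (Fin d)) (extChartAt (𝓡 d) (1 : G))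
      (g * lieExp ((0 : ℝ) • v))
  let w : EuclideanSpace ℝ (Fin d) := mulInvariantVectorField v (g * lieExp ((0 : ℝ) • v))
  have m₂ : HasFDerivAt (fun s : ℝ => extChartAt (𝓡 d) (1 : G) (g * lieExp (s • v)))
      (T.comp ((1 : ℝ →L[ℝ] ℝ).smulRight w)) 0 :=
    hasMFDerivAt_iff_hasFDerivAt.1 m
  have m₃ : HasDerivAt (fun s : ℝ => extChartAt (𝓡 d) (1 : G) (g * lieExp (s • v))) (T w) 0 := by
    simpa using m₂.hasDerivAt
  refine (h₀ (g * lieExp ((0 : ℝ) • v)) (by simp)).symm.trans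
    (m₃.unique (d₁.congr_of_eventuallyEq ?_))
  filter_upwards [eventually_lieExp_mem_source v] with s hs
  unfold chartExp
  rw [chartMul_apply hg hs]

theorem mpullbackWithin_mulInvariantVectorField (v : GroupLieAlgebra (𝓡 d) G) :
    (VectorField.mpullbackWithin 𝓘(ℝ, EuclideanSpace ℝ (Fin d)) (𝓡 d)
      (extChartAt (𝓡 d) (1 : G)).symm (mulInvariantVectorField v) (range (𝓡 d)))
      =ᶠ[𝓝 (chartOne G)]
    fun x : EuclideanSpace ℝ (Fin d) => fderiv ℝ (chartMul G) (x, chartOne G) (0, v) := by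
  have hc : ContinuousAt (fun x : EuclideanSpace ℝ (Fin d) => (x, chartOne (d := d) G))
    (chartOne G) := by fun_prop
  filter_upwards [target_mem_nhds_chartOne (G := G),
    hc.eventually eventually_differentiableAt_chartMul] with x hx hd
  have e := (extChartAt (𝓡 d) (1 : G)).right_inv hx
  have h := mfderiv_extChartAt_mulInvariantVectorField (d := d) (G := G)
    (g := (extChartAt (𝓡 d) (1 : G)).symm x)
    ((extChartAt (𝓡 d) (1 : G)).map_target hx) (by rw [e]; exact hd) v
  rw [e] at h
  rw [← h, VectorField.mpullbackWithin_apply]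
  have hi := ContinuousLinearMap.inverse_eq
    (mfderivWithin_extChartAt_symm_comp_mfderiv_extChartAt (I := 𝓡 d) hx)
    (mfderiv_extChartAt_comp_mfderivWithin_extChartAt_symm (I := 𝓡 d) hx)
  rw [hi]

omit [T2Space G] in
theorem hasFDerivAt_fderiv_chartMul :
    HasFDerivAt (fderiv ℝ (chartMul (d := d) G))
      (fderiv ℝ (fderiv ℝ (chartMul (d := d) G)) (chartOne G, chartOne G))
      (chartOne G, chartOne G) :=
  (((contDiffAt_chartMul (d := d) (G := G)).fderiv_right (m := 1) (by norm_cast)).differentiableAt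
    (by simp)).hasFDerivAt

theorem lieBracket_fderiv_snd {E : Type*} [NormedAddCommGroup E] [NormedSpace ℝ E] {f : E × E → E}
    {x : E} {D : E × E →L[ℝ] E × E →L[ℝ] E} (hD : HasFDerivAt (fderiv ℝ f) D (x, x))
    (h0 : ∀ v, fderiv ℝ f (x, x) (0, v) = v) (v w : E) :
    VectorField.lieBracket ℝ (fun y => fderiv ℝ f (y, x) (0, v))
      (fun y => fderiv ℝ f (y, x) (0, w)) x = D (v, 0) (0, w) - D (w, 0) (0, v) := by
  have hd : ∀ v : E, HasFDerivAt (fun y : E => fderiv ℝ f (y, x) (0, v))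
      ((D.comp (.inl ℝ E E)).flip (0, v)) x := fun v => by
    have h₁ : HasFDerivAt (fun y : E => fderiv ℝ f (y, x)) (D.comp (.inl ℝ E E)) x :=
      HasFDerivAt.comp (f := fun y => (y, x)) x hD (hasFDerivAt_prodMk_left _ _)
    simpa using h₁.clm_apply (hasFDerivAt_const ((0, v) : E × E) x)
  rw [VectorField.lieBracket_eq]
  simp [(hd _).fderiv, h0]

theorem bracket_eq_chartMul (v w : GroupLieAlgebra (𝓡 d) G) :
    ⁅v, w⁆ = fderiv ℝ (fderiv ℝ (chartMul (d := d) G)) (chartOne G, chartOne G) (v, 0) (0, w) -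
      fderiv ℝ (fderiv ℝ (chartMul (d := d) G)) (chartOne G, chartOne G) (w, 0) (0, v) := by
  have h0 : ∀ v : EuclideanSpace ℝ (Fin d),
      fderiv ℝ (chartMul (d := d) G) (chartOne G, chartOne G) (0, v) = v := fun v => by
    rw [hasStrictFDerivAt_chartMul.hasFDerivAt.fderiv]
    exact zero_add v
  let T : EuclideanSpace ℝ (Fin d) →L[ℝ] EuclideanSpace ℝ (Fin d) :=
    mfderiv (𝓡 d) 𝓘(ℝ, EuclideanSpace ℝ (Fin d)) (extChartAt (𝓡 d) (1 : G)) 1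
  have hT : T = ContinuousLinearMap.id ℝ _ := mfderiv_extChartAt_self
  have hu : (extChartAt (𝓡 d) (1 : G)).symm ⁻¹' univ ∩ range (𝓡 d) = univ := by simp
  let V : EuclideanSpace ℝ (Fin d) → EuclideanSpace ℝ (Fin d) :=
    VectorField.mpullbackWithin 𝓘(ℝ, EuclideanSpace ℝ (Fin d)) (𝓡 d)
      (extChartAt (𝓡 d) (1 : G)).symm (mulInvariantVectorField v) (range (𝓡 d))
  let W : EuclideanSpace ℝ (Fin d) → EuclideanSpace ℝ (Fin d) :=
    VectorField.mpullbackWithin 𝓘(ℝ, EuclideanSpace ℝ (Fin d)) (𝓡 d)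
      (extChartAt (𝓡 d) (1 : G)).symm (mulInvariantVectorField w) (range (𝓡 d))
  have e₁ : ⁅v, w⁆ = T.inverse
      (VectorField.lieBracketWithin ℝ V W ((extChartAt (𝓡 d) (1 : G)).symm ⁻¹' univ ∩ range (𝓡 d))
        (chartOne G)) := rfl
  have e₂ : VectorField.lieBracket ℝ V W (chartOne G) =
      VectorField.lieBracket ℝ (fun y => fderiv ℝ (chartMul (d := d) G) (y, chartOne G) (0, v))
      (fun y => fderiv ℝ (chartMul (d := d) G) (y, chartOne G) (0, w)) (chartOne G) :=
    Filter.EventuallyEq.lieBracket_vectorField_eq (mpullbackWithin_mulInvariantVectorField v)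
      (mpullbackWithin_mulInvariantVectorField w)
  have e₃ : VectorField.lieBracket ℝ V W (chartOne G) = _ := e₂.trans
    (lieBracket_fderiv_snd (E := EuclideanSpace ℝ (Fin d)) hasFDerivAt_fderiv_chartMul h0 v w)
  rw [hu, VectorField.lieBracketWithin_univ, hT, ContinuousLinearMap.inverse_id, e₃] at e₁
  exact e₁

theorem hasDerivAt_of_clm_apply_eq {E : Type*} [NormedAddCommGroup E] [NormedSpace ℝ E]
    [CompleteSpace E] {B : ℝ → E →L[ℝ] E} {B' : E →L[ℝ] E} {r c : ℝ → E} {r' : E} {t : ℝ}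
    (hB : HasDerivAt B B' t) (hB1 : B t = 1) (hr : HasDerivAt r r' t)
    (h : ∀ᶠ s in 𝓝 t, B s (c s) = r s) : HasDerivAt c (r' - B' (r t)) t := by
  have hi : HasDerivAt (fun s => Ring.inverse (B s)) (-B') t := by
    have h₁ : HasFDerivAt (𝕜 := ℝ) Ring.inverse
        (-ContinuousLinearMap.mulLeftRight ℝ (E →L[ℝ] E) ↑(1 : (E →L[ℝ] E)ˣ)⁻¹
          ↑(1 : (E →L[ℝ] E)ˣ)⁻¹) (B t) := by
      rw [hB1]
      exact hasFDerivAt_ringInverse (𝕜 := ℝ) (1 : (E →L[ℝ] E)ˣ)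
    refine (h₁.comp_hasDerivAt t hB).congr_deriv ?_
    simp
  have hu : ∀ᶠ s in 𝓝 t, IsUnit (B s) :=
    hB.continuousAt.eventually (Units.isOpen.mem_nhds (by rw [hB1]; exact isUnit_one))
  have h₂ := (hi.clm_apply hr).congr_of_eventuallyEq (f₁ := c) (by
    filter_upwards [h, hu] with s hs hs'
    rw [← hs, ← mul_apply_eq_comp, Ring.inverse_mul_cancel _ hs']
    rfl)
  refine h₂.congr_deriv ?_
  rw [hB1, Ring.inverse_one]
  simp [sub_eq_neg_add]

theorem hasDerivAt_lieAd_lieExp_zero (v w : GroupLieAlgebra (𝓡 d) G) :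
    HasDerivAt (fun t : ℝ => @id (EuclideanSpace ℝ (Fin d)) (lieAd (lieExp (t • v) : G) w))
      (⁅v, w⁆ : GroupLieAlgebra (𝓡 d) G) 0 := by
  set D := fderiv ℝ (fderiv ℝ (chartMul (d := d) G)) (chartOne G, chartOne G) with hDdef
  have hD : HasFDerivAt (fderiv ℝ (chartMul (d := d) G)) D (chartOne G, chartOne G) :=
    hasFDerivAt_fderiv_chartMul
  have hf : fderiv ℝ (chartMul (d := d) G) (chartOne G, chartOne G) = _ :=
    hasStrictFDerivAt_chartMul.hasFDerivAt.fderiv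
  have hη := hasDerivAt_chartExp_zero v
  have hl : HasDerivAt (fun t => fderiv ℝ (chartMul (d := d) G) (chartExp v t, chartOne G))
      (D (v, 0)) 0 := by
    have h₃ : HasDerivAt (fun t : ℝ => (chartExp v t, chartOne (d := d) G))
        ((v, 0) : EuclideanSpace ℝ (Fin d) × EuclideanSpace ℝ (Fin d)) 0 :=
      hη.prodMk (hasDerivAt_const (0 : ℝ) _)
    have h₄ : HasFDerivAt (fderiv ℝ (chartMul (d := d) G)) D (chartExp v 0, chartOne G) := by
      rwa [chartExp_zero]
    exact h₄.comp_hasDerivAt (0 : ℝ) h₃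
  have hr : HasDerivAt (fun t => fderiv ℝ (chartMul (d := d) G) (chartOne G, chartExp v t))
      (D (0, v)) 0 := by
    have h₃ : HasDerivAt (fun t : ℝ => (chartOne (d := d) G, chartExp v t))
        ((0, v) : EuclideanSpace ℝ (Fin d) × EuclideanSpace ℝ (Fin d)) 0 :=
      (hasDerivAt_const (0 : ℝ) _).prodMk hη
    have h₄ : HasFDerivAt (fderiv ℝ (chartMul (d := d) G)) D (chartOne G, chartExp v 0) := by
      rwa [chartExp_zero]
    exact h₄.comp_hasDerivAt (0 : ℝ) h₃
  have hl' : HasDerivAt (fun t => fderiv ℝ (chartMul (d := d) G) (chartExp v t, chartOne G)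
      ((0, w) : EuclideanSpace ℝ (Fin d) × EuclideanSpace ℝ (Fin d))) (D (v, 0) (0, w)) 0 := by
    simpa using hl.clm_apply (hasDerivAt_const (0 : ℝ)
      ((0, w) : EuclideanSpace ℝ (Fin d) × EuclideanSpace ℝ (Fin d)))
  have hB : HasDerivAt (fun t => (fderiv ℝ (chartMul (d := d) G) (chartOne G, chartExp v t)).comp
      (.inl ℝ (EuclideanSpace ℝ (Fin d)) (EuclideanSpace ℝ (Fin d))))
      ((D (0, v)).comp (.inl ℝ _ _)) 0 := by
    simpa using hr.clm_comp (hasDerivAt_const (0 : ℝ)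
      (ContinuousLinearMap.inl ℝ (EuclideanSpace ℝ (Fin d)) (EuclideanSpace ℝ (Fin d))))
  have key := hasDerivAt_of_clm_apply_eq
    (c := fun t : ℝ => @id (EuclideanSpace ℝ (Fin d)) (lieAd (lieExp (t • v) : G) w))
    hB (by rw [chartExp_zero, hf]; ext; simp) hl' (by
      have hc₁ : ContinuousAt (fun t => (chartExp v t, chartOne (d := d) G)) 0 :=
        hη.continuousAt.prodMk continuousAt_const
      have hc₂ : ContinuousAt (fun t => (chartOne (d := d) G, chartExp v t)) 0 :=
        continuousAt_const.prodMk hη.continuousAt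
      rw [ContinuousAt, chartExp_zero] at hc₁ hc₂
      filter_upwards [eventually_lieExp_mem_source v,
        hc₁.eventually (eventually_differentiableAt_chartMul (G := G)),
        hc₂.eventually (eventually_differentiableAt_chartMul (G := G))] with t ht h₁ h₂
      exact (fderiv_chartMul_lieAd ht h₁ h₂ w).symm)
  refine key.congr_deriv ?_
  rw [bracket_eq_chartMul, ← hDdef, chartExp_zero, hf]
  have hsymm := (contDiffAt_chartMul (d := d) (G := G)).isSymmSndFDerivAt
    (by rw [minSmoothness_of_isRCLikeNormedField]; norm_cast)
    ((w, 0) : EuclideanSpace ℝ (Fin d) × EuclideanSpace ℝ (Fin d)) (0, v)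
  rw [← hDdef] at hsymm
  rw [hsymm]
  simp only [add_apply, ContinuousLinearMap.coe_fst',
    ContinuousLinearMap.coe_snd', ContinuousLinearMap.comp_apply, ContinuousLinearMap.inl_apply]
  exact congrArg (fun z : EuclideanSpace ℝ (Fin d) => D (v, 0) (0, w) - D (0, v) (z, 0))
    (zero_add (w : EuclideanSpace ℝ (Fin d)))

theorem hasDerivAt_lieAd_lieExp (v w : GroupLieAlgebra (𝓡 d) G) (t : ℝ) :
    HasDerivAt (fun t : ℝ => @id (EuclideanSpace ℝ (Fin d)) (lieAd (lieExp (t • v) : G) w))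
      (lieAd (lieExp (t • v) : G) ⁅v, w⁆) t := by
  have h₁ := hasDerivAt_lieAd_lieExp_zero v w
  rw [← sub_self t] at h₁
  have h₂ := h₁.comp_sub_const t t
  let T : EuclideanSpace ℝ (Fin d) →L[ℝ] EuclideanSpace ℝ (Fin d) := lieAd (lieExp (t • v) : G)
  have h₃ := T.hasFDerivAt.comp_hasDerivAt t h₂
  refine h₃.congr_of_eventuallyEq (Eventually.of_forall fun s => ?_)
  have e : (lieExp (s • v) : G) = lieExp (t • v) * lieExp ((s - t) • v) := by
    rw [← lieExp_add_smul, add_sub_cancel]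
  simp only [e]
  exact lieAd_mul _ _ _

theorem hasDerivAt_exp_smul_neg_mulVec {n : ℕ} (N : Matrix (Fin n) (Fin n) ℝ) (y : Fin n → ℝ)
    (t : ℝ) : HasDerivAt (fun t : ℝ => NormedSpace.exp (t • -N) *ᵥ y)
      (-(N *ᵥ NormedSpace.exp (t • -N) *ᵥ y)) t := by
  let _ : NormedRing (Matrix (Fin n) (Fin n) ℝ) := Matrix.linftyOpNormedRing
  let _ : NormedAlgebra ℝ (Matrix (Fin n) (Fin n) ℝ) := Matrix.linftyOpNormedAlgebra
  have h₁ := hasDerivAt_exp_smul_const' (𝕂 := ℝ) (-N) t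
  have h₂ := (LinearMap.toContinuousLinearMap
    ((Matrix.mulVecBilin ℝ ℝ).flip y)).hasFDerivAt.comp_hasDerivAt t h₁
  refine h₂.congr_deriv ?_
  change (-N * NormedSpace.exp (t • -N)) *ᵥ y = -(N *ᵥ NormedSpace.exp (t • -N) *ᵥ y)
  rw [neg_mul, Matrix.neg_mulVec, Matrix.mulVec_mulVec]

omit [T2Space G] in
theorem coe_eq_sum_repr {𝔭 : LieIdeal ℝ (GroupLieAlgebra (𝓡 d) G)} {n : ℕ}
    (X : Module.Basis (Fin n) ℝ 𝔭) (Y : 𝔭) :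
    (Y : GroupLieAlgebra (𝓡 d) G) = ∑ j, X.repr Y j • (X j : GroupLieAlgebra (𝓡 d) G) := by
  have h := congrArg 𝔭.toSubmodule.subtype (X.sum_repr Y)
  rw [map_sum] at h
  simp only [map_smul] at h
  exact h.symm

theorem lieAd_lieExp_neg_coe {𝔭 : LieIdeal ℝ (GroupLieAlgebra (𝓡 d) G)} {n : ℕ}
    (X : Module.Basis (Fin n) ℝ 𝔭) (v : GroupLieAlgebra (𝓡 d) G) (Y : 𝔭) :
    lieAd (lieExp (-v) : G) (Y : GroupLieAlgebra (𝓡 d) G) =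
      (Matrix.toLin X X (NormedSpace.exp (-(LinearMap.toMatrix X X
        (LieModule.toEnd ℝ (GroupLieAlgebra (𝓡 d) G) 𝔭 v)))) Y : 𝔭) := by
  set N := LinearMap.toMatrix X X (LieModule.toEnd ℝ (GroupLieAlgebra (𝓡 d) G) 𝔭 v) with hN
  let c : ℝ → Fin n → ℝ := fun t => NormedSpace.exp (t • -N) *ᵥ (X.repr Y)
  have hc : ∀ t, HasDerivAt c (-(N *ᵥ c t)) t := hasDerivAt_exp_smul_neg_mulVec N (X.repr Y)
  have e : ∀ j, ⁅v, (X j : GroupLieAlgebra (𝓡 d) G)⁆ =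
      ∑ i, N i j • (X i : GroupLieAlgebra (𝓡 d) G) := fun j => by
    have h := coe_eq_sum_repr X (LieModule.toEnd ℝ (GroupLieAlgebra (𝓡 d) G) 𝔭 v (X j))
    refine Eq.trans ?_ (h.trans (Finset.sum_congr rfl fun i _ => ?_))
    · simp
    · rw [hN, LinearMap.toMatrix_apply]
  let u : ℝ → EuclideanSpace ℝ (Fin d) := fun t =>
    ∑ j, c t j • @id (EuclideanSpace ℝ (Fin d)) (lieAd (lieExp (t • v) : G) (X j))
  have hu : ∀ t, HasDerivAt u 0 t := fun t => by
    have h₁ := HasDerivAt.fun_sum (u := Finset.univ) fun j _ =>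
      (hasDerivAt_pi.1 (hc t) j).smul (hasDerivAt_lieAd_lieExp v (X j) t)
    refine h₁.congr_deriv ?_
    have e₂ : ∀ j, c t j • (@id (EuclideanSpace ℝ (Fin d))
        (lieAd (lieExp (t • v) : G) ⁅v, (X j : GroupLieAlgebra (𝓡 d) G)⁆)) =
        ∑ i, (N i j * c t j) • @id (EuclideanSpace ℝ (Fin d)) (lieAd (lieExp (t • v) : G) (X i)) := by
      intro j
      rw [e j, map_sum]
      refine (Finset.smul_sum (N := EuclideanSpace ℝ (Fin d)) (r := c t j)).trans
        (Finset.sum_congr rfl fun i _ => ?_)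
      rw [map_smul, mul_comm]
      exact smul_smul (M := ℝ) (α := EuclideanSpace ℝ (Fin d)) _ _ _
    have e₃ : ∑ j, c t j • (@id (EuclideanSpace ℝ (Fin d))
        (lieAd (lieExp (t • v) : G) ⁅v, (X j : GroupLieAlgebra (𝓡 d) G)⁆)) =
        ∑ i, (N *ᵥ c t) i • @id (EuclideanSpace ℝ (Fin d)) (lieAd (lieExp (t • v) : G) (X i)) := by
      simp_rw [e₂]
      rw [Finset.sum_comm]
      simp_rw [← Finset.sum_smul]
      rfl
    rw [Finset.sum_add_distrib]
    refine (congrArg (· + _) e₃).trans ?_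
    rw [← Finset.sum_add_distrib]
    refine Finset.sum_eq_zero fun i _ => ?_
    rw [Pi.neg_apply, neg_smul]
    exact add_neg_cancel _
  have h01 : u 1 = u 0 := is_const_of_deriv_eq_zero (fun t => (hu t).differentiableAt)
    (fun t => (hu t).deriv) 1 0
  have hu0 : u 0 = (Y : GroupLieAlgebra (𝓡 d) G) := by
    rw [coe_eq_sum_repr X Y]
    refine Finset.sum_congr rfl fun j _ => ?_
    simp only [c, zero_smul, NormedSpace.exp_zero, Matrix.one_mulVec, lieExp_zero, lieAd_one]
    rfl
  have hu1 : u 1 = lieAd (lieExp v : G) (Matrix.toLin X X (NormedSpace.exp (-N)) Y : 𝔭) := by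
    rw [coe_eq_sum_repr X, map_sum]
    refine Finset.sum_congr rfl fun j _ => ?_
    rw [map_smul]
    have h : X.repr (Matrix.toLin X X (NormedSpace.exp (-N)) Y) j =
        (NormedSpace.exp (-N) *ᵥ X.repr Y) j := by
      rw [Matrix.repr_toLin]
    rw [h]
    simp only [c, one_smul]
    rfl
  have h₅ := hu1.symm.trans (h01.trans hu0)
  have h₆ := congrArg (lieAd (lieExp (-v) : G)) h₅
  rw [← lieAd_mul, lieExp_neg, inv_mul_cancel, lieAd_one] at h₆
  rw [lieExp_neg]
  exact h₆.symm

end Bracket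

/-! ### Coordinates of the second kind -/

section SecondKind

variable {d : ℕ} {G : Type*} [TopologicalSpace G] [ChartedSpace (EuclideanSpace ℝ (Fin d)) G]
  [Group G] [LieGroup (𝓡 d) ∞ G] [T2Space G]

theorem lieAd_list_prod_inv_coe {𝔭 : LieIdeal ℝ (GroupLieAlgebra (𝓡 d) G)} {n : ℕ}
    (X : Module.Basis (Fin n) ℝ 𝔭) (l : List (GroupLieAlgebra (𝓡 d) G)) (Y : 𝔭) :
    lieAd ((l.map lieExp).prod : G)⁻¹ (Y : GroupLieAlgebra (𝓡 d) G) =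
      (Matrix.toLin X X ((l.map fun v => NormedSpace.exp (-(LinearMap.toMatrix X X
        (LieModule.toEnd ℝ (GroupLieAlgebra (𝓡 d) G) 𝔭 v)))).reverse.prod) Y : 𝔭) := by
  induction l generalizing Y with
  | nil => simp
  | cons v l ih =>
    have h₁ := lieAd_lieExp_neg_coe (G := G) X v Y
    let F : GroupLieAlgebra (𝓡 d) G → Matrix (Fin n) (Fin n) ℝ := fun v =>
      NormedSpace.exp (-(LinearMap.toMatrix X X
        (LieModule.toEnd ℝ (GroupLieAlgebra (𝓡 d) G) 𝔭 v)))
    have h₂ := LinearMap.congr_fun (Matrix.toLin_mul X X X (l.map F).reverse.prod (F v)) Y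
    have h₃ := lieAd_mul ((l.map lieExp).prod : G)⁻¹ (lieExp (-v)) (Y : GroupLieAlgebra (𝓡 d) G)
    have h₄ : (((v :: l).map lieExp).prod : G)⁻¹ = ((l.map lieExp).prod : G)⁻¹ * lieExp (-v) := by
      rw [List.map_cons, List.prod_cons, mul_inv_rev, ← lieExp_neg v]
    rw [h₄]
    refine h₃.trans ((congrArg (lieAd ((l.map lieExp).prod : G)⁻¹) h₁).trans
      ((ih _).trans ?_))
    rw [List.map_cons, List.reverse_cons, List.prod_append, List.prod_singleton]
    exact congrArg Subtype.val h₂.symm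

theorem lieAd_secondKind_inv {𝔭 : LieIdeal ℝ (GroupLieAlgebra (𝓡 d) G)}
    {𝔪 : LieSubalgebra ℝ (GroupLieAlgebra (𝓡 d) G)} {n₁ n₂ : ℕ}
    (X : Module.Basis (Fin n₁) ℝ 𝔭) (A : Module.Basis (Fin n₂) ℝ 𝔪) (a : Fin n₂ → ℝ) (Y : 𝔭) :
    lieAd (secondKind A a : G)⁻¹ (Y : GroupLieAlgebra (𝓡 d) G) = (opC A X a Y : 𝔭) := by
  have h := lieAd_list_prod_inv_coe (G := G) X
    (List.ofFn fun k => a k • (A k : GroupLieAlgebra (𝓡 d) G)) Y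
  rwa [List.map_ofFn, List.map_ofFn] at h

/-- Ordered products of one-parameter groups. -/
def expProd {n : ℕ} (v : Fin n → GroupLieAlgebra (𝓡 d) G) (a : Fin n → ℝ) : G :=
  (List.ofFn fun k => lieExp (a k • v k)).prod

theorem expProd_zero {n : ℕ} (v : Fin n → GroupLieAlgebra (𝓡 d) G) : (expProd v 0 : G) = 1 := by
  simp [expProd]

omit [LieGroup (𝓡 d) ∞ G] [T2Space G] in
theorem expProd_succ {n : ℕ} (v : Fin (n + 1) → GroupLieAlgebra (𝓡 d) G) (a : Fin (n + 1) → ℝ) :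
    (expProd v a : G) = lieExp (a 0 • v 0) * expProd (fun k => v k.succ) (fun k => a k.succ) := by
  simp [expProd, List.ofFn_succ]

theorem continuous_expProd [IsTopologicalGroup G] {n : ℕ}
    (v : Fin n → GroupLieAlgebra (𝓡 d) G) : Continuous (expProd v : (Fin n → ℝ) → G) := by
  induction n with
  | zero =>
    have : (expProd v : (Fin 0 → ℝ) → G) = fun _ => 1 := by
      ext a
      simp [expProd]
    rw [this]
    exact continuous_const
  | succ n ih =>
    rw [funext (expProd_succ v)]
    exact ((continuous_lieExp_smul (v 0)).comp (continuous_apply 0)).mul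
      ((ih fun k => v k.succ).comp (by fun_prop))

omit [LieGroup (𝓡 d) ∞ G] [T2Space G] in
theorem expProd_mem {n : ℕ} {v : Fin n → GroupLieAlgebra (𝓡 d) G} {H : Subgroup G}
    (h : ∀ k (t : ℝ), (lieExp (t • v k) : G) ∈ H) (a : Fin n → ℝ) : expProd v a ∈ H := by
  refine list_prod_mem fun x hx => ?_
  obtain ⟨k, rfl⟩ := (List.mem_ofFn' _ _).1 hx
  exact h k _

theorem hasStrictFDerivAt_expProd [IsTopologicalGroup G] {n : ℕ}
    (v : Fin n → GroupLieAlgebra (𝓡 d) G) :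
    HasStrictFDerivAt (fun a : Fin n → ℝ => extChartAt (𝓡 d) (1 : G) (expProd v a))
      (∑ k, (ContinuousLinearMap.proj (R := ℝ) (φ := fun _ : Fin n => ℝ) k).smulRight
        (@id (EuclideanSpace ℝ (Fin d)) (v k))) 0 := by
  induction n with
  | zero =>
    have : (fun a : Fin 0 → ℝ => extChartAt (𝓡 d) (1 : G) (expProd v a)) =
        fun _ => extChartAt (𝓡 d) (1 : G) 1 := by
      ext1 a
      simp [expProd]
    rw [this]
    simpa using hasStrictFDerivAt_const (𝕜 := ℝ) (extChartAt (𝓡 d) (1 : G) 1) (0 : Fin 0 → ℝ)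
  | succ n ih =>
    let S : (Fin (n + 1) → ℝ) →L[ℝ] (Fin n → ℝ) :=
      ContinuousLinearMap.pi fun k => ContinuousLinearMap.proj k.succ
    have h₁ : HasStrictFDerivAt (fun a : Fin (n + 1) → ℝ => chartExp (v 0) (a 0))
        ((ContinuousLinearMap.proj (R := ℝ) (φ := fun _ : Fin (n + 1) => ℝ) 0).smulRight
        (@id (EuclideanSpace ℝ (Fin d)) (v 0))) 0 := by
      have h := (hasStrictDerivAt_chartExp (v 0)).hasStrictFDerivAt.comp (0 : Fin (n + 1) → ℝ)
        (ContinuousLinearMap.proj (R := ℝ) (φ := fun _ : Fin (n + 1) => ℝ) 0).hasStrictFDerivAt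
      exact h.congr_fderiv (ContinuousLinearMap.ext fun x => rfl)
    have h₂ := HasStrictFDerivAt.comp (f := S) (0 : Fin (n + 1) → ℝ)
      (by rw [map_zero]; exact ih fun k => v k.succ) S.hasStrictFDerivAt
    have h₃ := h₁.prodMk h₂
    have h₄ : HasStrictFDerivAt (fun a : Fin (n + 1) → ℝ => chartMul G (chartExp (v 0) (a 0),
        extChartAt (𝓡 d) (1 : G) (expProd (fun k => v k.succ) (S a)))) _ 0 :=
      HasStrictFDerivAt.comp (g := chartMul G) (0 : Fin (n + 1) → ℝ)
        (by
          have e : ((chartExp (v 0) ((0 : Fin (n + 1) → ℝ) 0)), 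
              extChartAt (𝓡 d) (1 : G) (expProd (fun k => v k.succ) (S 0))) =
              (chartOne (d := d) G, chartOne (d := d) G) := by
            simp [expProd_zero, chartOne]
          rw [e]
          exact hasStrictFDerivAt_chartMul) h₃
    refine (h₄.congr_of_eventuallyEq ?_).congr_fderiv ?_
    · have c₁ : ∀ᶠ a : Fin (n + 1) → ℝ in 𝓝 0,
          (lieExp (a 0 • v 0) : G) ∈ (extChartAt (𝓡 d) (1 : G)).source :=
        ((continuous_apply (A := fun _ => ℝ) (0 : Fin (n + 1))).tendsto 0).eventually
          (eventually_lieExp_mem_source (v 0))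
      have c₂ : ∀ᶠ a : Fin (n + 1) → ℝ in 𝓝 0,
          (expProd (fun k => v k.succ) (S a) : G) ∈ (extChartAt (𝓡 d) (1 : G)).source := by
        refine (((continuous_expProd fun k => v k.succ).comp S.continuous).continuousAt
          (x := 0)).eventually_mem ?_
        rw [Function.comp_apply, map_zero, expProd_zero]
        exact extChartAt_source_mem_nhds (I := 𝓡 d) (1 : G)
      filter_upwards [c₁, c₂] with a h₁ h₂
      rw [chartExp, chartMul_apply h₁ h₂, expProd_succ]
      rfl
    · ext a
      simp [Fin.sum_univ_succ, S]

theorem map_expProd_mul_nhds [IsTopologicalGroup G] {n₁ n₂ : ℕ}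
    {v : Fin n₁ → GroupLieAlgebra (𝓡 d) G} {w : Fin n₂ → GroupLieAlgebra (𝓡 d) G}
    (h : Submodule.span ℝ (range v) ⊔ Submodule.span ℝ (range w) = ⊤) :
    map (fun p : (Fin n₁ → ℝ) × (Fin n₂ → ℝ) => (expProd v p.1 * expProd w p.2 : G)) (𝓝 0) =
      𝓝 1 := by
  let Q : (Fin n₁ → ℝ) × (Fin n₂ → ℝ) → G := fun p => expProd v p.1 * expProd w p.2
  have hQc : Continuous Q := ((continuous_expProd v).comp continuous_fst).mul
    ((continuous_expProd w).comp continuous_snd)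
  have hQ0 : Q 0 = 1 := by simp [Q, expProd_zero]
  have h₁ := HasStrictFDerivAt.comp (f := Prod.fst) (0 : (Fin n₁ → ℝ) × (Fin n₂ → ℝ))
    (hasStrictFDerivAt_expProd v) hasStrictFDerivAt_fst
  have h₂ := HasStrictFDerivAt.comp (f := Prod.snd) (0 : (Fin n₁ → ℝ) × (Fin n₂ → ℝ))
    (hasStrictFDerivAt_expProd w) hasStrictFDerivAt_snd
  have h₃ := h₁.prodMk h₂
  have h₄ := HasStrictFDerivAt.comp (g := chartMul G) (0 : (Fin n₁ → ℝ) × (Fin n₂ → ℝ))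
    (by
      have e : (extChartAt (𝓡 d) (1 : G) (expProd v (0 : (Fin n₁ → ℝ) × (Fin n₂ → ℝ)).1),
          extChartAt (𝓡 d) (1 : G) (expProd w (0 : (Fin n₁ → ℝ) × (Fin n₂ → ℝ)).2)) =
          (chartOne (d := d) G, chartOne (d := d) G) := by
        simp [expProd_zero, chartOne]
      rw [e]
      exact hasStrictFDerivAt_chartMul) h₃
  have hs : ∀ᶠ p in 𝓝 0, Q p ∈ (extChartAt (𝓡 d) (1 : G)).source := by
    refine hQc.continuousAt.eventually_mem ?_
    rw [hQ0]
    exact extChartAt_source_mem_nhds (I := 𝓡 d) (1 : G)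
  have h₅ := h₄.congr_of_eventuallyEq (f₁ := fun p => extChartAt (𝓡 d) (1 : G) (Q p)) (by
    have c₁ : ∀ᶠ p : (Fin n₁ → ℝ) × (Fin n₂ → ℝ) in 𝓝 0,
        (expProd v p.1 : G) ∈ (extChartAt (𝓡 d) (1 : G)).source := by
      refine ((continuous_expProd v).comp continuous_fst).continuousAt.eventually_mem ?_
      simpa [expProd_zero] using extChartAt_source_mem_nhds (I := 𝓡 d) (1 : G)
    have c₂ : ∀ᶠ p : (Fin n₁ → ℝ) × (Fin n₂ → ℝ) in 𝓝 0,
        (expProd w p.2 : G) ∈ (extChartAt (𝓡 d) (1 : G)).source := by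
      refine ((continuous_expProd w).comp continuous_snd).continuousAt.eventually_mem ?_
      simpa [expProd_zero] using extChartAt_source_mem_nhds (I := 𝓡 d) (1 : G)
    filter_upwards [c₁, c₂] with p h₁ h₂
    exact chartMul_apply h₁ h₂)
  have h₆ := h₅.map_nhds_eq_of_surj (by
    rw [eq_top_iff]
    have key : ∀ z ∈ Submodule.span ℝ (range v) ⊔ Submodule.span ℝ (range w),
        ∃ p : (Fin n₁ → ℝ) × (Fin n₂ → ℝ), ∑ k, p.1 k • v k + ∑ k, p.2 k • w k = z := by
      intro z hz
      obtain ⟨x, hx, y, hy, rfl⟩ := Submodule.mem_sup.1 hz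
      obtain ⟨a, rfl⟩ := (Submodule.mem_span_range_iff_exists_fun ℝ).1 hx
      obtain ⟨b, rfl⟩ := (Submodule.mem_span_range_iff_exists_fun ℝ).1 hy
      exact ⟨(a, b), rfl⟩
    rintro z -
    obtain ⟨p, hp⟩ := key z (by rw [h]; trivial)
    refine ⟨p, ?_⟩
    rw [← hp]
    simp
    rfl)
  have h₇ : map (extChartAt (𝓡 d) (1 : G)).symm (𝓝 (extChartAt (𝓡 d) (1 : G) 1)) = 𝓝 1 := by
    have := map_extChartAt_symm_nhdsWithin_range (I := 𝓡 d) (1 : G)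
    simpa using this
  rw [hQ0] at h₆
  rw [← h₆, map_map] at h₇
  refine (map_congr ?_).trans h₇
  filter_upwards [hs] with p hp
  exact ((extChartAt (𝓡 d) (1 : G)).left_inv hp).symm

end SecondKind

/-! ### Haar measure in orbit coordinates -/

section Orbit

/-- Local coordinates `e` of a group `M`, with a linear action `ρ` of `M` such that the orbit map
`a ↦ ρ (e a) v`, followed by a linear projection `p`, is a diffeomorphism on `O`. -/
structure OrbitCoords {M : Type*} [Group M] [TopologicalSpace M] {n : ℕ} {V : Type*}
    [NormedAddCommGroup V] [NormedSpace ℝ V] (ρ : M →* (V →L[ℝ] V)) (p : V →L[ℝ] (Fin n → ℝ))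
    (e : (Fin n → ℝ) → M) (θ : (Fin n → ℝ) → V) (O : Set (Fin n → ℝ)) : Prop where
  continuous_coord : Continuous e
  coord_zero : e 0 = 1
  nhds_le : 𝓝 1 ≤ map e (𝓝 0)
  contDiff_orbit : ContDiff ℝ ∞ θ
  orbit_eq : ∀ a, θ a = ρ (e a) (θ 0)
  continuous_action : Continuous fun a => ρ (e a)
  zero_mem : 0 ∈ O
  diffeo : IsDiffeoOn (fun a => p (θ a)) O

namespace OrbitCoords

variable {M : Type*} [Group M] [TopologicalSpace M] {n : ℕ} {V : Type*}
  [NormedAddCommGroup V] [NormedSpace ℝ V] {ρ : M →* (V →L[ℝ] V)} {p : V →L[ℝ] (Fin n → ℝ)}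
  {e : (Fin n → ℝ) → M} {θ : (Fin n → ℝ) → V} {O : Set (Fin n → ℝ)}

/-- The derivative at `a` of `a ↦ p (ρ g (θ a))`. -/
def orbitDeriv (ρ : M →* (V →L[ℝ] V)) (p : V →L[ℝ] (Fin n → ℝ)) (θ : (Fin n → ℝ) → V) (g : M)
    (a : Fin n → ℝ) : (Fin n → ℝ) →L[ℝ] (Fin n → ℝ) :=
  (p.comp (ρ g)).comp (fderiv ℝ θ a)

/-- The density of Haar measure in the coordinates `e`. -/
def haarWeight (ρ : M →* (V →L[ℝ] V)) (p : V →L[ℝ] (Fin n → ℝ)) (e : (Fin n → ℝ) → M)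
    (θ : (Fin n → ℝ) → V) (a : Fin n → ℝ) : ℝ :=
  |(orbitDeriv ρ p θ 1 a).det| / |(orbitDeriv ρ p θ (e a) 0).det|

variable (h : OrbitCoords ρ p e θ O)
include h

theorem hasStrictFDerivAt_orbit (g : M) (a : Fin n → ℝ) :
    HasStrictFDerivAt (fun a => p (ρ g (θ a))) (orbitDeriv ρ p θ g a) a :=
  (p.comp (ρ g)).hasStrictFDerivAt.comp a
    (h.contDiff_orbit.contDiffAt.hasStrictFDerivAt (by simp))

theorem hasFDerivAt_proj (a : Fin n → ℝ) :
    HasFDerivAt (fun a => p (θ a)) (orbitDeriv ρ p θ 1 a) a := by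
  simpa using (h.hasStrictFDerivAt_orbit 1 a).hasFDerivAt

theorem orbit_of_mul {g : M} {a b : Fin n → ℝ} (hab : g * e a = e b) : ρ g (θ a) = θ b := by
  rw [h.orbit_eq a, h.orbit_eq b, ← hab, map_mul]
  rfl

theorem injOn_proj : InjOn (fun a => p (θ a)) O := by
  obtain ⟨-, -, -, g, -, hg⟩ := h.diffeo
  exact hg.injOn

theorem injOn_coord : InjOn e O := fun a ha b hb hab => by
  refine h.injOn_proj ha hb ?_
  simp only
  rw [h.orbit_eq a, h.orbit_eq b, hab]

theorem det_proj_ne_zero {a : Fin n → ℝ} (ha : a ∈ O) : (orbitDeriv ρ p θ 1 a).det ≠ 0 := by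
  obtain ⟨hO, hO', -, g, hg, hgl⟩ := h.diffeo
  have h₁ := h.hasFDerivAt_proj a
  have h₂ : HasFDerivAt g (fderiv ℝ g (p (θ a))) (p (θ a)) :=
    ((hg.contDiffAt (hO'.mem_nhds (mem_image_of_mem _ ha))).differentiableAt (by simp)).hasFDerivAt
  have h₃ := (h₂.comp a h₁).unique ((hasFDerivAt_id a).congr_of_eventuallyEq
    (by filter_upwards [hO.mem_nhds ha] with b hb using hgl hb))
  intro h0
  have h₄ := congrArg ContinuousLinearMap.det h₃
  simp only [ContinuousLinearMap.det, ContinuousLinearMap.toLinearMap_comp, LinearMap.det_comp] at h₄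
  rw [ContinuousLinearMap.det] at h0
  rw [h0] at h₄
  simp at h₄

variable [IsTopologicalGroup M]

theorem exists_transition {a : Fin n → ℝ} (ha : a ∈ O) :
    ∃ (c : (Fin n → ℝ) → (Fin n → ℝ)) (c' : (Fin n → ℝ) →L[ℝ] (Fin n → ℝ)), c a = 0 ∧
      HasStrictFDerivAt c c' a ∧ c'.det ≠ 0 ∧ (∀ᶠ b in 𝓝 a, e b = e a * e (c b)) ∧
      ∀ g, orbitDeriv ρ p θ g a = (orbitDeriv ρ p θ (g * e a) 0).comp c' := by
  obtain ⟨hO, hO', -, g, hg, hgl⟩ := h.diffeo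
  let c : (Fin n → ℝ) → (Fin n → ℝ) := fun b => g (p (ρ (e a)⁻¹ (θ b)))
  have hca : p (ρ (e a)⁻¹ (θ a)) = p (θ 0) := by
    rw [h.orbit_of_mul (b := 0) (by rw [h.coord_zero, inv_mul_cancel])]
  have hc0 : c a = 0 := by
    simp only [c, hca]
    exact hgl h.zero_mem
  have hcd : ContDiffAt ℝ ∞ c a := by
    refine ContDiffAt.comp a ?_ ((p.comp (ρ (e a)⁻¹)).contDiff.comp h.contDiff_orbit).contDiffAt
    rw [hca]
    exact hg.contDiffAt (hO'.mem_nhds (mem_image_of_mem _ h.zero_mem))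
  have hcs := hcd.hasStrictFDerivAt (by simp)
  have hev : ∀ᶠ b in 𝓝 a, e b = e a * e (c b) := by
    have h₁ : e '' O ∈ 𝓝 (1 : M) := h.nhds_le (image_mem_map (hO.mem_nhds h.zero_mem))
    have h₂ : ContinuousAt (fun b => (e a)⁻¹ * e b) a :=
      (continuous_const.mul h.continuous_coord).continuousAt
    have h₃ := h₂.eventually_mem (by rwa [inv_mul_cancel])
    filter_upwards [h₃] with b hb
    obtain ⟨x, hx, hxb⟩ := hb
    have : c b = x := by
      simp only [c]
      rw [h.orbit_of_mul hxb.symm]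
      exact hgl hx
    rw [this, hxb, mul_inv_cancel_left]
  have hD : ∀ g, orbitDeriv ρ p θ g a = (orbitDeriv ρ p θ (g * e a) 0).comp (fderiv ℝ c a) := by
    intro g
    have h₁ := (h.hasStrictFDerivAt_orbit g a).hasFDerivAt
    have h₂ : HasFDerivAt (fun b => p (ρ (g * e a) (θ (c b))))
        ((orbitDeriv ρ p θ (g * e a) 0).comp (fderiv ℝ c a)) a := by
      have h₃ := (h.hasStrictFDerivAt_orbit (g * e a) 0).hasFDerivAt
      rw [← hc0] at h₃
      exact hc0 ▸ h₃.comp a hcs.hasFDerivAt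
    refine h₁.unique (h₂.congr_of_eventuallyEq ?_)
    filter_upwards [hev] with b hb
    rw [map_mul, ContinuousLinearMap.mul_def, ContinuousLinearMap.comp_apply,
      h.orbit_of_mul hb.symm]
  refine ⟨c, fderiv ℝ c a, hc0, hcs, fun h0 => h.det_proj_ne_zero ha ?_, hev, hD⟩
  rw [hD 1]
  rw [ContinuousLinearMap.det] at h0 ⊢
  rw [ContinuousLinearMap.toLinearMap_comp, LinearMap.det_comp, h0, mul_zero]

theorem map_coord_nhds {a : Fin n → ℝ} (ha : a ∈ O) : map e (𝓝 a) = 𝓝 (e a) := by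
  refine le_antisymm h.continuous_coord.continuousAt ?_
  obtain ⟨c, c', hc0, hc, hdet, hev, -⟩ := h.exists_transition ha
  have h₁ : map c (𝓝 a) = 𝓝 0 := by
    rw [← hc0]
    refine hc.map_nhds_eq_of_surj ?_
    have : IsUnit (c' : (Fin n → ℝ) →ₗ[ℝ] (Fin n → ℝ)) :=
      (LinearMap.isUnit_iff_isUnit_det _).2 (isUnit_iff_ne_zero.2 hdet)
    exact (LinearMap.isUnit_iff_range_eq_top _).1 this
  have h₂ : map e (𝓝 a) = map (fun x => e a * x) (map e (map c (𝓝 a))) := by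
    rw [map_map, map_map]
    exact map_congr hev
  rw [h₂, h₁]
  refine le_trans ?_ (map_mono h.nhds_le)
  rw [map_mul_left_nhds_one]

theorem isOpen_image_coord {S : Set (Fin n → ℝ)} (hS : IsOpen S) (hSO : S ⊆ O) :
    IsOpen (e '' S) := by
  rw [isOpen_iff_mem_nhds]
  rintro _ ⟨a, ha, rfl⟩
  rw [← h.map_coord_nhds (hSO ha)]
  exact image_mem_map (hS.mem_nhds ha)

theorem det_ne_zero {a : Fin n → ℝ} (ha : a ∈ O) : (orbitDeriv ρ p θ (e a) 0).det ≠ 0 := by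
  obtain ⟨c, c', -, -, -, -, hD⟩ := h.exists_transition ha
  have h₁ := hD 1
  intro h0
  refine h.det_proj_ne_zero ha ?_
  rw [h₁, one_mul]
  rw [ContinuousLinearMap.det] at h0 ⊢
  rw [ContinuousLinearMap.toLinearMap_comp, LinearMap.det_comp, h0, zero_mul]

theorem abs_det_div_eq {a b : Fin n → ℝ} (ha : a ∈ O) (hb : b ∈ O) {g : M} (hab : g * e a = e b) :
    |(orbitDeriv ρ p θ g a).det| / |(orbitDeriv ρ p θ (e b) 0).det| = haarWeight ρ p e θ a := by
  obtain ⟨c, c', -, -, -, -, hD⟩ := h.exists_transition ha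
  have hdet : ∀ g, (orbitDeriv ρ p θ g a).det = (orbitDeriv ρ p θ (g * e a) 0).det * c'.det := by
    intro g
    rw [hD g]
    exact LinearMap.det_comp _ _
  have h₁ := h.det_ne_zero ha
  have h₂ := h.det_ne_zero hb
  rw [haarWeight, hdet g, hdet 1, hab, one_mul, abs_mul, abs_mul,
    mul_div_cancel_left₀ _ (abs_ne_zero.2 h₁), mul_div_cancel_left₀ _ (abs_ne_zero.2 h₂)]

theorem haarWeight_pos {a : Fin n → ℝ} (ha : a ∈ O) : 0 < haarWeight ρ p e θ a :=
  div_pos (abs_pos.2 (h.det_proj_ne_zero ha)) (abs_pos.2 (h.det_ne_zero ha))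

omit [IsTopologicalGroup M] in
theorem continuous_det_zero : Continuous fun a => (orbitDeriv ρ p θ (e a) 0).det := by
  refine ContinuousLinearMap.continuous_det.comp ?_
  exact ((continuous_const.clm_comp h.continuous_action).clm_comp continuous_const)

omit [IsTopologicalGroup M] in
theorem continuous_det_proj : Continuous fun a => (orbitDeriv ρ p θ 1 a).det := by
  refine ContinuousLinearMap.continuous_det.comp ?_
  exact continuous_const.clm_comp (h.contDiff_orbit.continuous_fderiv (by simp))

theorem continuousOn_haarWeight : ContinuousOn (haarWeight ρ p e θ) O :=
  h.continuous_det_proj.abs.continuousOn.div h.continuous_det_zero.abs.continuousOn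
    fun _ ha => abs_ne_zero.2 (h.det_ne_zero ha)

end OrbitCoords

end Orbit

/-! ### Gluing a locally invariant measure -/

section Glue

variable {M : Type*} [Group M] [TopologicalSpace M] [IsTopologicalGroup M]
  [SecondCountableTopology M] [MeasurableSpace M] [BorelSpace M]

/-- A finite measure `ν₀` carried by a neighbourhood `U` of `1` that is invariant under those left
translations that stay in `U` is the restriction of a multiple of Haar measure. -/
theorem exists_smul_eq_of_locally_invariant [LocallyCompactSpace M] {U : Set M}
    (hU : MeasurableSet U) (hU1 : U ∈ 𝓝 1) {ν₀ : Measure M} [IsFiniteMeasure ν₀]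
    (hν₀ : ν₀ U ≠ 0)
    (hinv : ∀ (g : M) (E : Set M), MeasurableSet E → E ⊆ U → (∀ x ∈ E, g * x ∈ U) →
      ν₀ ((fun x => g⁻¹ * x) ⁻¹' E) = ν₀ E)
    (μ : Measure M) [μ.IsHaarMeasure] :
    ∃ c : ℝ, 0 < c ∧ ∀ E ⊆ U, MeasurableSet E → μ E = ENNReal.ofReal c * ν₀ E := by
  have hmul : ∀ g : M, Measurable fun x : M => g * x := fun g =>
    (continuous_const_mul g).measurable
  have hnhds : ∀ g : M, (fun x => g⁻¹ * x) ⁻¹' U ∈ 𝓝 g := fun g => by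
    refine (continuous_const_mul g⁻¹).continuousAt.preimage_mem_nhds ?_
    rwa [inv_mul_cancel]
  obtain ⟨t, htc, ht⟩ := TopologicalSpace.countable_cover_nhds hnhds
  have htne : t.Nonempty := by
    by_contra hne
    rw [not_nonempty_iff_eq_empty] at hne
    rw [hne] at ht
    simp only [mem_empty_iff_false, iUnion_of_empty, iUnion_empty] at ht
    exact absurd (mem_univ (1 : M)) (ht ▸ notMem_empty _)
  obtain ⟨k, hk⟩ := htc.exists_eq_range htne
  let D : ℕ → Set M := disjointed fun i => (fun x => (k i)⁻¹ * x) ⁻¹' U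
  have hDm : ∀ i, MeasurableSet (D i) :=
    MeasurableSet.disjointed fun i => hmul _ hU
  have hDd : Pairwise (Function.onFun Disjoint D) := disjoint_disjointed _
  have hDU : ⋃ i, D i = univ := by
    rw [iUnion_disjointed, ← ht, hk, biUnion_range]
  have hDsub : ∀ i, ∀ x ∈ D i, (k i)⁻¹ * x ∈ U := fun i x hx => disjointed_subset _ i hx
  let ν : Measure M := Measure.sum fun i => (ν₀.map fun x => k i * x).restrict (D i)
  have hνapply : ∀ E, MeasurableSet E → ν E = ∑' i, ν₀ ((fun x => k i * x) ⁻¹' (E ∩ D i)) := by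
    intro E hE
    rw [Measure.sum_apply _ hE]
    refine tsum_congr fun i => ?_
    rw [Measure.restrict_apply hE, Measure.map_apply (hmul _) (hE.inter (hDm i))]
  have hsplit : ∀ (τ : Measure M) (E : Set M), MeasurableSet E →
      ∀ (g : M), τ ((fun x => g * x) ⁻¹' E) = ∑' i, τ ((fun x => g * x) ⁻¹' (E ∩ D i)) := by
    intro τ E hE g
    rw [← measure_iUnion]
    · rw [← preimage_iUnion, ← inter_iUnion, hDU, inter_univ]
    · intro i j hij
      exact ((hDd hij).mono inter_subset_right inter_subset_right).preimage _
    · exact fun i => hmul _ (hE.inter (hDm i))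
  have hloc : ∀ (g : M) (E : Set M), MeasurableSet E → (∀ x ∈ E, g⁻¹ * x ∈ U) →
      ν E = ν₀ ((fun x => g * x) ⁻¹' E) := by
    intro g E hE hEU
    rw [hνapply E hE, hsplit ν₀ E hE g]
    refine tsum_congr fun i => ?_
    have h₁ := hinv ((k i)⁻¹ * g) ((fun x => g * x) ⁻¹' (E ∩ D i)) (hmul _ (hE.inter (hDm i)))
      (fun x hx => by simpa using hEU _ hx.1)
      (fun x hx => by simpa [mul_assoc] using hDsub i _ hx.2)
    rw [← h₁, ← preimage_comp]
    congr 1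
    ext x
    simp [mul_assoc]
  have hνinv : ν.IsMulLeftInvariant := by
    refine ⟨fun g => Measure.ext fun E hE => ?_⟩
    rw [Measure.map_apply (hmul g) hE, hsplit ν E hE g, hνapply E hE]
    refine tsum_congr fun i => ?_
    rw [hloc (g⁻¹ * k i) _ (hmul g (hE.inter (hDm i)))
      (fun x hx => by simpa [mul_assoc] using hDsub i _ hx.2), ← preimage_comp]
    congr 1
    ext x
    simp [mul_assoc]
  have hνfin : IsFiniteMeasureOnCompacts ν := by
    have : IsLocallyFiniteMeasure ν := by
      refine ⟨fun g => ⟨_, hnhds g, ?_⟩⟩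
      rw [hloc g _ (hmul _ hU) fun x hx => hx]
      exact measure_lt_top _ _
    infer_instance
  have hνμ := Measure.isMulLeftInvariant_eq_smul ν μ
  set c := Measure.haarScalarFactor ν μ with hc
  have hνU : ∀ E ⊆ U, MeasurableSet E → ν E = ν₀ E := fun E hEU hE => by
    rw [hloc 1 E hE fun x hx => by simpa using hEU hx]
    simp
  have hc0 : c ≠ 0 := fun h0 => by
    rw [h0, zero_smul] at hνμ
    exact hν₀ (by rw [← hνU U subset_rfl hU, hνμ]; simp)
  refine ⟨(c : ℝ)⁻¹, by positivity, fun E hEU hE => ?_⟩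
  rw [← hνU E hEU hE, hνμ, Measure.smul_apply, ENNReal.ofReal_inv_of_pos (by positivity),
    ENNReal.ofReal_coe_nnreal]
  rw [ENNReal.smul_def, smul_eq_mul, ← mul_assoc, ENNReal.inv_mul_cancel, one_mul]
  · exact_mod_cast hc0
  · exact ENNReal.coe_ne_top

end Glue

namespace OrbitCoords

variable {M : Type*} [Group M] [TopologicalSpace M] [IsTopologicalGroup M] {n : ℕ} {V : Type*}
  [NormedAddCommGroup V] [NormedSpace ℝ V] {ρ : M →* (V →L[ℝ] V)} {p : V →L[ℝ] (Fin n → ℝ)}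
  {e : (Fin n → ℝ) → M} {θ : (Fin n → ℝ) → V} {O S : Set (Fin n → ℝ)}

/-- Change of variables `ξ = p (ρ g (θ a))`. -/
theorem lintegral_haarWeight (h : OrbitCoords ρ p e θ O) {g : M} {E : Set (Fin n → ℝ)}
    (hE : MeasurableSet E) (hEO : E ⊆ O) {F : Set (Fin n → ℝ)} (hFO : F ⊆ O)
    (hEF : ∀ a ∈ E, ∃ b ∈ F, g * e a = e b) (hFE : ∀ b ∈ F, ∃ a ∈ E, g * e a = e b)
    {J : (Fin n → ℝ) → ℝ≥0∞}
    (hJ : ∀ a ∈ O, J (p (θ a)) = ENNReal.ofReal |(orbitDeriv ρ p θ (e a) 0).det|⁻¹) :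
    ∫⁻ a in E, ENNReal.ofReal (haarWeight ρ p e θ a) =
      ∫⁻ ξ in (fun a => p (θ a)) '' F, J ξ := by
  have himg : (fun a => p (θ a)) '' F = (fun a => p (ρ g (θ a))) '' E := by
    ext ξ
    constructor
    · rintro ⟨b, hb, rfl⟩
      obtain ⟨a, ha, hab⟩ := hFE b hb
      exact ⟨a, ha, by simp only [h.orbit_of_mul hab]⟩
    · rintro ⟨a, ha, rfl⟩
      obtain ⟨b, hb, hab⟩ := hEF a ha
      exact ⟨b, hb, by simp only [h.orbit_of_mul hab]⟩
  have hinj : InjOn (fun a => p (ρ g (θ a))) E := by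
    intro a ha a' ha' haa
    obtain ⟨b, hb, hab⟩ := hEF a ha
    obtain ⟨b', hb', hab'⟩ := hEF a' ha'
    simp only [h.orbit_of_mul hab, h.orbit_of_mul hab'] at haa
    have hbb := h.injOn_proj (hFO hb) (hFO hb') haa
    rw [← hbb, ← hab] at hab'
    exact (h.injOn_coord (hEO ha') (hEO ha) (mul_left_cancel hab')).symm
  rw [himg, lintegral_image_eq_lintegral_abs_det_fderiv_mul volume hE
    (fun a _ => (h.hasStrictFDerivAt_orbit g a).hasFDerivAt.hasFDerivWithinAt) hinj]
  refine setLIntegral_congr_fun hE fun a ha => ?_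
  obtain ⟨b, hb, hab⟩ := hEF a ha
  simp only [h.orbit_of_mul hab]
  rw [hJ b (hFO hb), ← ENNReal.ofReal_mul (abs_nonneg _), ← div_eq_mul_inv,
    h.abs_det_div_eq (hEO ha) (hFO hb) hab]

/-- The density of Haar measure in the coordinates `p (θ a)`, up to a constant. -/
def orbitDensity (ρ : M →* (V →L[ℝ] V)) (p : V →L[ℝ] (Fin n → ℝ)) (e : (Fin n → ℝ) → M)
    (θ : (Fin n → ℝ) → V) (O : Set (Fin n → ℝ)) (ξ : Fin n → ℝ) : ℝ :=
  |(orbitDeriv ρ p θ (e (Function.invFunOn (fun a => p (θ a)) O ξ)) 0).det|⁻¹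

omit [IsTopologicalGroup M] in
theorem orbitDensity_apply (h : OrbitCoords ρ p e θ O) {a : Fin n → ℝ} (ha : a ∈ O) :
    orbitDensity ρ p e θ O (p (θ a)) = |(orbitDeriv ρ p θ (e a) 0).det|⁻¹ := by
  have := h.injOn_proj.leftInvOn_invFunOn ha
  rw [orbitDensity, this]

omit [IsTopologicalGroup M] in
theorem continuousOn_invFunOn (h : OrbitCoords ρ p e θ O) :
    ContinuousOn (Function.invFunOn (fun a => p (θ a)) O) ((fun a => p (θ a)) '' O) := by
  obtain ⟨-, -, -, g, hg, hgl⟩ := h.diffeo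
  refine hg.continuousOn.congr ?_
  rintro _ ⟨a, ha, rfl⟩
  rw [hgl ha]
  exact h.injOn_proj.leftInvOn_invFunOn ha

theorem orbitDensity_pos (h : OrbitCoords ρ p e θ O) {a : Fin n → ℝ} (ha : a ∈ O) :
    0 < orbitDensity ρ p e θ O (p (θ a)) := by
  rw [h.orbitDensity_apply ha]
  exact inv_pos.2 (abs_pos.2 (h.det_ne_zero ha))

theorem continuousOn_orbitDensity (h : OrbitCoords ρ p e θ O) :
    ContinuousOn (orbitDensity ρ p e θ O) ((fun a => p (θ a)) '' O) := by
  refine ContinuousOn.inv₀ (h.continuous_det_zero.abs.comp_continuousOn h.continuousOn_invFunOn) ?_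
  rintro _ ⟨a, ha, rfl⟩
  have := h.injOn_proj.leftInvOn_invFunOn ha
  rw [this]
  exact abs_ne_zero.2 (h.det_ne_zero ha)

variable [SecondCountableTopology M] [LocallyCompactSpace M] [MeasurableSpace M] [BorelSpace M]

/-- In the coordinates `p (θ a)`, Haar measure has the density `orbitDensity`, up to a constant. -/
theorem exists_haar_eq (h : OrbitCoords ρ p e θ O) (hS : IsOpen S) (hS0 : 0 ∈ S)
    {K : Set (Fin n → ℝ)} (hK : IsCompact K) (hSK : S ⊆ K) (hKO : K ⊆ O)
    (μ : Measure M) [μ.IsHaarMeasure] :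
    ∃ c : ℝ, 0 < c ∧ ∀ E : Set M, MeasurableSet E → E ⊆ e '' S →
      μ E = ∫⁻ ξ in (fun a => p (θ a)) '' (S ∩ e ⁻¹' E),
        ENNReal.ofReal (c * orbitDensity ρ p e θ O ξ) := by
  have hSO : S ⊆ O := hSK.trans hKO
  have hem : Measurable e := h.continuous_coord.measurable
  have hU : IsOpen (e '' S) := h.isOpen_image_coord hS hSO
  let m₀ : Measure (Fin n → ℝ) :=
    (volume.restrict S).withDensity fun a => ENNReal.ofReal (haarWeight ρ p e θ a)
  let ν₀ : Measure M := m₀.map e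
  have hν₀ : ∀ E, MeasurableSet E →
      ν₀ E = ∫⁻ a in S ∩ e ⁻¹' E, ENNReal.ofReal (haarWeight ρ p e θ a) := by
    intro E hE
    rw [Measure.map_apply hem hE, withDensity_apply _ (hem hE),
      Measure.restrict_restrict (hem hE), inter_comm]
  have hJ : ∀ a ∈ O, ENNReal.ofReal (orbitDensity ρ p e θ O (p (θ a))) =
      ENNReal.ofReal |(orbitDeriv ρ p θ (e a) 0).det|⁻¹ := fun a ha => by
    rw [h.orbitDensity_apply ha]
  have hν₀' : ∀ E, MeasurableSet E → ν₀ E = ∫⁻ ξ in (fun a => p (θ a)) '' (S ∩ e ⁻¹' E),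
      ENNReal.ofReal (orbitDensity ρ p e θ O ξ) := by
    intro E hE
    rw [hν₀ E hE]
    exact h.lintegral_haarWeight (g := 1) (hS.measurableSet.inter (hem hE))
      (inter_subset_left.trans hSO) (inter_subset_left.trans hSO)
      (fun a ha => ⟨a, ha, one_mul _⟩) (fun a ha => ⟨a, ha, one_mul _⟩) hJ
  have hfin : IsFiniteMeasure ν₀ := by
    refine ⟨?_⟩
    rw [hν₀ _ MeasurableSet.univ, preimage_univ, inter_univ]
    refine (lintegral_mono_set hSK).trans_lt ?_
    exact Integrable.lintegral_lt_top
      ((h.continuousOn_haarWeight.mono hKO).integrableOn_compact hK)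
  have hpos : ν₀ (e '' S) ≠ 0 := by
    rw [hν₀ _ hU.measurableSet, inter_eq_left.2 (subset_preimage_image e S)]
    intro h0
    have hae : AEMeasurable (fun a => ENNReal.ofReal (haarWeight ρ p e θ a)) (volume.restrict S) :=
      ((h.continuousOn_haarWeight.mono hSO).aemeasurable hS.measurableSet).ennreal_ofReal
    rw [lintegral_eq_zero_iff' hae] at h0
    have h₁ := (ae_restrict_iff' hS.measurableSet).1 h0
    have h₂ : volume S = 0 := by
      refine measure_mono_null (fun a ha => ?_) h₁
      simp only [mem_compl_iff, mem_ofPred_eq, Pi.zero_apply, ENNReal.ofReal_eq_zero, not_forall,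
        not_le]
      exact ⟨ha, h.haarWeight_pos (hSO ha)⟩
    exact hS.measure_ne_zero volume ⟨0, hS0⟩ h₂
  obtain ⟨c, hc, hcE⟩ := exists_smul_eq_of_locally_invariant hU.measurableSet
    (hU.mem_nhds ⟨0, hS0, h.coord_zero⟩) hpos (fun g E hE hEU hgE => by
      have hgm : MeasurableSet ((fun x => g⁻¹ * x) ⁻¹' E) :=
        (continuous_const_mul g⁻¹).measurable hE
      rw [hν₀' _ hgm, hν₀ E hE]
      refine (h.lintegral_haarWeight (g := g) (hS.measurableSet.inter (hem hE))
        (inter_subset_left.trans hSO) (inter_subset_left.trans hSO) ?_ ?_ hJ).symm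
      · rintro a ⟨ha, haE⟩
        obtain ⟨b, hb, hab⟩ := hgE _ haE
        refine ⟨b, ⟨hb, ?_⟩, hab.symm⟩
        simpa [hab] using haE
      · rintro b ⟨hb, hbE⟩
        obtain ⟨a, ha, hab⟩ := hEU hbE
        refine ⟨a, ⟨ha, ?_⟩, by simp [hab]⟩
        rw [mem_preimage, hab]
        exact hbE) μ
  refine ⟨c, hc, fun E hE hEU => ?_⟩
  rw [hcE E hEU hE, hν₀' E hE]
  simp_rw [ENNReal.ofReal_mul hc.le]
  rw [lintegral_const_mul' _ _ ENNReal.ofReal_ne_top]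

end OrbitCoords

/-! ### The coadjoint orbit of `λ` -/

section Coadjoint

theorem contDiff_list_prod {E 𝔸 : Type*} [NormedAddCommGroup E] [NormedSpace ℝ E] [NormedRing 𝔸]
    [NormedAlgebra ℝ 𝔸] (l : List (E → 𝔸)) (h : ∀ f ∈ l, ContDiff ℝ ∞ f) :
    ContDiff ℝ ∞ fun x => (l.map fun f => f x).prod := by
  induction l with
  | nil => simpa using contDiff_const
  | cons f l ih =>
    simp only [List.map_cons, List.prod_cons]
    exact (h f (by simp)).mul (ih fun g hg => h g (by simp [hg]))

theorem contDiff_list_prod_exp {n m : ℕ} (N : Fin m → Matrix (Fin n) (Fin n) ℝ) (i j : Fin n) :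
    ContDiff ℝ ∞ fun a : Fin m → ℝ =>
      (List.ofFn fun k => NormedSpace.exp (a k • N k)).reverse.prod i j := by
  let _ : NormedRing (Matrix (Fin n) (Fin n) ℝ) := Matrix.linftyOpNormedRing
  let _ : NormedAlgebra ℝ (Matrix (Fin n) (Fin n) ℝ) := Matrix.linftyOpNormedAlgebra
  have h₁ : ∀ k, ContDiff ℝ ∞ fun a : Fin m → ℝ => NormedSpace.exp (a k • N k) := fun k => by
    have h₂ : ContDiff ℝ ∞ (NormedSpace.exp : Matrix (Fin n) (Fin n) ℝ → _) :=
      contDiff_iff_contDiffAt.2 fun x => (NormedSpace.exp_analytic (𝕂 := ℝ) x).contDiffAt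
    exact h₂.comp ((contDiff_apply ℝ ℝ k).smul contDiff_const)
  have h₃ := contDiff_list_prod
    (List.ofFn fun k => fun a : Fin m → ℝ => NormedSpace.exp (a k • N k)).reverse (by
      intro f hf
      rw [List.mem_reverse, List.mem_ofFn'] at hf
      obtain ⟨k, rfl⟩ := hf
      exact h₁ k)
  let T : Matrix (Fin n) (Fin n) ℝ →L[ℝ] ℝ :=
    LinearMap.toContinuousLinearMap (Matrix.entryLinearMap ℝ ℝ i j)
  have h₄ := T.contDiff.comp h₃
  convert! h₄ using 2 with a
  simp only [Function.comp_apply, List.map_reverse, List.map_ofFn]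
  rfl

variable {d : ℕ} {G : Type*} [TopologicalSpace G] [ChartedSpace (EuclideanSpace ℝ (Fin d)) G]
  [Group G] [LieGroup (𝓡 d) ∞ G] {M : Subgroup G}
  {𝔪 : LieSubalgebra ℝ (GroupLieAlgebra (𝓡 d) G)} {𝔭 : LieIdeal ℝ (GroupLieAlgebra (𝓡 d) G)}
  {n₁ n₂ : ℕ}

/-- The operator `Ad m⁻¹` of the ideal `𝔭`. -/
def adIdeal (h𝔭 : ∀ (m : M) (Y : 𝔭), lieAd (m : G)⁻¹ (Y : GroupLieAlgebra (𝓡 d) G) ∈ 𝔭) (m : M) :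
    𝔭 →ₗ[ℝ] 𝔭 where
  toFun Y := ⟨lieAd (m : G)⁻¹ (Y : GroupLieAlgebra (𝓡 d) G), h𝔭 m Y⟩
  map_add' Y Z := Subtype.ext (map_add (lieAd (m : G)⁻¹) (Y : GroupLieAlgebra (𝓡 d) G) Z)
  map_smul' c Y := Subtype.ext (map_smul (lieAd (m : G)⁻¹) c (Y : GroupLieAlgebra (𝓡 d) G))

theorem adIdeal_mul
    (h𝔭 : ∀ (m : M) (Y : 𝔭), lieAd (m : G)⁻¹ (Y : GroupLieAlgebra (𝓡 d) G) ∈ 𝔭) (m m' : M) :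
    adIdeal h𝔭 (m * m') = adIdeal h𝔭 m' ∘ₗ adIdeal h𝔭 m := by
  ext Y
  have h := lieAd_mul (m' : G)⁻¹ (m : G)⁻¹ (Y : GroupLieAlgebra (𝓡 d) G)
  rw [← mul_inv_rev] at h
  exact h

theorem adIdeal_one
    (h𝔭 : ∀ (m : M) (Y : 𝔭), lieAd (m : G)⁻¹ (Y : GroupLieAlgebra (𝓡 d) G) ∈ 𝔭) :
    adIdeal h𝔭 1 = LinearMap.id := by
  ext Y
  have h := lieAd_one (G := G) (Y : GroupLieAlgebra (𝓡 d) G)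
  rw [← inv_one] at h
  exact h

/-- The operator `ℓ ↦ ℓ ᵥ* N`, as a linear function of the matrix `N`. -/
def vecMulCLM (n : ℕ) : Matrix (Fin n) (Fin n) ℝ →ₗ[ℝ] (Fin n → ℝ) →L[ℝ] (Fin n → ℝ) where
  toFun N := LinearMap.toContinuousLinearMap N.vecMulLinear
  map_add' N N' := by
    ext
    simp
  map_smul' c N := by
    ext
    simp

/-- The coadjoint action of `M` on `𝔭^*`, in the basis `X^*`. -/
def coadjoint (X : Module.Basis (Fin n₁) ℝ 𝔭)
    (h𝔭 : ∀ (m : M) (Y : 𝔭), lieAd (m : G)⁻¹ (Y : GroupLieAlgebra (𝓡 d) G) ∈ 𝔭) :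
    M →* ((Fin n₁ → ℝ) →L[ℝ] (Fin n₁ → ℝ)) where
  toFun m := vecMulCLM n₁ (LinearMap.toMatrix X X (adIdeal h𝔭 m))
  map_one' := by
    rw [adIdeal_one, LinearMap.toMatrix_id]
    ext
    simp [vecMulCLM]
  map_mul' m m' := by
    rw [adIdeal_mul, LinearMap.toMatrix_comp X X X]
    ext ℓ : 1
    simp [vecMulCLM, Matrix.vecMul_vecMul]

/-- The coordinates of `θ_λ(a)` in the basis `X^*`. -/
def thetaVec (A : Module.Basis (Fin n₂) ℝ 𝔪) (X : Module.Basis (Fin n₁) ℝ 𝔭)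
    (lam : Module.Dual ℝ 𝔭) (a : Fin n₂ → ℝ) (i : Fin n₁) : ℝ :=
  theta A X lam a (X i)

/-- The projection onto the coordinates in `J`. -/
def projCoords (J : Fin n₂ ↪o Fin n₁) : (Fin n₁ → ℝ) →L[ℝ] (Fin n₂ → ℝ) :=
  ContinuousLinearMap.pi fun i => ContinuousLinearMap.proj (J i)

/-- The matrix of `C(a)`. -/
def matC (A : Module.Basis (Fin n₂) ℝ 𝔪) (X : Module.Basis (Fin n₁) ℝ 𝔭) (a : Fin n₂ → ℝ) :
    Matrix (Fin n₁) (Fin n₁) ℝ :=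
  LinearMap.toMatrix X X (opC A X a)

theorem contDiff_matC (A : Module.Basis (Fin n₂) ℝ 𝔪) (X : Module.Basis (Fin n₁) ℝ 𝔭)
    (i j : Fin n₁) : ContDiff ℝ ∞ fun a => matC A X a i j := by
  have h := contDiff_list_prod_exp (fun k => -(LinearMap.toMatrix X X
        (LieModule.toEnd ℝ (GroupLieAlgebra (𝓡 d) G) 𝔭 (A k : GroupLieAlgebra (𝓡 d) G)))) i j
  convert! h using 2 with a
  rw [matC, opC, LinearMap.toMatrix_toLin]
  simp only [map_smul, smul_neg]

theorem thetaVec_eq (A : Module.Basis (Fin n₂) ℝ 𝔪) (X : Module.Basis (Fin n₁) ℝ 𝔭)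
    (lam : Module.Dual ℝ 𝔭) (a : Fin n₂ → ℝ) :
    thetaVec A X lam a = (fun j => lam (X j)) ᵥ* matC A X a := by
  ext i
  have h := X.sum_repr (opC A X a (X i))
  rw [thetaVec, theta, LinearMap.comp_apply, ← h, map_sum]
  simp only [map_smul, smul_eq_mul, Matrix.vecMul, dotProduct, matC, LinearMap.toMatrix_apply]
  exact Finset.sum_congr rfl fun j _ => mul_comm _ _

end Coadjoint

/-! ### Orbit coordinates of `M` -/

section Coords

theorem sigmaCompactSpace_of_connected (G : Type*) [TopologicalSpace G] [Group G]
    [IsTopologicalGroup G] [WeaklyLocallyCompactSpace G] [PreconnectedSpace G] :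
    SigmaCompactSpace G := by
  obtain ⟨K, hK, hK1⟩ := exists_compact_mem_nhds (1 : G)
  let S := K ∪ K⁻¹
  have hS : IsCompact S := hK.union hK.inv
  have hS1 : S ∈ 𝓝 1 := mem_of_superset hK1 subset_union_left
  have hSi : ∀ x ∈ S, x⁻¹ ∈ S := by
    rintro x (hx | hx)
    · exact Or.inr (by simpa using hx)
    · exact Or.inl hx
  have hSn : ∀ x : G, {y | x⁻¹ * y ∈ S} ∈ 𝓝 x := fun x => by
    have h : Tendsto (fun y => x⁻¹ * y) (𝓝 x) (𝓝 1) := by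
      have : Continuous fun y => x⁻¹ * y := by fun_prop
      simpa using this.tendsto x
    exact h hS1
  have hpow : ∀ n : ℕ, IsCompact (S ^ n) := fun n => by
    induction n with
    | zero => simp
    | succ n ih => rw [pow_succ]; exact ih.mul hS
  have hmul : ∀ {n : ℕ} {x y : G}, x ∈ S ^ n → x⁻¹ * y ∈ S → y ∈ S ^ (n + 1) := by
    intro n x y hx hy
    rw [pow_succ]
    exact ⟨x, hx, x⁻¹ * y, hy, by simp⟩
  have hclopen : IsClopen (⋃ n : ℕ, S ^ n) := by
    refine ⟨⟨isOpen_iff_mem_nhds.2 fun x hx => ?_⟩, isOpen_iff_mem_nhds.2 fun x hx => ?_⟩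
    · filter_upwards [hSn x] with y hy hyU
      obtain ⟨n, hn⟩ := mem_iUnion.1 hyU
      refine hx (mem_iUnion.2 ⟨n + 1, hmul hn ?_⟩)
      simpa using hSi _ hy
    · obtain ⟨n, hn⟩ := mem_iUnion.1 hx
      filter_upwards [hSn x] with y hy using mem_iUnion.2 ⟨n + 1, hmul hn hy⟩
  exact ⟨⟨fun n => S ^ n, hpow, hclopen.eq_univ ⟨1, mem_iUnion.2 ⟨0, by simp⟩⟩⟩⟩

variable {d : ℕ} {G : Type*} [TopologicalSpace G] [ChartedSpace (EuclideanSpace ℝ (Fin d)) G]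
  [Group G] [LieGroup (𝓡 d) ∞ G] [T2Space G] {P M : Subgroup G}
  {𝔪 : LieSubalgebra ℝ (GroupLieAlgebra (𝓡 d) G)} {𝔭 : LieIdeal ℝ (GroupLieAlgebra (𝓡 d) G)}
  {n₁ n₂ : ℕ}

theorem lieAd_inv_mem (hM : (M : Set G) = lieExp '' (𝔪 : Set (GroupLieAlgebra (𝓡 d) G)))
    (X : Module.Basis (Fin n₁) ℝ 𝔭) (m : M) (Y : 𝔭) :
    lieAd (m : G)⁻¹ (Y : GroupLieAlgebra (𝓡 d) G) ∈ 𝔭 := by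
  obtain ⟨Z, -, hZ⟩ : (m : G) ∈ lieExp '' (𝔪 : Set (GroupLieAlgebra (𝓡 d) G)) := hM ▸ m.2
  rw [← hZ, ← lieExp_neg, lieAd_lieExp_neg_coe X]
  exact Subtype.prop _

omit [T2Space G] in
theorem secondKind_mem (hM : (M : Set G) = lieExp '' (𝔪 : Set (GroupLieAlgebra (𝓡 d) G)))
    (A : Module.Basis (Fin n₂) ℝ 𝔪) (a : Fin n₂ → ℝ) : (secondKind A a : G) ∈ M := by
  refine expProd_mem (v := fun k => (A k : GroupLieAlgebra (𝓡 d) G)) (fun k t => ?_) a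
  rw [← SetLike.mem_coe, hM]
  exact ⟨_, (t • A k).2, rfl⟩

/-- Canonical coordinates of the second kind, as elements of `M`. -/
def coordM (hM : (M : Set G) = lieExp '' (𝔪 : Set (GroupLieAlgebra (𝓡 d) G)))
    (A : Module.Basis (Fin n₂) ℝ 𝔪) (a : Fin n₂ → ℝ) : M :=
  ⟨secondKind A a, secondKind_mem hM A a⟩

theorem adIdeal_coordM (hM : (M : Set G) = lieExp '' (𝔪 : Set (GroupLieAlgebra (𝓡 d) G)))
    (X : Module.Basis (Fin n₁) ℝ 𝔭) (A : Module.Basis (Fin n₂) ℝ 𝔪) (a : Fin n₂ → ℝ) :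
    adIdeal (lieAd_inv_mem hM X) (coordM hM A a) = opC A X a := by
  ext Y
  exact lieAd_secondKind_inv X A a Y

theorem coadjoint_coordM (hM : (M : Set G) = lieExp '' (𝔪 : Set (GroupLieAlgebra (𝓡 d) G)))
    (X : Module.Basis (Fin n₁) ℝ 𝔭) (A : Module.Basis (Fin n₂) ℝ 𝔪) (a : Fin n₂ → ℝ) :
    coadjoint X (lieAd_inv_mem hM X) (coordM hM A a) = vecMulCLM n₁ (matC A X a) := by
  rw [matC, ← adIdeal_coordM hM]
  rfl

theorem span_range_coe_basis {V : Type*} [AddCommGroup V] [Module ℝ V] {W : Submodule ℝ V} {n : ℕ}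
    (b : Module.Basis (Fin n) ℝ W) : Submodule.span ℝ (range fun k => (b k : V)) = W := by
  have h := congrArg (Submodule.map W.subtype) b.span_eq
  rw [Submodule.map_span, Submodule.map_top, Submodule.range_subtype, ← range_comp] at h
  exact h

variable [IsTopologicalGroup G]

theorem nhds_one_le_map_coordM (hPM : P.IsComplement' M)
    (h𝔭𝔪 : IsCompl 𝔭.toSubmodule 𝔪.toSubmodule)
    (hP : (P : Set G) = lieExp '' (𝔭 : Set (GroupLieAlgebra (𝓡 d) G)))
    (hM : (M : Set G) = lieExp '' (𝔪 : Set (GroupLieAlgebra (𝓡 d) G)))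
    (X : Module.Basis (Fin n₁) ℝ 𝔭) (A : Module.Basis (Fin n₂) ℝ 𝔪) :
    𝓝 1 ≤ map (coordM hM A) (𝓝 0) := by
  have hspan : Submodule.span ℝ (range fun k => (X k : GroupLieAlgebra (𝓡 d) G)) ⊔
      Submodule.span ℝ (range fun k => (A k : GroupLieAlgebra (𝓡 d) G)) = ⊤ := by
    have h₁ := span_range_coe_basis (W := 𝔭.toSubmodule) X
    have h₂ := span_range_coe_basis (W := 𝔪.toSubmodule) A
    exact (congrArg₂ (· ⊔ ·) h₁ h₂).trans h𝔭𝔪.sup_eq_top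
  have hmap := map_expProd_mul_nhds (G := G) hspan
  intro V hV
  have hV' : Prod.snd ⁻¹' (coordM hM A ⁻¹' V) ∈ 𝓝 (0 : (Fin n₁ → ℝ) × (Fin n₂ → ℝ)) :=
    continuous_snd.continuousAt.preimage_mem_nhds hV
  have h₁ := image_mem_map (m := fun p : (Fin n₁ → ℝ) × (Fin n₂ → ℝ) =>
    (expProd (fun k => (X k : GroupLieAlgebra (𝓡 d) G)) p.1 *
      expProd (fun k => (A k : GroupLieAlgebra (𝓡 d) G)) p.2 : G)) hV'
  rw [hmap] at h₁
  have h₂ : Subtype.val ⁻¹' _ ∈ 𝓝 (1 : M) :=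
    continuous_subtype_val.continuousAt.preimage_mem_nhds h₁
  refine mem_of_superset h₂ ?_
  rintro m ⟨⟨x, a⟩, ha, hxa⟩
  have hx : (expProd (fun k => (X k : GroupLieAlgebra (𝓡 d) G)) x : G) ∈ P := by
    refine expProd_mem (fun k t => ?_) x
    rw [← SetLike.mem_coe, hP]
    exact ⟨_, (t • X k).2, rfl⟩
  have hx' : (expProd (fun k => (X k : GroupLieAlgebra (𝓡 d) G)) x : G) ∈ M := by
    have : (expProd (fun k => (X k : GroupLieAlgebra (𝓡 d) G)) x : G) =
        m * (coordM hM A a : G)⁻¹ := eq_mul_inv_of_mul_eq hxa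
    rw [this]
    exact M.mul_mem m.2 (M.inv_mem (coordM hM A a).2)
  have h1 : (expProd (fun k => (X k : GroupLieAlgebra (𝓡 d) G)) x : G) = 1 :=
    (Subgroup.disjoint_def.1 hPM.disjoint) hx hx'
  have : m = coordM hM A a := by
    apply Subtype.ext
    rw [← hxa]
    dsimp only
    rw [h1, one_mul]
    rfl
  rw [this]
  exact ha

theorem orbitCoords_coordM (hPM : P.IsComplement' M)
    (h𝔭𝔪 : IsCompl 𝔭.toSubmodule 𝔪.toSubmodule)
    (hP : (P : Set G) = lieExp '' (𝔭 : Set (GroupLieAlgebra (𝓡 d) G)))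
    (hM : (M : Set G) = lieExp '' (𝔪 : Set (GroupLieAlgebra (𝓡 d) G)))
    (lam : Module.Dual ℝ 𝔭)
    (X : Module.Basis (Fin n₁) ℝ 𝔭) (A : Module.Basis (Fin n₂) ℝ 𝔪) (J : Fin n₂ ↪o Fin n₁)
    {O : Set (Fin n₂ → ℝ)} (hO0 : 0 ∈ O) (hO : IsDiffeoOn (beta A X lam J) O) :
    OrbitCoords (coadjoint X (lieAd_inv_mem hM X)) (projCoords J) (coordM hM A)
      (thetaVec A X lam) O where
  continuous_coord := Continuous.subtype_mk (continuous_expProd _) _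
  coord_zero := Subtype.ext (expProd_zero _)
  nhds_le := nhds_one_le_map_coordM hPM h𝔭𝔪 hP hM X A
  contDiff_orbit := by
    refine contDiff_pi.2 fun i => ?_
    simp only [thetaVec_eq, Matrix.vecMul, dotProduct]
    exact ContDiff.sum fun j _ => contDiff_const.mul (contDiff_matC A X j i)
  orbit_eq a := by
    have h0 : coordM hM A 0 = 1 := Subtype.ext (expProd_zero _)
    have h1 : matC A X 0 = 1 := by
      rw [matC, ← adIdeal_coordM hM, h0, adIdeal_one, LinearMap.toMatrix_id]
    rw [coadjoint_coordM, thetaVec_eq, thetaVec_eq, h1, Matrix.vecMul_one]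
    rfl
  continuous_action := by
    simp only [coadjoint_coordM]
    refine (LinearMap.continuous_of_finiteDimensional (vecMulCLM n₁)).comp ?_
    exact continuous_pi fun i => continuous_pi fun j => (contDiff_matC A X i j).continuous
  zero_mem := hO0
  diffeo := hO

end Coords

/-! ### The density of Haar measure -/

section Density

variable {d : ℕ} {G : Type*} [TopologicalSpace G] [ChartedSpace (EuclideanSpace ℝ (Fin d)) G]
  [Group G] [LieGroup (𝓡 d) ∞ G] [T2Space G] {M : Subgroup G}
  {𝔪 : LieSubalgebra ℝ (GroupLieAlgebra (𝓡 d) G)} {𝔭 : LieIdeal ℝ (GroupLieAlgebra (𝓡 d) G)}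
  {n₁ n₂ : ℕ} {hM : (M : Set G) = lieExp '' (𝔪 : Set (GroupLieAlgebra (𝓡 d) G))}
  {lam : Module.Dual ℝ 𝔭} {X : Module.Basis (Fin n₁) ℝ 𝔭} {A : Module.Basis (Fin n₂) ℝ 𝔪}
  {J : Fin n₂ ↪o Fin n₁} {O : Set (Fin n₂ → ℝ)} {ε : ℝ}

theorem isOpen_openCube (n : ℕ) (ε : ℝ) : IsOpen (openCube n ε) :=
  isOpen_set_pi finite_univ fun _ _ => isOpen_Ioo

theorem zero_mem_openCube (n : ℕ) {ε : ℝ} (hε : 0 < ε) : 0 ∈ openCube n ε :=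
  fun _ _ => ⟨by simpa using hε, by simpa using hε⟩

theorem openCube_subset_closedCube (n : ℕ) (ε : ℝ) : openCube n ε ⊆ closedCube n ε :=
  pi_mono fun _ _ => Ioo_subset_Icc_self

theorem isCompact_closedCube (n : ℕ) (ε : ℝ) : IsCompact (closedCube n ε) :=
  isCompact_univ_pi fun _ => isCompact_Icc

omit [T2Space G] in
theorem omegaOpen_eq_image (hM : (M : Set G) = lieExp '' (𝔪 : Set (GroupLieAlgebra (𝓡 d) G)))
    (A : Module.Basis (Fin n₂) ℝ 𝔪) (ε : ℝ) :
    omegaOpen M A ε = coordM hM A '' openCube n₂ ε := by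
  ext m
  constructor
  · rintro ⟨a, ha, h⟩
    exact ⟨a, ha, Subtype.ext h⟩
  · rintro ⟨a, ha, rfl⟩
    exact ⟨a, ha, rfl⟩

theorem phi_coordM (h : OrbitCoords (coadjoint X (lieAd_inv_mem hM X)) (projCoords J)
      (coordM hM A) (thetaVec A X lam) O) (hεO : closedCube n₂ ε ⊆ O)
    {a : Fin n₂ → ℝ} (ha : a ∈ openCube n₂ ε) :
    phi A X lam J ε (coordM hM A a) = beta A X lam J a := by
  have hinj : InjOn (secondKind (G := G) A) (openCube n₂ ε) := fun x hx y hy hxy =>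
    h.injOn_coord (hεO (openCube_subset_closedCube _ _ hx))
      (hεO (openCube_subset_closedCube _ _ hy)) (Subtype.ext hxy)
  have h₁ : Function.invFunOn (secondKind (G := G) A) (openCube n₂ ε) (secondKind A a) = a :=
    hinj.leftInvOn_invFunOn ha
  exact congrArg (beta A X lam J) h₁

theorem phi_image_omegaOpen (h : OrbitCoords (coadjoint X (lieAd_inv_mem hM X)) (projCoords J)
      (coordM hM A) (thetaVec A X lam) O) (hεO : closedCube n₂ ε ⊆ O) :
    phi A X lam J ε '' omegaOpen M A ε = beta A X lam J '' openCube n₂ ε := by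
  rw [omegaOpen_eq_image hM, image_image]
  exact image_congr fun a ha => phi_coordM h hεO ha

variable [IsTopologicalGroup G]

theorem isOpen_omegaOpen (h : OrbitCoords (coadjoint X (lieAd_inv_mem hM X)) (projCoords J)
      (coordM hM A) (thetaVec A X lam) O) (hεO : closedCube n₂ ε ⊆ O) :
    IsOpen (omegaOpen M A ε) := by
  rw [omegaOpen_eq_image hM]
  exact h.isOpen_image_coord (isOpen_openCube _ _) ((openCube_subset_closedCube _ _).trans hεO)

theorem continuousOn_phi (h : OrbitCoords (coadjoint X (lieAd_inv_mem hM X)) (projCoords J)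
      (coordM hM A) (thetaVec A X lam) O) (hεO : closedCube n₂ ε ⊆ O) :
    ContinuousOn (phi A X lam J ε) (omegaOpen M A ε) := by
  rw [omegaOpen_eq_image hM]
  rintro _ ⟨a, ha, rfl⟩
  have haO := hεO (openCube_subset_closedCube _ _ ha)
  refine ContinuousAt.continuousWithinAt ?_
  rw [ContinuousAt, ← h.map_coord_nhds haO, tendsto_map'_iff, phi_coordM h hεO ha]
  have hc : ContinuousAt (beta A X lam J) a :=
    ((projCoords J).continuous.comp h.contDiff_orbit.continuous).continuousAt
  refine Tendsto.congr' ?_ hc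
  filter_upwards [(isOpen_openCube n₂ ε).mem_nhds ha] with b hb using (phi_coordM h hεO hb).symm

variable [MeasurableSpace G] [BorelSpace G] [SecondCountableTopology G] [LocallyCompactSpace M]

theorem exists_isHaarDensity (h : OrbitCoords (coadjoint X (lieAd_inv_mem hM X)) (projCoords J)
      (coordM hM A) (thetaVec A X lam) O) (hε : 0 < ε) (hεO : closedCube n₂ ε ⊆ O)
    (μ : Measure M) [μ.IsHaarMeasure] : ∃ Ψ, IsHaarDensity A X lam J ε μ Ψ := by
  have : SecondCountableTopology M := TopologicalSpace.Subtype.secondCountableTopology _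
  have hSO : openCube n₂ ε ⊆ O := (openCube_subset_closedCube _ _).trans hεO
  obtain ⟨c, hc, hμ⟩ := h.exists_haar_eq (isOpen_openCube n₂ ε) (zero_mem_openCube n₂ hε)
    (isCompact_closedCube n₂ ε) (openCube_subset_closedCube _ _) hεO μ
  have hΩ : MeasurableSet (omegaOpen M A ε) := (isOpen_omegaOpen h hεO).measurableSet
  refine ⟨fun ξ => c * OrbitCoords.orbitDensity (coadjoint X (lieAd_inv_mem hM X)) (projCoords J)
      (coordM hM A) (thetaVec A X lam) O ξ,
    (continuousOn_const.mul h.continuousOn_orbitDensity).mono (image_mono hSO), ?_, ?_⟩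
  · rintro _ ⟨a, ha, rfl⟩
    exact mul_pos hc (h.orbitDensity_pos (hSO ha))
  · ext B hB
    rw [Measure.map_apply_of_aemeasurable ((continuousOn_phi h hεO).aemeasurable hΩ) hB,
      withDensity_apply _ hB, Measure.restrict_restrict hB, Measure.restrict_apply' hΩ]
    have hE : MeasurableSet (phi A X lam J ε ⁻¹' B ∩ omegaOpen M A ε) := by
      have h₁ := MeasurableSet.subtype_image hΩ
        ((continuousOn_phi h hεO).domRestrict.measurable hB)
      convert! h₁ using 1
      ext m
      simp [and_comm]
    rw [hμ _ hE (by rw [← omegaOpen_eq_image hM]; exact inter_subset_right)]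
    congr 2
    ext ξ
    constructor
    · rintro ⟨a, ⟨ha, haB, -⟩, rfl⟩
      rw [mem_preimage, phi_coordM h hεO ha] at haB
      exact ⟨haB, a, ha, rfl⟩
    · rintro ⟨hξ, a, ha, rfl⟩
      refine ⟨a, ⟨ha, ?_, ?_⟩, rfl⟩
      · rw [mem_preimage, phi_coordM h hεO ha]
        exact hξ
      · rw [omegaOpen_eq_image hM]
        exact mem_image_of_mem _ ha

theorem isHaarDensity_psi (h : OrbitCoords (coadjoint X (lieAd_inv_mem hM X)) (projCoords J)
      (coordM hM A) (thetaVec A X lam) O) (hε : 0 < ε) (hεO : closedCube n₂ ε ⊆ O)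
    (μ : Measure M) [μ.IsHaarMeasure] : IsHaarDensity A X lam J ε μ (psi A X lam J ε μ) :=
  Classical.epsilon_spec (exists_isHaarDensity h hε hεO μ)

end Density

/-! ### Parseval's identity on a fundamental domain of a lattice -/

section Parseval

/-- The Haar probability measure of the torus. -/
abbrev torusMeasure (n : ℕ) : Measure (UnitAddTorus (Fin n)) :=
  Measure.pi fun _ => AddCircle.haarAddCircle

theorem enorm_sq_eq_ofReal (z : ℂ) : ‖z‖ₑ ^ 2 = ENNReal.ofReal (‖z‖ ^ 2) := by
  rw [ENNReal.ofReal_pow (norm_nonneg _), ofReal_norm]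

theorem tsum_enorm_sq_mFourier {n : ℕ} {f : UnitAddTorus (Fin n) → ℂ}
    (hf : MemLp f 2 (torusMeasure n)) :
    ∑' z : Fin n → ℤ, ‖∫ t, UnitAddTorus.mFourier z t * f t ∂torusMeasure n‖ₑ ^ 2 =
      ∫⁻ t, ‖f t‖ₑ ^ 2 ∂torusMeasure n := by
  have h : HasSum (fun z : Fin n → ℤ =>
      ‖∫ t, UnitAddTorus.mFourier (-z) t • hf.toLp f t ∂torusMeasure n‖ ^ 2)
      (∫ t, ‖hf.toLp f t‖ ^ 2 ∂torusMeasure n) := UnitAddTorus.hasSum_sq_mFourierCoeff (hf.toLp f)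
  have h₁ : ∀ z : Fin n → ℤ, ∫ t, UnitAddTorus.mFourier (-z) t • hf.toLp f t ∂torusMeasure n =
      ∫ t, UnitAddTorus.mFourier (-z) t * f t ∂torusMeasure n := fun z =>
    integral_congr_ae (hf.coeFn_toLp.mono fun t ht => by simp only [ht, smul_eq_mul])
  have h₂ : ∫ t, ‖hf.toLp f t‖ ^ 2 ∂torusMeasure n = ∫ t, ‖f t‖ ^ 2 ∂torusMeasure n :=
    integral_congr_ae (hf.coeFn_toLp.mono fun t ht => by simp only [ht])
  simp only [h₁] at h
  rw [h₂] at h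
  rw [← (Equiv.neg (Fin n → ℤ)).tsum_eq]
  simp only [enorm_sq_eq_ofReal, Equiv.neg_apply]
  rw [← ENNReal.ofReal_tsum_of_nonneg (fun _ => by positivity) h.summable, h.tsum_eq,
    ofReal_integral_eq_lintegral_ofReal
      ((memLp_two_iff_integrable_sq_norm hf.aestronglyMeasurable).1 hf)
      (Eventually.of_forall fun _ => by positivity)]

theorem exists_measurable_comp_eq {Z Y : Type*} [MeasurableSpace Z] [StandardBorelSpace Z]
    [MeasurableSpace Y] [MeasurableSpace.CountablySeparated Y] {S : Set Z} (hS : MeasurableSet S)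
    {τ : Z → Y} (hτ : Measurable (S.domRestrict τ)) (hinj : InjOn τ S) {f : Z → ℂ}
    (hf : Measurable f) : ∃ u : Y → ℂ, Measurable u ∧ ∀ x ∈ S, u (τ x) = f x := by
  have : StandardBorelSpace S := hS.standardBorel
  obtain ⟨u, hu, h⟩ := (hτ.measurableEmbedding (injOn_iff_injective.1 hinj)).exists_measurable_extend
    (hf.comp measurable_subtype_coe) fun _ => ⟨0⟩
  exact ⟨u, hu, fun x hx => congrFun h ⟨x, hx⟩⟩

variable {n : ℕ}

/-- The projection onto the torus given by the coordinates in the basis `b`. -/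
def toTorus (b : Module.Basis (Fin n) ℝ (Fin n → ℝ)) (x : Fin n → ℝ) : UnitAddTorus (Fin n) :=
  fun i => (b.equivFun x i : UnitAddCircle)

theorem continuous_toTorus (b : Module.Basis (Fin n) ℝ (Fin n → ℝ)) : Continuous (toTorus b) :=
  continuous_pi fun i => (AddCircle.continuous_mk' 1).comp
    ((continuous_apply i).comp b.equivFun.toLinearMap.continuous_of_finiteDimensional)

theorem toTorus_eq_iff (b : Module.Basis (Fin n) ℝ (Fin n → ℝ)) (x y : Fin n → ℝ) :
    toTorus b x = toTorus b y ↔ x - y ∈ Submodule.span ℤ (range b) := by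
  rw [b.mem_span_iff_repr_mem ℤ, funext_iff]
  refine forall_congr' fun i => ?_
  rw [toTorus, toTorus, QuotientAddGroup.eq_iff_sub_mem, AddSubgroup.mem_zmultiples_iff]
  simp

/-- The covolume of the lattice spanned by `b`. -/
def covol (b : Module.Basis (Fin n) ℝ (Fin n → ℝ)) : ℝ :=
  |(LinearMap.det (b.equivFun : (Fin n → ℝ) →ₗ[ℝ] (Fin n → ℝ)))⁻¹|

theorem map_toTorus (b : Module.Basis (Fin n) ℝ (Fin n → ℝ)) {F : Set (Fin n → ℝ)}
    (hF : IsAddFundamentalDomain (Submodule.span ℤ (range b)) F volume) :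
    (volume.restrict F).map (toTorus b) = ENNReal.ofReal (covol b) • torusMeasure n := by
  have hm := (continuous_toTorus b).measurable
  have h₁ : (volume.restrict F).map (toTorus b) =
      (volume.restrict (ZSpan.fundamentalDomain b)).map (toTorus b) := by
    ext B hB
    rw [Measure.map_apply hm hB, Measure.map_apply hm hB, Measure.restrict_apply (hm hB),
      Measure.restrict_apply (hm hB)]
    have : VAddInvariantMeasure (Submodule.span ℤ (range b)) (Fin n → ℝ) volume :=
      inferInstanceAs <|
        VAddInvariantMeasure (Submodule.span ℤ (range b)).toAddSubgroup (Fin n → ℝ) volume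
    refine hF.measure_set_eq (ZSpan.isAddFundamentalDomain b volume) (hm hB) fun g => ?_
    ext x
    have : toTorus b (g +ᵥ x) = toTorus b x := by
      rw [toTorus_eq_iff, Submodule.vadd_def, vadd_eq_add, add_sub_cancel_right]
      exact g.2
    simp only [mem_preimage, this]
  let E : (Fin n → ℝ) →ₗ[ℝ] (Fin n → ℝ) := b.equivFun
  have hE : Measurable E := E.continuous_of_finiteDimensional.measurable
  have hdet : LinearMap.det E ≠ 0 := (LinearEquiv.isUnit_det' b.equivFun).ne_zero
  have hI : MeasurableSet (univ.pi fun _ : Fin n => Ico (0 : ℝ) 1) :=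
    MeasurableSet.univ_pi fun _ => measurableSet_Ico
  have h₂ : ZSpan.fundamentalDomain b = E ⁻¹' univ.pi fun _ => Ico 0 1 := by
    ext x
    simp [ZSpan.fundamentalDomain, E]
  have h₃ : toTorus b = (fun x i => (x i : UnitAddCircle)) ∘ E := rfl
  have hq : Measurable fun (x : Fin n → ℝ) i => (x i : UnitAddCircle) :=
    measurable_pi_lambda _ fun i => (AddCircle.continuous_mk' 1).measurable.comp (measurable_pi_apply i)
  have h₄ : (volume.restrict (Ioc 0 1)).map (fun x : ℝ => (x : UnitAddCircle)) =
      AddCircle.haarAddCircle := by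
    have := (AddCircle.measurePreserving_mk 1 0).map_eq
    rw [zero_add, AddCircle.volume_eq_smul_haarAddCircle, ENNReal.ofReal_one, one_smul] at this
    exact this
  have h₅ : (volume.restrict (univ.pi fun _ : Fin n => Ico (0 : ℝ) 1)) =
      Measure.pi fun _ : Fin n => volume.restrict (Ioc (0 : ℝ) 1) := by
    rw [volume_pi, Measure.restrict_pi_pi]
    congr 1
    ext1 i
    exact Measure.restrict_congr_set Ico_ae_eq_Ioc
  rw [h₁, h₂, h₃, ← Measure.map_map hq hE, ← Measure.restrict_map hE hI,
    Real.map_linearMap_volume_pi_eq_smul_volume_pi hdet, Measure.restrict_smul, Measure.map_smul, h₅]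
  congr 1
  rw [torusMeasure, ← h₄]
  exact (measurePreserving_pi _ _ fun i =>
    ⟨(AddCircle.continuous_mk' 1).measurable, rfl⟩).map_eq

theorem exists_measurable_subset_injOn_toTorus (b : Module.Basis (Fin n) ℝ (Fin n → ℝ))
    {F : Set (Fin n → ℝ)} (hF : IsAddFundamentalDomain (Submodule.span ℤ (range b)) F volume) :
    ∃ S ⊆ F, MeasurableSet S ∧ S =ᵐ[volume] F ∧ InjOn (toTorus b) S := by
  obtain ⟨F₀, hF₀, hF₀m, hF₀e⟩ := hF.nullMeasurableSet.exists_measurable_subset_ae_eq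
  let N := ⋃ g : {g : Submodule.span ℤ (range b) // g ≠ 0}, F₀ ∩ (fun x => -g.1.1 + x) ⁻¹' F₀
  have hNm : MeasurableSet N := MeasurableSet.iUnion fun g =>
    hF₀m.inter ((measurable_const_add _) hF₀m)
  have hN : volume N = 0 := by
    refine measure_iUnion_null fun g => measure_mono_null ?_ (hF.aedisjoint (Ne.symm g.2))
    rintro x ⟨hx, hx'⟩
    refine ⟨by simpa using hF₀ hx, ?_⟩
    refine ⟨_, hF₀ hx', ?_⟩
    simp [Submodule.vadd_def]
  refine ⟨F₀ \ N, sdiff_subset.trans hF₀, hF₀m.diff hNm, (sdiff_null_ae_eq_self hN).trans hF₀e, ?_⟩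
  rintro x ⟨hx, hxN⟩ y ⟨hy, hyN⟩ hxy
  by_contra hne
  rw [toTorus_eq_iff] at hxy
  refine hxN (mem_iUnion.2 ⟨⟨⟨x - y, hxy⟩, fun h => hne (sub_eq_zero.1 (congrArg Subtype.val h))⟩,
    hx, ?_⟩)
  simpa using hy

theorem mFourier_toTorus (b : Module.Basis (Fin n) ℝ (Fin n → ℝ)) (z : Fin n → ℤ)
    (x : Fin n → ℝ) : UnitAddTorus.mFourier z (toTorus b x) =
      Circle.coeHom (Circle.exp (2 * Real.pi * ∑ i, z i * b.equivFun x i)) := by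
  have h₁ : UnitAddTorus.mFourier z (toTorus b x) =
      ∏ i, fourier (z i) (b.equivFun x i : UnitAddCircle) := rfl
  have h₂ : Circle.coeHom (Circle.exp (2 * Real.pi * ∑ i, z i * b.equivFun x i)) =
      Complex.exp ((2 * Real.pi * ∑ i, z i * b.equivFun x i : ℝ) * Complex.I) := Circle.coe_exp _
  rw [h₁, h₂]
  simp only [fourier_coe_apply]
  rw [← Complex.exp_sum]
  congr 1
  push_cast
  rw [Finset.mul_sum, Finset.sum_mul]
  refine Finset.sum_congr rfl fun i _ => ?_
  ring

theorem tsum_enorm_sq_fourier (b : Module.Basis (Fin n) ℝ (Fin n → ℝ)) {F : Set (Fin n → ℝ)}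
    (hF : IsAddFundamentalDomain (Submodule.span ℤ (range b)) F volume) {u : (Fin n → ℝ) → ℂ}
    (hu : Measurable u) (hu2 : MemLp u 2 volume) (hu0 : ∀ x ∉ F, u x = 0) :
    ∑' z : Fin n → ℤ, ‖∫ x, Circle.coeHom
        (Circle.exp (2 * Real.pi * ∑ i, z i * b.equivFun x i)) * u x‖ₑ ^ 2 =
      ENNReal.ofReal (covol b) * ∫⁻ x, ‖u x‖ₑ ^ 2 := by
  obtain ⟨S, hSF, hS, hSe, hinj⟩ := exists_measurable_subset_injOn_toTorus b hF
  have hm := (continuous_toTorus b).measurable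
  obtain ⟨v, hv, hvu⟩ := exists_measurable_comp_eq (τ := toTorus b) hS
    (hm.comp measurable_subtype_coe) hinj hu
  have hvF : ∀ᵐ x ∂volume.restrict F, v (toTorus b x) = u x := by
    rw [← Measure.restrict_congr_set hSe]
    exact ae_restrict_of_forall_mem hS hvu
  have hmap := map_toTorus b hF
  have hc : 0 ≤ covol b := abs_nonneg _
  have hc0 : ENNReal.ofReal (covol b) ≠ 0 := by
    rw [Ne, ENNReal.ofReal_eq_zero, not_le]
    exact abs_pos.2 (inv_ne_zero (LinearEquiv.isUnit_det' b.equivFun).ne_zero)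
  have hl : ∀ g : UnitAddTorus (Fin n) → ℝ≥0∞, Measurable g →
      ENNReal.ofReal (covol b) * ∫⁻ t, g t ∂torusMeasure n = ∫⁻ x in F, g (toTorus b x) :=
    fun g hg => by
      rw [← lintegral_map hg hm, hmap, lintegral_smul_measure, smul_eq_mul]
  have hu2' : ∫⁻ x in F, ‖v (toTorus b x)‖ₑ ^ 2 = ∫⁻ x, ‖u x‖ₑ ^ 2 := by
    have h₁ : ∫⁻ x in F, ‖v (toTorus b x)‖ₑ ^ 2 = ∫⁻ x in F, ‖u x‖ₑ ^ 2 :=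
      lintegral_congr_ae (hvF.mono fun x hx => by simp only [hx])
    rw [h₁]
    refine setLIntegral_eq_of_support_subset fun x hx => ?_
    by_contra hxF
    exact hx (by simp [hu0 x hxF])
  have hi : ∀ z : Fin n → ℤ, ∫ x, Circle.coeHom
        (Circle.exp (2 * Real.pi * ∑ i, z i * b.equivFun x i)) * u x =
      covol b * ∫ t, UnitAddTorus.mFourier z t * v t ∂torusMeasure n := fun z => by
    rw [← setIntegral_eq_integral_of_forall_compl_eq_zero (s := F)
      (fun x hx => by rw [hu0 x hx, mul_zero])]
    have h₁ : ∫ t, UnitAddTorus.mFourier z t * v t ∂(volume.restrict F).map (toTorus b) =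
        covol b * ∫ t, UnitAddTorus.mFourier z t * v t ∂torusMeasure n := by
      rw [hmap, integral_smul_measure, ENNReal.toReal_ofReal hc]
      rfl
    rw [← h₁, integral_map hm.aemeasurable (by fun_prop)]
    exact integral_congr_ae (hvF.mono fun x hx => by simp only [hx, mFourier_toTorus])
  have hlv := hl (fun t => ‖v t‖ₑ ^ 2) (by fun_prop)
  have hv2 : MemLp v 2 (torusMeasure n) := by
    refine ⟨hv.aestronglyMeasurable, ?_⟩
    rw [eLpNorm_lt_top_iff_lintegral_rpow_enorm_lt_top two_ne_zero ENNReal.ofNat_ne_top]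
    have h₁ := (eLpNorm_lt_top_iff_lintegral_rpow_enorm_lt_top two_ne_zero
      ENNReal.ofNat_ne_top).1 hu2.2
    simp only [ENNReal.toReal_ofNat, ENNReal.rpow_ofNat] at h₁ ⊢
    rw [← hu2', ← hlv] at h₁
    exact (ENNReal.mul_lt_top_iff.1 h₁).elim (fun h => h.2)
      (fun h => h.elim (fun h => absurd h hc0) (fun h => h ▸ ENNReal.zero_lt_top))
  have hce : ‖(covol b : ℂ)‖ₑ = ENNReal.ofReal (covol b) := by
    rw [← ofReal_norm, Complex.norm_real, Real.norm_of_nonneg hc]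
  simp only [hi, enorm_mul, mul_pow]
  rw [ENNReal.tsum_mul_left, tsum_enorm_sq_mFourier hv2, ← hu2', ← hlv, ← mul_assoc, sq, hce]

end Parseval

/-! ### Parseval's identity in the coordinates `Φ` -/

section Transfer

theorem memLp_two_iff_lintegral {Z : Type*} [MeasurableSpace Z] {μ : Measure Z} {f : Z → ℂ}
    (hf : AEStronglyMeasurable f μ) : MemLp f 2 μ ↔ ∫⁻ x, ‖f x‖ₑ ^ 2 ∂μ < ⊤ := by
  have h := eLpNorm_lt_top_iff_lintegral_rpow_enorm_lt_top (μ := μ) (f := f) two_ne_zero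
    ENNReal.ofNat_ne_top
  simp only [ENNReal.toReal_ofNat, ENNReal.rpow_ofNat] at h
  rw [← h]
  exact ⟨fun h => h.2, fun h => ⟨hf, h⟩⟩

variable {n : ℕ} {Z : Type*} [MeasurableSpace Z]

theorem tsum_enorm_sq_integral {μ : Measure Z} {Ω : Set Z} (hΩ : MeasurableSet Ω)
    {Φ : Z → Fin n → ℝ} (hΦ : Measurable (Ω.domRestrict Φ)) {r : (Fin n → ℝ) → Z} (hr : Measurable r)
    (hrΦ : LeftInvOn r Φ Ω)
    {Ψ : (Fin n → ℝ) → ℝ} (hV : MeasurableSet (Φ '' Ω)) (hΨ : Measurable ((Φ '' Ω).indicator Ψ))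
    (hΨ0 : ∀ ξ ∈ Φ '' Ω, 0 ≤ Ψ ξ)
    (hmap : (μ.restrict Ω).map Φ =
      (volume.restrict (Φ '' Ω)).withDensity fun ξ => ENNReal.ofReal (Ψ ξ))
    (b : Module.Basis (Fin n) ℝ (Fin n → ℝ)) {F : Set (Fin n → ℝ)}
    (hF : IsAddFundamentalDomain (Submodule.span ℤ (range b)) F volume)
    {K : Set Z} (hKΩ : K ⊆ Ω) (hKF : Φ '' K ⊆ F) {C : ℝ} (hC : ∀ m ∈ K, Ψ (Φ m) ≤ C)
    {f : Z → ℂ} (hf : Measurable f) (hf2 : MemLp f 2 μ) (hf0 : ∀ m ∉ K, f m = 0) :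
    ∑' z : Fin n → ℤ, ‖∫ m, Circle.coeHom
        (Circle.exp (2 * Real.pi * ∑ i, z i * b.equivFun (Φ m) i)) * f m ∂μ‖ₑ ^ 2 =
      ∫⁻ m, ENNReal.ofReal (covol b * Ψ (Φ m)) * ‖f m‖ₑ ^ 2 ∂μ := by
  set V := Φ '' Ω with hVdef
  let u₀ : (Fin n → ℝ) → ℂ := fun ξ => f (r ξ)
  have hu₀ : Measurable u₀ := hf.comp hr
  have hu₀f : ∀ m ∈ Ω, u₀ (Φ m) = f m := fun m hm => congrArg f (hrΦ hm)
  set Ψ' := V.indicator Ψ with hΨ'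
  have hΨ'0 : ∀ ξ, 0 ≤ Ψ' ξ := indicator_nonneg hΨ0
  have hΨ'eq : ∀ m ∈ Ω, Ψ' (Φ m) = Ψ (Φ m) := fun m hm => indicator_of_mem (mem_image_of_mem _ hm) _
  have hf0' : ∀ m ∉ Ω, f m = 0 := fun m hm => hf0 m fun h => hm (hKΩ h)
  have hΦm : AEMeasurable Φ (μ.restrict Ω) := aemeasurable_restrict_of_measurable_subtype hΩ hΦ
  have hmap' : (μ.restrict Ω).map Φ = volume.withDensity fun ξ => ENNReal.ofReal (Ψ' ξ) := by
    rw [hmap, ← withDensity_indicator hV]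
    congr 1
    ext ξ
    by_cases hξ : ξ ∈ V <;> simp [hΨ', hξ]
  have hl : ∀ g : (Fin n → ℝ) → ℝ≥0∞, Measurable g →
      ∫⁻ m in Ω, g (Φ m) ∂μ = ∫⁻ ξ, ENNReal.ofReal (Ψ' ξ) * g ξ := fun g hg => by
    rw [← lintegral_map' hg.aemeasurable hΦm, hmap',
      lintegral_withDensity_eq_lintegral_mul _ (by fun_prop) hg]
    rfl
  let u : (Fin n → ℝ) → ℂ := fun ξ => (Ψ' ξ : ℂ) * u₀ ξ
  have hum : Measurable u := by fun_prop
  have hue : ∀ ξ, ‖u ξ‖ₑ ^ 2 = ENNReal.ofReal (Ψ' ξ) * (ENNReal.ofReal (Ψ' ξ) * ‖u₀ ξ‖ₑ ^ 2) :=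
    fun ξ => by
      have : ‖(Ψ' ξ : ℂ)‖ₑ = ENNReal.ofReal (Ψ' ξ) := by
        rw [← ofReal_norm, Complex.norm_real, Real.norm_of_nonneg (hΨ'0 ξ)]
      rw [enorm_mul, mul_pow, this, sq, mul_assoc]
  have hu_eq : ∫⁻ ξ, ‖u ξ‖ₑ ^ 2 = ∫⁻ m, ENNReal.ofReal (Ψ (Φ m)) * ‖f m‖ₑ ^ 2 ∂μ := by
    simp only [hue]
    rw [← hl (fun ξ => ENNReal.ofReal (Ψ' ξ) * ‖u₀ ξ‖ₑ ^ 2) (by fun_prop),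
      ← setLIntegral_eq_of_support_subset (s := Ω)
        (f := fun m => ENNReal.ofReal (Ψ (Φ m)) * ‖f m‖ₑ ^ 2)]
    · exact setLIntegral_congr_fun hΩ fun m hm => by
        rw [hΨ'eq m hm, hu₀f m hm]
    · intro m hm
      by_contra h
      exact hm (by simp [hf0' m h])
  have hu2 : MemLp u 2 volume := by
    rw [memLp_two_iff_lintegral hum.aestronglyMeasurable, hu_eq]
    have h₁ := (memLp_two_iff_lintegral hf.aestronglyMeasurable).1 hf2
    refine lt_of_le_of_lt ?_ (ENNReal.mul_lt_top (a := ENNReal.ofReal C) ENNReal.ofReal_lt_top h₁)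
    rw [← lintegral_const_mul _ (by fun_prop)]
    refine lintegral_mono fun m => ?_
    by_cases hm : m ∈ K
    · gcongr
      exact hC m hm
    · simp [hf0 m hm]
  have hu0 : ∀ ξ ∉ F, u ξ = 0 := by
    intro ξ hξ
    by_cases hξV : ξ ∈ V
    · obtain ⟨m, hm, rfl⟩ := hξV
      have : m ∉ K := fun h => hξ (hKF (mem_image_of_mem _ h))
      simp [u, hu₀f m hm, hf0 m this]
    · simp [u, hΨ', hξV]
  have hi : ∀ z : Fin n → ℤ, ∫ m, Circle.coeHom
        (Circle.exp (2 * Real.pi * ∑ i, z i * b.equivFun (Φ m) i)) * f m ∂μ =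
      ∫ ξ, Circle.coeHom
        (Circle.exp (2 * Real.pi * ∑ i, z i * b.equivFun ξ i)) * u ξ := fun z => by
    let e : (Fin n → ℝ) → ℂ := fun ξ => Circle.coeHom
        (Circle.exp (2 * Real.pi * ∑ i, z i * b.equivFun ξ i))
    have he : Continuous e := by
      refine continuous_coeHom.comp (Circle.exp.continuous.comp ?_)
      have : Continuous b.equivFun := b.equivFun.toLinearMap.continuous_of_finiteDimensional
      fun_prop
    have hem : Measurable e := he.measurable
    rw [← setIntegral_eq_integral_of_forall_compl_eq_zero (s := Ω)
      (fun m hm => by rw [hf0' m hm, mul_zero])]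
    have h₁ : ∫ m in Ω, e (Φ m) * f m ∂μ = ∫ m in Ω, e (Φ m) * u₀ (Φ m) ∂μ :=
      setIntegral_congr_fun hΩ fun m hm => by
        rw [hu₀f m hm]
    rw [h₁, ← integral_map (f := fun ξ => e ξ * u₀ ξ) hΦm
      (hem.mul hu₀).aestronglyMeasurable, hmap',
      integral_withDensity_eq_integral_toReal_smul (by fun_prop)
        (Eventually.of_forall fun _ => ENNReal.ofReal_lt_top)]
    refine integral_congr_ae (Eventually.of_forall fun ξ => ?_)
    simp only [ENNReal.toReal_ofReal (hΨ'0 ξ), Complex.real_smul, u, e]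
    ring
  simp only [hi]
  rw [tsum_enorm_sq_fourier b hF hum hu2 hu0, hu_eq,
    ← lintegral_const_mul' _ _ ENNReal.ofReal_ne_top]
  refine lintegral_congr fun m => ?_
  rw [ENNReal.ofReal_mul (p := covol b) (abs_nonneg _), mul_assoc]

end Transfer

/-! ### Frames with a frame operator of multiplication type -/

section Multiplier

theorem lintegral_enorm_sq_Lp {Z : Type*} [MeasurableSpace Z] {μ : Measure Z} (h : Lp ℂ 2 μ) :
    ∫⁻ x, ‖h x‖ₑ ^ 2 ∂μ = ENNReal.ofReal (‖h‖ ^ 2) := by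
  have h₁ := eLpNorm_eq_lintegral_rpow_enorm_toReal (μ := μ) (f := h) two_ne_zero
    ENNReal.ofNat_ne_top
  simp only [ENNReal.toReal_ofNat, ENNReal.rpow_ofNat] at h₁
  rw [ENNReal.ofReal_pow (norm_nonneg _), ofReal_norm, Lp.enorm_def, h₁, ← ENNReal.rpow_natCast,
    ← ENNReal.rpow_mul]
  simp

theorem exists_Lp_eq_indicator {Z : Type*} [MeasurableSpace Z] {μ : Measure Z} {U : Set Z}
    (hU : MeasurableSet U) (hμU : μ U ≠ ⊤) :
    ∃ h : Lp ℂ 2 μ, ∀ W : Z → ℝ≥0∞, ∫⁻ x, W x * ‖h x‖ₑ ^ 2 ∂μ = ∫⁻ x in U, W x ∂μ := by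
  refine ⟨indicatorConstLp 2 hU hμU 1, fun W => ?_⟩
  rw [← lintegral_indicator hU]
  refine lintegral_congr_ae ?_
  filter_upwards [indicatorConstLp_coeFn (p := 2) (hs := hU) (hμs := hμU) (c := (1 : ℂ))] with x hx
  rw [hx]
  by_cases hxU : x ∈ U <;> simp [hxU]

variable {Z : Type*} [TopologicalSpace Z] [MeasurableSpace Z] [BorelSpace Z] {μ : Measure Z}
  [IsLocallyFiniteMeasure μ] [μ.IsOpenPosMeasure]

omit [BorelSpace Z] in
theorem exists_isOpen_subset_measure {V : Set Z} (hV : IsOpen V) (hne : V.Nonempty) :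
    ∃ U ⊆ V, IsOpen U ∧ μ U ≠ 0 ∧ μ U ≠ ⊤ := by
  obtain ⟨x, hx⟩ := hne
  obtain ⟨N, hxN, hN, hμN⟩ := μ.exists_isOpen_measure_lt_top x
  exact ⟨V ∩ N, inter_subset_left, hV.inter hN, (hV.inter hN).measure_ne_zero μ ⟨x, hx, hxN⟩,
    measure_ne_top_of_subset inter_subset_right hμN.ne⟩

theorem frame_of_multiplier [Nonempty Z] {ι : Type*} {v : ι → Lp ℂ 2 μ} {W : Z → ℝ≥0∞}
    (hW : Continuous W)
    (hv : ∀ h : Lp ℂ 2 μ, ∑' i, ‖⟪h, v i⟫_ℂ‖ₑ ^ 2 = ∫⁻ x, W x * ‖h x‖ₑ ^ 2 ∂μ)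
    (hinf : 0 < ⨅ x, W x) (hsup : ⨆ x, W x < ⊤) :
    IsFrame v ∧ IsGreatest {a | IsLowerFrameBound v a} (⨅ x, W x).toReal ∧
      IsLeast {b | IsUpperFrameBound v b} (⨆ x, W x).toReal := by
  obtain ⟨x₀⟩ := ‹Nonempty Z›
  have hle : ⨅ x, W x ≤ ⨆ x, W x := (iInf_le W x₀).trans (le_iSup W x₀)
  have hinf' : ⨅ x, W x ≠ ⊤ := (hle.trans_lt hsup).ne
  have hWm : Measurable W := hW.measurable
  have hlow : IsLowerFrameBound v (⨅ x, W x).toReal := by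
    refine ⟨ENNReal.toReal_pos hinf.ne' hinf', fun h => ?_⟩
    rw [hv, ENNReal.ofReal_mul ENNReal.toReal_nonneg, ENNReal.ofReal_toReal hinf',
      ← lintegral_enorm_sq_Lp, ← lintegral_const_mul' _ _ hinf']
    exact lintegral_mono fun x => mul_le_mul_left (iInf_le W x) _
  have hup : IsUpperFrameBound v (⨆ x, W x).toReal := by
    refine ⟨ENNReal.toReal_pos (hinf.trans_le hle).ne' hsup.ne, fun h => ?_⟩
    rw [hv, ENNReal.ofReal_mul ENNReal.toReal_nonneg, ENNReal.ofReal_toReal hsup.ne,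
      ← lintegral_enorm_sq_Lp, ← lintegral_const_mul' _ _ hsup.ne]
    exact lintegral_mono fun x => mul_le_mul_left (le_iSup W x) _
  refine ⟨⟨_, _, ENNReal.toReal_mono hsup.ne hle, hlow, hup⟩, ⟨hlow, ?_⟩, ⟨hup, ?_⟩⟩
  · rintro a ⟨ha, hah⟩
    by_contra! hlt
    have h₁ : ⨅ x, W x < ENNReal.ofReal a := (ENNReal.lt_ofReal_iff_toReal_lt hinf').2 hlt
    obtain ⟨r, hr, hra⟩ := exists_between h₁
    obtain ⟨x, hx⟩ := iInf_lt_iff.1 hr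
    obtain ⟨U, hUV, hU, hU0, hUt⟩ := exists_isOpen_subset_measure (μ := μ)
      (isOpen_Iio.preimage hW) ⟨x, hx⟩
    obtain ⟨h, hh⟩ := exists_Lp_eq_indicator hU.measurableSet hUt
    have h₂ := hah h
    have h₃ := hh 1
    simp only [Pi.one_apply, one_mul, lintegral_one, Measure.restrict_apply_univ] at h₃
    rw [hv, hh, ENNReal.ofReal_mul ha.le, ← lintegral_enorm_sq_Lp, h₃] at h₂
    have h₄ : ∫⁻ x in U, W x ∂μ ≤ r * μ U := by
      rw [← setLIntegral_const]
      exact setLIntegral_mono measurable_const fun x hx => (hUV hx).le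
    exact absurd (h₂.trans h₄) (not_le.2 (ENNReal.mul_lt_mul_left hU0 hUt hra))
  · rintro b ⟨hb, hbh⟩
    by_contra! hlt
    have h₁ : ENNReal.ofReal b < ⨆ x, W x := (ENNReal.ofReal_lt_iff_lt_toReal hb.le hsup.ne).2 hlt
    obtain ⟨r, hrb, hr⟩ := exists_between h₁
    obtain ⟨x, hx⟩ := lt_iSup_iff.1 hr
    obtain ⟨U, hUV, hU, hU0, hUt⟩ := exists_isOpen_subset_measure (μ := μ)
      (isOpen_Ioi.preimage hW) ⟨x, hx⟩
    obtain ⟨h, hh⟩ := exists_Lp_eq_indicator hU.measurableSet hUt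
    have h₂ := hbh h
    have h₃ := hh 1
    simp only [Pi.one_apply, one_mul, lintegral_one, Measure.restrict_apply_univ] at h₃
    rw [hv, hh, ENNReal.ofReal_mul hb.le, ← lintegral_enorm_sq_Lp, h₃] at h₂
    have h₄ : r * μ U ≤ ∫⁻ x in U, W x ∂μ := by
      rw [← setLIntegral_const]
      exact setLIntegral_mono hWm fun x hx => (hUV hx).le
    exact absurd (h₄.trans h₂) (not_le.2 (ENNReal.mul_lt_mul_left hU0 hUt hrb))

end Multiplier

section LocallyFinite

variable {M : Type*} [Group M] [TopologicalSpace M] [IsTopologicalGroup M] {g : M → ℝ≥0∞}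
  {Γ : Set M}

theorem finite_inter_of_tsum_ne_top (hg : Continuous g) {m₀ : M} (hm₀ : g m₀ ≠ 0)
    (hsum : ∀ m, ∑' γ : Γ, g (γ * m) ≠ ⊤) {C : Set M} (hC : IsCompact C) : (Γ ∩ C).Finite := by
  refine hC.induction_on (p := fun S => (Γ ∩ S).Finite) (by simp)
    (fun S T hST hT => hT.subset (inter_subset_inter_right _ hST))
    (fun S T hS hT => by rw [inter_union_distrib_left]; exact hS.union hT) fun γ₀ _ => ?_
  obtain ⟨r, hr0, hr⟩ := exists_between (pos_iff_ne_zero.2 hm₀)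
  have h₁ : Tendsto (fun γ : M => g (γ * (γ₀⁻¹ * m₀))) (𝓝 γ₀) (𝓝 (g m₀)) := by
    have : Continuous fun γ : M => g (γ * (γ₀⁻¹ * m₀)) := by fun_prop
    simpa using this.tendsto γ₀
  refine ⟨_, mem_nhdsWithin_of_mem_nhds (h₁.eventually (lt_mem_nhds hr)), ?_⟩
  have h₂ := ENNReal.finite_const_le_of_tsum_ne_top (hsum (γ₀⁻¹ * m₀)) hr0.ne'
  refine (h₂.image Subtype.val).subset ?_
  rintro γ ⟨hγ, hγr⟩
  have h₃ : r < g (γ * (γ₀⁻¹ * m₀)) := hγr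
  exact ⟨⟨γ, hγ⟩, (h₃.le : r ≤ _), rfl⟩

theorem continuous_tsum_mul_left [LocallyCompactSpace M] (hg : Continuous g) {K : Set M}
    (hK : IsCompact K) (hgK : ∀ m ∉ K, g m = 0) {m₀ : M} (hm₀ : g m₀ ≠ 0)
    (hsum : ∀ m, ∑' γ : Γ, g (γ * m) ≠ ⊤) : Continuous fun m => ∑' γ : Γ, g (γ * m) := by
  have hlf : LocallyFinite fun γ : Γ => Function.support fun m => g (γ * m) := by
    intro m
    obtain ⟨U, hU, hUm⟩ := exists_compact_mem_nhds m
    refine ⟨U, hUm, ?_⟩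
    have h₁ := finite_inter_of_tsum_ne_top hg hm₀ hsum (hK.mul hU.inv)
    refine Finite.of_finite_image (f := Subtype.val) (h₁.subset ?_) Subtype.val_injective.injOn
    rintro _ ⟨γ, ⟨x, hx, hxU⟩, rfl⟩
    refine ⟨γ.2, ?_⟩
    have : (γ : M) * x ∈ K := by
      by_contra h
      exact hx (hgK _ h)
    exact ⟨_, this, x⁻¹, inv_mem_inv.2 hxU, by simp⟩
  have h₂ : (fun m => ∑' γ : Γ, g (γ * m)) = fun m => ∑ᶠ γ : Γ, g (γ * m) := by
    ext m
    exact tsum_eq_finsum (hlf.point_finite m)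
  rw [h₂]
  exact continuous_finsum (fun γ => by fun_prop) hlf

theorem countable_of_tsum_ne_top [SigmaCompactSpace M] (hg : Continuous g) {m₀ : M}
    (hm₀ : g m₀ ≠ 0) (hsum : ∀ m, ∑' γ : Γ, g (γ * m) ≠ ⊤) : Γ.Countable := by
  have h : Γ = ⋃ n, Γ ∩ compactCovering M n := by
    rw [← inter_iUnion, iUnion_compactCovering, inter_univ]
  rw [h]
  exact countable_iUnion fun n =>
    (finite_inter_of_tsum_ne_top hg hm₀ hsum (isCompact_compactCovering M n)).countable

end LocallyFinite

/-! ### Coefficients of the induced representation -/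

section Coefficients

variable {G : Type*} [TopologicalSpace G] [Group G] [IsTopologicalGroup G] [MeasurableSpace G]
  [BorelSpace G] {P M : Subgroup G} [P.Normal]

omit [IsTopologicalGroup G] [TopologicalSpace G] [MeasurableSpace G] [BorelSpace G] in
theorem conjP_conjP (p : P) (γ m : M) : conjP (conjP p γ) m = conjP p (γ * m) := by
  apply Subtype.ext
  simp only [conjP, Subgroup.coe_mul]
  group

theorem inner_indRep (hPM : P.IsComplement' M) (χ : P →ₜ* Circle) (μ : Measure M)
    [μ.IsMulLeftInvariant] {s : M → ℂ} (hs : MemLp s 2 μ) (p : P) (γ : M) (h : Lp ℂ 2 μ) :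
    ⟪h, indRep hPM χ μ ((γ : G)⁻¹ * p) (hs.toLp s)⟫_ℂ =
      ∫ m, Circle.coeHom (χ (conjP p m)) * (s m * (starRingEnd ℂ) (h (γ⁻¹ * m))) ∂μ := by
  have hg : (γ : G)⁻¹ * p = (conjP p γ : P) * ((γ⁻¹ : M) : G) := by
    simp only [conjP, Subgroup.coe_inv]
    group
  have hs' := (measurePreserving_mul_left μ γ).quasiMeasurePreserving.ae_eq_comp hs.coeFn_toLp
  rw [hg, L2.inner_def, ← integral_mul_left_eq_self (fun m =>
    Circle.coeHom (χ (conjP p m)) * (s m * (starRingEnd ℂ) (h (γ⁻¹ * m)))) γ]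
  refine integral_congr_ae ?_
  filter_upwards [indRep_ae hPM χ μ (conjP p γ) γ⁻¹ (hs.toLp s), hs'] with m h₁ h₂
  have h₂' : hs.toLp s (γ * m) = s (γ * m) := h₂
  rw [RCLike.inner_apply, h₁, inv_inv, h₂', conjP_conjP, inv_mul_cancel_left, mul_assoc]

end Coefficients

/-! ### The dual lattice -/

section Lattice

variable {n : ℕ}

/-- The basis `(L^{-T} X_k^*)` of the dual lattice. -/
def dualBasis (L : GL (Fin n) ℝ) : Module.Basis (Fin n) ℝ (Fin n → ℝ) :=
  Module.Basis.ofEquivFun (Matrix.toLin'OfInv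
    (M := ((↑L⁻¹ : Matrix (Fin n) (Fin n) ℝ)ᵀ)) (M' := (L : Matrix (Fin n) (Fin n) ℝ)ᵀ)
    (by rw [← Matrix.transpose_mul, ← Units.val_mul, mul_inv_cancel]; simp)
    (by rw [← Matrix.transpose_mul, ← Units.val_mul, inv_mul_cancel]; simp))

theorem dualBasis_equivFun (L : GL (Fin n) ℝ) (ξ : Fin n → ℝ) :
    (dualBasis L).equivFun ξ = (L : Matrix (Fin n) (Fin n) ℝ)ᵀ *ᵥ ξ := by
  rw [dualBasis, Module.Basis.equivFun_ofEquivFun]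
  exact Matrix.toLin'_apply (L : Matrix (Fin n) (Fin n) ℝ)ᵀ ξ

theorem dualLattice_eq (L : GL (Fin n) ℝ) :
    dualLattice L = Submodule.span ℤ (range (dualBasis L)) := by
  rw [dualLattice]
  congr 2
  ext k : 1
  rw [dualBasis, Module.Basis.coe_ofEquivFun]
  exact ((Matrix.toLin'_apply _ _).trans
    (Matrix.mulVec_single_one ((↑L⁻¹ : Matrix (Fin n) (Fin n) ℝ)ᵀ) k)).symm

theorem covol_dualBasis (L : GL (Fin n) ℝ) :
    covol (dualBasis L) = |((↑L⁻¹ : Matrix (Fin n) (Fin n) ℝ)ᵀ).det| := by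
  have h : ((dualBasis L).equivFun : (Fin n → ℝ) →ₗ[ℝ] (Fin n → ℝ)) =
      Matrix.toLin' (L : Matrix (Fin n) (Fin n) ℝ)ᵀ := by
    refine LinearMap.ext fun ξ => ?_
    rw [Matrix.toLin'_apply]
    exact dualBasis_equivFun L ξ
  rw [covol, h, LinearMap.det_toLin', Matrix.det_transpose, Matrix.det_transpose,
    Matrix.coe_units_inv, Matrix.det_nonsing_inv, Ring.inverse_eq_inv']

theorem eq_of_circleExp_eq_on_open (b : Module.Basis (Fin n) ℝ (Fin n → ℝ)) {V : Set (Fin n → ℝ)}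
    (hV : IsOpen V) (hne : V.Nonempty) {z z' : Fin n → ℤ}
    (h : ∀ ξ ∈ V, Circle.exp (2 * Real.pi * ∑ i, z i * b.equivFun ξ i) =
      Circle.exp (2 * Real.pi * ∑ i, z' i * b.equivFun ξ i)) : z = z' := by
  obtain ⟨ξ₀, hξ₀⟩ := hne
  let w : Fin n → ℝ := fun i => z i - z' i
  let η := b.equivFun.symm w
  let N : ℝ := ∑ i, w i * w i
  have hint : ∀ ξ ∈ V, ∃ k : ℤ, ∑ i, w i * b.equivFun ξ i = k := fun ξ hξ => by
    obtain ⟨k, hk⟩ := Circle.exp_eq_exp.1 (h ξ hξ)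
    refine ⟨k, ?_⟩
    have h₁ : ∑ i, w i * b.equivFun ξ i =
        ∑ i, z i * b.equivFun ξ i - ∑ i, z' i * b.equivFun ξ i := by
      rw [← Finset.sum_sub_distrib]
      exact Finset.sum_congr rfl fun i _ => by simp only [w]; ring
    rw [h₁]
    have := Real.pi_pos
    apply mul_left_cancel₀ (mul_pos two_pos this).ne'
    linarith
  have hη : ∀ t : ℝ, ∑ i, w i * b.equivFun (ξ₀ + t • η) i =
      ∑ i, w i * b.equivFun ξ₀ i + t * N := fun t => by
    rw [map_add, map_smul, b.equivFun.apply_symm_apply, Finset.mul_sum, ← Finset.sum_add_distrib]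
    exact Finset.sum_congr rfl fun i _ => by simp only [Pi.add_apply, Pi.smul_apply, smul_eq_mul]; ring
  by_contra hne
  have hN : 0 < N := by
    obtain ⟨i, hi⟩ := Function.ne_iff.1 hne
    refine Finset.sum_pos' (fun i _ => mul_self_nonneg _) ⟨i, Finset.mem_univ _, ?_⟩
    exact mul_self_pos.2 (sub_ne_zero.2 (by exact_mod_cast hi))
  have h₁ : Tendsto (fun t : ℝ => ξ₀ + t • η) (𝓝 0) (𝓝 ξ₀) := by
    have : Continuous fun t : ℝ => ξ₀ + t • η := by fun_prop
    simpa using this.tendsto 0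
  have h₂ : Tendsto (fun t : ℝ => t * N) (𝓝 0) (𝓝 0) := by
    have : Continuous fun t : ℝ => t * N := by fun_prop
    simpa using this.tendsto 0
  have h₃ : ∀ᶠ t in 𝓝[>] (0 : ℝ), ξ₀ + t • η ∈ V ∧ t * N < 1 ∧ 0 < t :=
    ((h₁.eventually (hV.mem_nhds hξ₀)).filter_mono nhdsWithin_le_nhds).and
      (((h₂.eventually (gt_mem_nhds one_pos)).filter_mono nhdsWithin_le_nhds).and
        eventually_mem_nhdsWithin)
  obtain ⟨t, htV, ht1, ht0⟩ := h₃.exists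
  obtain ⟨k, hk⟩ := hint _ htV
  obtain ⟨k₀, hk₀⟩ := hint _ hξ₀
  rw [hη, hk₀] at hk
  have h₄ : t * N = ((k - k₀ : ℤ) : ℝ) := by push_cast; linarith
  have h₅ : 0 < t * N := mul_pos ht0 hN
  rw [h₄] at h₅ ht1
  have : (0 : ℤ) < k - k₀ := by exact_mod_cast h₅
  have : k - k₀ < (1 : ℤ) := by exact_mod_cast ht1
  omega

end Lattice

/-! ### The frame operator -/

section FrameOperator

variable {d : ℕ} {G : Type*} [TopologicalSpace G] [ChartedSpace (EuclideanSpace ℝ (Fin d)) G]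
  [Group G] [LieGroup (𝓡 d) ∞ G] {P M : Subgroup G}
  {𝔪 : LieSubalgebra ℝ (GroupLieAlgebra (𝓡 d) G)} {𝔭 : LieIdeal ℝ (GroupLieAlgebra (𝓡 d) G)}
  {n₁ n₂ : ℕ} {hM : (M : Set G) = lieExp '' (𝔪 : Set (GroupLieAlgebra (𝓡 d) G))}
  {lam : Module.Dual ℝ 𝔭} {X : Module.Basis (Fin n₁) ℝ 𝔭} {A : Module.Basis (Fin n₂) ℝ 𝔪}
  {J : Fin n₂ ↪o Fin n₁} {O : Set (Fin n₂ → ℝ)} {ε : ℝ}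

/-- The element of the lattice `Λ` with coordinates `z`. -/
def latticeVec (X : Module.Basis (Fin n₁) ℝ 𝔭) (J : Fin n₂ ↪o Fin n₁) (L : GL (Fin n₂) ℝ)
    (z : Fin n₂ → ℤ) : 𝔭 :=
  ∑ k, z k • ∑ i, (L : Matrix (Fin n₂) (Fin n₂) ℝ) i k • X (J i)

theorem mem_latticeP_iff (X : Module.Basis (Fin n₁) ℝ 𝔭) (J : Fin n₂ ↪o Fin n₁) (L : GL (Fin n₂) ℝ)
    (Y : 𝔭) : Y ∈ latticeP X J L ↔ ∃ z, latticeVec X J L z = Y :=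
  Submodule.mem_span_range_iff_exists_fun ℤ

theorem theta_latticeVec (A : Module.Basis (Fin n₂) ℝ 𝔪) (X : Module.Basis (Fin n₁) ℝ 𝔭)
    (lam : Module.Dual ℝ 𝔭) (J : Fin n₂ ↪o Fin n₁) (L : GL (Fin n₂) ℝ) (z : Fin n₂ → ℤ)
    (a : Fin n₂ → ℝ) : theta A X lam a (latticeVec X J L z) =
      ∑ k, z k * (dualBasis L).equivFun (beta A X lam J a) k := by
  rw [latticeVec, map_sum]
  refine Finset.sum_congr rfl fun k _ => ?_
  rw [map_zsmul, map_sum, dualBasis_equivFun, zsmul_eq_mul]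
  congr 1
  simp only [map_smul, smul_eq_mul, Matrix.mulVec, dotProduct, Matrix.transpose_apply]
  rfl

theorem isOpen_beta_openCube (hO : IsDiffeoOn (beta A X lam J) O) (hεO : closedCube n₂ ε ⊆ O) :
    IsOpen (beta A X lam J '' openCube n₂ ε) := by
  obtain ⟨-, hV, -, g, hg, hgl⟩ := hO
  have hSO : openCube n₂ ε ⊆ O := (openCube_subset_closedCube _ _).trans hεO
  have : beta A X lam J '' openCube n₂ ε = (beta A X lam J '' O) ∩ g ⁻¹' openCube n₂ ε := by
    ext ξ
    constructor
    · rintro ⟨a, ha, rfl⟩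
      refine ⟨⟨a, hSO ha, rfl⟩, ?_⟩
      rwa [mem_preimage, hgl (hSO ha)]
    · rintro ⟨⟨a, ha, rfl⟩, hga⟩
      rw [mem_preimage, hgl ha] at hga
      exact ⟨a, hga, rfl⟩
  rw [this]
  exact hg.continuousOn.isOpen_inter_preimage hV (isOpen_openCube _ _)

theorem lieExp_mem (hP : (P : Set G) = lieExp '' (𝔭 : Set (GroupLieAlgebra (𝓡 d) G))) (Y : 𝔭) :
    (lieExp (Y : GroupLieAlgebra (𝓡 d) G) : G) ∈ P := by
  rw [← SetLike.mem_coe, hP]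
  exact ⟨_, Y.2, rfl⟩

variable [T2Space G] [IsTopologicalGroup G] [P.Normal]

omit [IsTopologicalGroup G] in
theorem character_conjP (h : OrbitCoords (coadjoint X (lieAd_inv_mem hM X)) (projCoords J)
      (coordM hM A) (thetaVec A X lam) O) (hεO : closedCube n₂ ε ⊆ O)
    (hP : (P : Set G) = lieExp '' (𝔭 : Set (GroupLieAlgebra (𝓡 d) G))) {χ : P →ₜ* Circle}
    (hχ : ∀ (Y : 𝔭) (hY : lieExp (Y : GroupLieAlgebra (𝓡 d) G) ∈ P),
      χ ⟨lieExp (Y : GroupLieAlgebra (𝓡 d) G), hY⟩ = Circle.exp (2 * Real.pi * lam Y))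
    (L : GL (Fin n₂) ℝ) (z : Fin n₂ → ℤ) {m : M} (hm : m ∈ omegaOpen M A ε) :
    χ (conjP ⟨lieExp (latticeVec X J L z : GroupLieAlgebra (𝓡 d) G), lieExp_mem hP _⟩ m) =
      Circle.exp (2 * Real.pi * ∑ i, z i * (dualBasis L).equivFun (phi A X lam J ε m) i) := by
  rw [omegaOpen_eq_image hM] at hm
  obtain ⟨a, ha, rfl⟩ := hm
  have h₁ : conjP ⟨lieExp (latticeVec X J L z : GroupLieAlgebra (𝓡 d) G), lieExp_mem hP _⟩
      (coordM hM A a) = ⟨lieExp (opC A X a (latticeVec X J L z) : GroupLieAlgebra (𝓡 d) G),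
        lieExp_mem hP _⟩ := by
    apply Subtype.ext
    have h₂ := conj_lieExp (secondKind A a : G)⁻¹ (latticeVec X J L z : GroupLieAlgebra (𝓡 d) G)
    rw [inv_inv, lieAd_secondKind_inv X A a] at h₂
    exact h₂
  rw [h₁, hχ, phi_coordM h hεO ha, ← theta_latticeVec]
  rfl

omit [IsTopologicalGroup G] in
theorem exists_equiv_gammaSet (h : OrbitCoords (coadjoint X (lieAd_inv_mem hM X)) (projCoords J)
      (coordM hM A) (thetaVec A X lam) O) (hε : 0 < ε) (hεO : closedCube n₂ ε ⊆ O)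
    (hPM : P.IsComplement' M)
    (hP : (P : Set G) = lieExp '' (𝔭 : Set (GroupLieAlgebra (𝓡 d) G))) {χ : P →ₜ* Circle}
    (hχ : ∀ (Y : 𝔭) (hY : lieExp (Y : GroupLieAlgebra (𝓡 d) G) ∈ P),
      χ ⟨lieExp (Y : GroupLieAlgebra (𝓡 d) G), hY⟩ = Circle.exp (2 * Real.pi * lam Y))
    (L : GL (Fin n₂) ℝ) (ΓM : Set M) :
    ∃ e : ΓM × (Fin n₂ → ℤ) ≃ gammaSet X J L ΓM, ∀ q, (e q : G) =
      ((q.1 : M) : G)⁻¹ * lieExp (latticeVec X J L q.2 : GroupLieAlgebra (𝓡 d) G) := by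
  have hmem : ∀ q : ΓM × (Fin n₂ → ℤ), ((q.1 : M) : G)⁻¹ *
      lieExp (latticeVec X J L q.2 : GroupLieAlgebra (𝓡 d) G) ∈ gammaSet X J L ΓM := fun q =>
    Set.mul_mem_mul (by
      rw [Set.mem_inv, inv_inv]
      exact ⟨q.1, q.1.2, rfl⟩) ⟨_, (mem_latticeP_iff X J L _).2 ⟨q.2, rfl⟩, rfl⟩
  refine ⟨Equiv.ofBijective (fun q => ⟨_, hmem q⟩) ⟨?_, ?_⟩, fun q => rfl⟩
  · rintro ⟨γ, z⟩ ⟨γ', z'⟩ hq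
    have h₁ : ((γ : M) : G)⁻¹ * lieExp (latticeVec X J L z : GroupLieAlgebra (𝓡 d) G) =
        ((γ' : M) : G)⁻¹ * lieExp (latticeVec X J L z' : GroupLieAlgebra (𝓡 d) G) :=
      congrArg Subtype.val hq
    have h₂ : ((γ' : M) : G) * ((γ : M) : G)⁻¹ =
        lieExp (latticeVec X J L z' : GroupLieAlgebra (𝓡 d) G) *
          (lieExp (latticeVec X J L z : GroupLieAlgebra (𝓡 d) G))⁻¹ := by
      rw [eq_mul_inv_iff_mul_eq, mul_assoc, h₁, mul_inv_cancel_left]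
    have h₃ : ((γ' : M) : G) * ((γ : M) : G)⁻¹ = 1 := by
      refine (Subgroup.disjoint_def.1 hPM.disjoint) ?_ (M.mul_mem (γ' : M).2 (M.inv_mem (γ : M).2))
      rw [h₂]
      exact P.mul_mem (lieExp_mem hP _) (P.inv_mem (lieExp_mem hP _))
    have h₄ : lieExp (latticeVec X J L z : GroupLieAlgebra (𝓡 d) G) =
        (lieExp (latticeVec X J L z' : GroupLieAlgebra (𝓡 d) G) : G) := by
      rw [h₂, mul_inv_eq_one] at h₃
      exact h₃.symm
    have hγ : γ = γ' := by
      apply Subtype.ext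
      apply Subtype.ext
      exact (mul_inv_eq_one.1 h₃).symm
    have hz : z = z' := by
      refine eq_of_circleExp_eq_on_open (dualBasis L) (isOpen_beta_openCube h.diffeo hεO)
        ⟨_, 0, zero_mem_openCube n₂ hε, rfl⟩ ?_
      rintro _ ⟨a, ha, rfl⟩
      have hm : coordM hM A a ∈ omegaOpen M A ε := ⟨a, ha, rfl⟩
      have h₅ := character_conjP h hεO hP hχ L z hm
      have h₆ := character_conjP h hεO hP hχ L z' hm
      rw [phi_coordM h hεO ha] at h₅ h₆
      rw [← h₅, ← h₆]
      congr 2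
      exact Subtype.ext h₄
    rw [hγ, hz]
  · rintro ⟨_, γ, hγ, p, ⟨Y, hY, rfl⟩, rfl⟩
    obtain ⟨m, hm, hmγ⟩ := hγ
    obtain ⟨z, rfl⟩ := (mem_latticeP_iff X J L Y).1 hY
    refine ⟨(⟨m, hm⟩, z), Subtype.ext ?_⟩
    have : γ = (m : G)⁻¹ := by rw [← inv_inv γ]; exact congrArg _ hmγ.symm
    exact congrArg (· * lieExp (latticeVec X J L z : GroupLieAlgebra (𝓡 d) G)) this.symm

end FrameOperator

section FrameIdentity

variable {d : ℕ} {G : Type*} [TopologicalSpace G] [ChartedSpace (EuclideanSpace ℝ (Fin d)) G]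
  [Group G] [LieGroup (𝓡 d) ∞ G] [T2Space G] [IsTopologicalGroup G] [MeasurableSpace G]
  [BorelSpace G] {P M : Subgroup G}
  {𝔪 : LieSubalgebra ℝ (GroupLieAlgebra (𝓡 d) G)} {𝔭 : LieIdeal ℝ (GroupLieAlgebra (𝓡 d) G)}
  {n₁ n₂ : ℕ} {hM : (M : Set G) = lieExp '' (𝔪 : Set (GroupLieAlgebra (𝓡 d) G))}
  {lam : Module.Dual ℝ 𝔭} {X : Module.Basis (Fin n₁) ℝ 𝔭} {A : Module.Basis (Fin n₂) ℝ 𝔪}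
  {J : Fin n₂ ↪o Fin n₁} {O : Set (Fin n₂ → ℝ)} {ε : ℝ} {μ : Measure M} {s : M → ℂ}

omit [IsTopologicalGroup G] [BorelSpace G] in
theorem enorm_upsilon_sq (h : OrbitCoords (coadjoint X (lieAd_inv_mem hM X)) (projCoords J)
      (coordM hM A) (thetaVec A X lam) O) (hεO : closedCube n₂ ε ⊆ O)
    (hψ : IsHaarDensity A X lam J ε μ (psi A X lam J ε μ)) (hsΩ : tsupport s ⊆ omegaOpen M A ε)
    (L : GL (Fin n₂) ℝ) (m : M) :
    ‖upsilon A X lam J ε μ L s m‖ₑ ^ 2 =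
      ENNReal.ofReal (covol (dualBasis L) * psi A X lam J ε μ (phi A X lam J ε m)) * ‖s m‖ₑ ^ 2 := by
  by_cases hm : m ∈ omegaOpen M A ε
  · have hpos : 0 < psi A X lam J ε μ (phi A X lam J ε m) :=
      hψ.2.1 _ (phi_image_omegaOpen h hεO ▸ mem_image_of_mem _ hm)
    rw [upsilon, enorm_mul, mul_pow, covol_dualBasis, ← ofReal_norm, Complex.norm_real,
      Real.norm_of_nonneg (Real.sqrt_nonneg _), ← ENNReal.ofReal_pow (Real.sqrt_nonneg _),
      Real.sq_sqrt (mul_nonneg hpos.le (abs_nonneg _)), mul_comm (psi A X lam J ε μ _)]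
  · have : s m = 0 := image_eq_zero_of_notMem_tsupport fun h => hm (hsΩ h)
    simp [upsilon, this]

omit [BorelSpace G] in
theorem continuous_upsilon (h : OrbitCoords (coadjoint X (lieAd_inv_mem hM X)) (projCoords J)
      (coordM hM A) (thetaVec A X lam) O) (hεO : closedCube n₂ ε ⊆ O)
    (hψ : IsHaarDensity A X lam J ε μ (psi A X lam J ε μ)) (hs : Continuous s)
    (hsΩ : tsupport s ⊆ omegaOpen M A ε) (L : GL (Fin n₂) ℝ) :
    Continuous (upsilon A X lam J ε μ L s) := by
  refine continuous_iff_continuousAt.2 fun m => ?_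
  by_cases hm : m ∈ omegaOpen M A ε
  · have h₁ : ContinuousOn (fun m => psi A X lam J ε μ (phi A X lam J ε m)) (omegaOpen M A ε) :=
      hψ.1.comp (continuousOn_phi h hεO)
        (by rw [← phi_image_omegaOpen h hεO]; exact mapsTo_image _ _)
    have h₂ := h₁.continuousAt ((isOpen_omegaOpen h hεO).mem_nhds hm)
    exact (Complex.continuous_ofReal.continuousAt.comp
      (Real.continuous_sqrt.continuousAt.comp (h₂.mul continuousAt_const))).mul hs.continuousAt
  · have h₁ : (tsupport s)ᶜ ∈ 𝓝 m :=
      (isClosed_tsupport s).isOpen_compl.mem_nhds fun h => hm (hsΩ h)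
    refine (continuousAt_const (y := (0 : ℂ))).congr ?_
    filter_upwards [h₁] with x hx
    simp [upsilon, image_eq_zero_of_notMem_tsupport hx]

variable [P.Normal] [SecondCountableTopology G] [LocallyCompactSpace M] [μ.IsHaarMeasure]

theorem tsum_inner_indRep (h : OrbitCoords (coadjoint X (lieAd_inv_mem hM X)) (projCoords J)
      (coordM hM A) (thetaVec A X lam) O) (hε : 0 < ε) (hεO : closedCube n₂ ε ⊆ O)
    (hPM : P.IsComplement' M)
    (hP : (P : Set G) = lieExp '' (𝔭 : Set (GroupLieAlgebra (𝓡 d) G))) {χ : P →ₜ* Circle}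
    (hχ : ∀ (Y : 𝔭) (hY : lieExp (Y : GroupLieAlgebra (𝓡 d) G) ∈ P),
      χ ⟨lieExp (Y : GroupLieAlgebra (𝓡 d) G), hY⟩ = Circle.exp (2 * Real.pi * lam Y))
    (hs : Continuous s) (hsc : HasCompactSupport s) (hs2 : MemLp s 2 μ)
    (hsΩ : tsupport s ⊆ omegaOpen M A ε) {L : GL (Fin n₂) ℝ} {F : Set (Fin n₂ → ℝ)}
    (hF : IsAddFundamentalDomain (dualLattice L) F volume)
    (hsF : phi A X lam J ε '' tsupport s ⊆ F) (γ : M) (f : Lp ℂ 2 μ) :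
    ∑' z : Fin n₂ → ℤ, ‖⟪f, indRep hPM χ μ ((γ : G)⁻¹ *
        lieExp (latticeVec X J L z : GroupLieAlgebra (𝓡 d) G)) (hs2.toLp s)⟫_ℂ‖ₑ ^ 2 =
      ∫⁻ m, ‖upsilon A X lam J ε μ L s (γ * m)‖ₑ ^ 2 * ‖f m‖ₑ ^ 2 ∂μ := by
  have : SecondCountableTopology M := TopologicalSpace.Subtype.secondCountableTopology _
  have hψ := isHaarDensity_psi h hε hεO μ
  have hΩ := (isOpen_omegaOpen h hεO).measurableSet
  have hV := isOpen_beta_openCube h.diffeo hεO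
  have himg := phi_image_omegaOpen h hεO
  classical
  let V := beta A X lam J '' openCube n₂ ε
  have hSO : openCube n₂ ε ⊆ O := (openCube_subset_closedCube _ _).trans hεO
  let r : (Fin n₂ → ℝ) → M := V.piecewise
    (fun ξ => coordM hM A (Function.invFunOn (beta A X lam J) O ξ)) (fun _ => 1)
  have hr : Measurable r := by
    refine ContinuousOn.measurable_piecewise ?_ continuousOn_const hV.measurableSet
    exact h.continuous_coord.comp_continuousOn (h.continuousOn_invFunOn.mono (image_mono hSO))
  have hrΦ : LeftInvOn r (phi A X lam J ε) (omegaOpen M A ε) := by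
    rw [omegaOpen_eq_image hM]
    rintro _ ⟨a, ha, rfl⟩
    rw [phi_coordM h hεO ha]
    have h₁ : beta A X lam J a ∈ V := mem_image_of_mem _ ha
    have h₂ : Function.invFunOn (beta A X lam J) O (beta A X lam J a) = a :=
      h.injOn_proj.leftInvOn_invFunOn (hSO ha)
    simp only [r, piecewise_eq_of_mem _ _ _ h₁, h₂]
  have hΨm : Measurable ((beta A X lam J '' openCube n₂ ε).indicator (psi A X lam J ε μ)) := by
    have := hψ.1.measurable_piecewise (g := 0) continuousOn_const hV.measurableSet
    rwa [piecewise_eq_indicator] at this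
  obtain ⟨C, hC⟩ : ∃ C, ∀ m ∈ tsupport s, psi A X lam J ε μ (phi A X lam J ε m) ≤ C := by
    have h₁ : ContinuousOn (fun m => psi A X lam J ε μ (phi A X lam J ε m)) (tsupport s) :=
      hψ.1.comp ((continuousOn_phi h hεO).mono hsΩ)
        (by rw [← himg]; exact fun m hm => mem_image_of_mem _ (hsΩ hm))
    obtain ⟨C, hC⟩ := (hsc.isCompact.image_of_continuousOn h₁).bddAbove
    exact ⟨C, fun m hm => hC (mem_image_of_mem _ hm)⟩
  have hfm : Measurable f := (Lp.stronglyMeasurable f).measurable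
  let g : M → ℂ := fun m => s m * (starRingEnd ℂ) (f (γ⁻¹ * m))
  have hfγ : MemLp (fun m => f (γ⁻¹ * m)) 2 μ :=
    (Lp.memLp f).comp_measurePreserving (measurePreserving_mul_left μ γ⁻¹)
  have hgm : Measurable g := hs.measurable.mul
    (Complex.continuous_conj.measurable.comp (hfm.comp (measurable_const_mul _)))
  have hg2 : MemLp g 2 μ := by
    obtain ⟨B, hB⟩ := hs.bounded_above_of_compact_support hsc
    refine (hfγ.const_mul (B : ℂ)).of_le hgm.aestronglyMeasurable (Eventually.of_forall fun m => ?_)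
    have hB0 : 0 ≤ B := (norm_nonneg _).trans (hB m)
    rw [norm_mul, norm_mul, Complex.norm_real, Real.norm_of_nonneg hB0, RCLike.norm_conj]
    exact mul_le_mul_of_nonneg_right (hB m) (norm_nonneg _)
  have hg0 : ∀ m ∉ tsupport s, g m = 0 := fun m hm => by
    simp [g, image_eq_zero_of_notMem_tsupport hm]
  rw [dualLattice_eq] at hF
  have key := tsum_enorm_sq_integral (μ := μ) hΩ (continuousOn_phi h hεO).domRestrict.measurable
    hr hrΦ (Ψ := psi A X lam J ε μ) (by rw [himg]; exact hV.measurableSet) (by rwa [himg])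
    (by rw [himg]; exact fun ξ hξ => (hψ.2.1 ξ hξ).le) (by rw [himg]; exact hψ.2.2)
    (dualBasis L) hF hsΩ hsF hC hgm hg2 hg0
  have hi : ∀ z : Fin n₂ → ℤ, ⟪f, indRep hPM χ μ ((γ : G)⁻¹ *
        lieExp (latticeVec X J L z : GroupLieAlgebra (𝓡 d) G)) (hs2.toLp s)⟫_ℂ =
      ∫ m, Circle.coeHom (Circle.exp (2 * Real.pi *
        ∑ i, z i * (dualBasis L).equivFun (phi A X lam J ε m) i)) * g m ∂μ := fun z => by
    refine (inner_indRep hPM χ μ hs2 ⟨_, lieExp_mem hP (latticeVec X J L z)⟩ γ f).trans ?_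
    refine integral_congr_ae (Eventually.of_forall fun m => ?_)
    by_cases hm : m ∈ tsupport s
    · have := character_conjP h hεO hP hχ L z (hsΩ hm)
      simp only [this, g]
    · have := hg0 m hm
      simp only [g] at this ⊢
      rw [this, mul_zero, mul_zero]
  simp only [hi]
  rw [key, ← lintegral_mul_left_eq_self _ γ]
  refine lintegral_congr fun m => ?_
  rw [enorm_upsilon_sq h hεO hψ hsΩ, mul_assoc]
  congr 1
  simp only [g, inv_mul_cancel_left, enorm_mul, mul_pow]
  congr 2
  exact RCLike.enorm_conj _

end FrameIdentity

end

end SolvFrame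

open SolvFrame in
theorem theorem2
    -- a connected, simply connected, completely solvable Lie group
    {d : ℕ} {G : Type*} [TopologicalSpace G] [ChartedSpace (EuclideanSpace ℝ (Fin d)) G]
    [Group G] [LieGroup (𝓡 d) ∞ G] [IsTopologicalGroup G] [T2Space G] [SimplyConnectedSpace G]
    [MeasurableSpace G] [BorelSpace G]
    (hG : IsCompletelySolvable (GroupLieAlgebra (𝓡 d) G))
    -- `G = P ⋊ M` with `P = exp 𝔭`, `M = exp 𝔪` closed
    (P M : Subgroup G) [P.Normal] (hPc : IsClosed (P : Set G)) (hMc : IsClosed (M : Set G))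
    (hPM : P.IsComplement' M)
    (𝔭 : LieIdeal ℝ (GroupLieAlgebra (𝓡 d) G)) (𝔪 : LieSubalgebra ℝ (GroupLieAlgebra (𝓡 d) G))
    (h𝔭𝔪 : IsCompl 𝔭.toSubmodule 𝔪.toSubmodule)
    (hP : (P : Set G) = lieExp '' (𝔭 : Set (GroupLieAlgebra (𝓡 d) G)))
    (hM : (M : Set G) = lieExp '' (𝔪 : Set (GroupLieAlgebra (𝓡 d) G)))
    (μ : Measure M) [μ.IsHaarMeasure]
    -- the unitary character `χ_λ (exp Y) = e^{2πi λ(Y)}` of `P`, and `π_λ` irreducible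
    (lam : Module.Dual ℝ 𝔭) (χ : P →ₜ* Circle)
    (hχ : ∀ (Y : 𝔭) (hY : lieExp (Y : GroupLieAlgebra (𝓡 d) G) ∈ P),
      χ ⟨lieExp (Y : GroupLieAlgebra (𝓡 d) G), hY⟩ = Circle.exp (2 * Real.pi * lam Y))
    (hirr : IsIrreducibleRep (indRep hPM χ μ))
    -- strong Malcev bases, the index set `J(λ)`, the neighbourhood `O` and `ε`
    {n₁ n₂ : ℕ} (X : Module.Basis (Fin n₁) ℝ 𝔭) (hX : IsStrongMalcev X)
    (A : Module.Basis (Fin n₂) ℝ 𝔪) (hA : IsStrongMalcev A)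
    (J : Fin n₂ ↪o Fin n₁) (hJ : ((jacZero A X lam).submatrix J id).det ≠ 0)
    (O : Set (Fin n₂ → ℝ)) (hO0 : 0 ∈ O) (hO : IsDiffeoOn (beta A X lam J) O)
    (ε : ℝ) (hε : 0 < ε) (hεO : closedCube n₂ ε ⊆ O)
    -- the smooth function `s`, the operator `L` and the set `Γ_M`
    (s : M → ℂ) (hs : IsSmoothFun d s) (hsc : HasCompactSupport s)
    (hsΩ : tsupport s ⊆ omegaOpen M A ε)
    (L : GL (Fin n₂) ℝ)
    (hL : ∃ F : Set (Fin n₂ → ℝ), IsAddFundamentalDomain (dualLattice L) F volume ∧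
      phi A X lam J ε '' tsupport s ⊆ F)
    (ΓM : Set M) (hΓM : IsDiscrete ΓM)
    (hinf : 0 < ⨅ m, upsilonSum A X lam J ε μ L s ΓM m)
    (hsup : ⨆ m, upsilonSum A X lam J ε μ L s ΓM m < ⊤) :
    let sL2 : Lp ℂ 2 μ := (hs.continuous.memLp_of_hasCompactSupport hsc).toLp s
    let system : gammaSet X J L ΓM → Lp ℂ 2 μ := fun κ => indRep hPM χ μ (κ : G) sL2
    IsFrame system ∧
    IsGreatest {a | IsLowerFrameBound system a}
      (⨅ m, upsilonSum A X lam J ε μ L s ΓM m).toReal ∧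
    IsLeast {b | IsUpperFrameBound system b}
      (⨆ m, upsilonSum A X lam J ε μ L s ΓM m).toReal := by
  intro sL2 system
  have hOC := orbitCoords_coordM hPM h𝔭𝔪 hP hM lam X A J hO0 hO
  have : LocallyCompactSpace G := ChartedSpace.locallyCompactSpace (EuclideanSpace ℝ (Fin d)) G
  have : SigmaCompactSpace G := sigmaCompactSpace_of_connected G
  have : SecondCountableTopology G :=
    ChartedSpace.secondCountable_of_sigmaCompact (EuclideanSpace ℝ (Fin d)) G
  have : LocallyCompactSpace M := hMc.isClosedEmbedding_subtypeVal.locallyCompactSpace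
  have : SigmaCompactSpace M := hMc.isClosedEmbedding_subtypeVal.sigmaCompactSpace
  have hψ := isHaarDensity_psi hOC hε hεO μ
  obtain ⟨F, hF, hsF⟩ := hL
  have hg : Continuous fun m => ‖upsilon A X lam J ε μ L s m‖ₑ ^ 2 :=
    (ENNReal.continuous_pow 2).comp
      (continuous_enorm.comp (continuous_upsilon hOC hεO hψ hs.continuous hsΩ L))
  have hsum : ∀ m, ∑' γ : ΓM, ‖upsilon A X lam J ε μ L s (γ * m)‖ₑ ^ 2 ≠ ⊤ := fun m =>
    ((le_iSup (upsilonSum A X lam J ε μ L s ΓM) m).trans_lt hsup).ne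
  obtain ⟨m₀, hm₀⟩ : ∃ m₀, ‖upsilon A X lam J ε μ L s m₀‖ₑ ^ 2 ≠ 0 := by
    by_contra! h
    refine (hinf.trans_le (iInf_le _ 1)).ne' ?_
    simp only [upsilonSum, h, tsum_zero]
  have hcont : Continuous (upsilonSum A X lam J ε μ L s ΓM) :=
    continuous_tsum_mul_left hg hsc.isCompact
      (fun m hm => by simp [upsilon, image_eq_zero_of_notMem_tsupport hm]) hm₀ hsum
  have : Countable ΓM := (countable_of_tsum_ne_top hg hm₀ hsum).to_subtype
  refine frame_of_multiplier hcont (fun f => ?_) hinf hsup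
  obtain ⟨e, he⟩ := exists_equiv_gammaSet hOC hε hεO hPM hP hχ L ΓM
  rw [← e.tsum_eq]
  simp only [system, he]
  rw [ENNReal.tsum_prod']
  have hrow : ∀ γ : ΓM, _ := fun γ => tsum_inner_indRep hOC hε hεO hPM hP hχ hs.continuous hsc
    (hs.continuous.memLp_of_hasCompactSupport hsc) hsΩ hF hsF (γ : M) f
  simp only [sL2, hrow]
  rw [← lintegral_tsum fun γ => ?_]
  · refine lintegral_congr fun m => ?_
    rw [upsilonSum, ENNReal.tsum_mul_right]
  · exact ((hg.comp (continuous_const_mul (γ : M))).measurable.mul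
      ((Lp.stronglyMeasurable f).measurable.enorm.pow_const 2)).aemeasurable
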